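/- **Theorem (presentation of the inertia subgroup).** Let $n\ge 2$. Let ${\rm Pauli}_n=\langle X_1,\dots,X_n,Z_1,\dots,Z_n,\,i\,I\rangle\subset U(2^n)$ be the $n$-qubit Pauli group, ${\rm Cliff}_n$ its normalizer in $U(2^n)$, $\mathcal C_n$ the quotient of ${\rm Cliff}_n$ by the scalar matrices that it contains, with the product written from left to right (so $uv$ is the class of the matrix product $VU$ when $u=[U]$, $v=[V]$), and $\mathcal P_n$ the image of ${\rm Pauli}_n$ in $\mathcal C_n$. Let $h_i$, $s_i$ ($1\le i\le n$) and $\Lambda_k$ ($1\le k\le n-1$) be the classes in $\mathcal C_n$ of the Hadamard gate on qubit $i$, the phase gate $S={\rm diag}(1,i)$ on qubit $i$, and the controlled-$Z$ gate on qubits $k,k+1$. Put $g=h_1s_1h_1s_1^3h_1$ and $M=h_2\Lambda_1s_2^2h_2h_1s_1^2h_2\Lambda_1h_2$. Let $\mathcal{IN}_n$ be the subgroup $\langle h_1,h_2,s_2,h_1s_1^2h_1,M\rangle$ of $\mathcal C_n$ if $n=2$, and $\langle h_1,\dots,h_n,s_2,\dots,s_n,M,\Lambda_2,\dots,\Lambda_{n-1}\rangle$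 if $n\ge3$. 1. In $\mathcal C_n$, $${\rm Cent}(s_1^2)=\langle g,h_2,\dots,h_n,s_1,\dots,s_n,\Lambda_1,\dots,\Lambda_{n-1}\rangle,\qquad {\rm Cent}(s_1)=\langle h_2,\dots,h_n,s_1,\dots,s_n,\Lambda_1,\dots,\Lambda_{n-1}\rangle ,$$ and ${\rm Cent}(s_1^2)$ is the internal semidirect product $\langle g\rangle\ltimes{\rm Cent}(s_1)$ with normal factor ${\rm Cent}(s_1)$. 2. $\mathcal{IN}_n\cong{\rm Cent}(s_1^2)$, and the inertia subgroup in $\mathcal C_n$ of every non-trivial irreducible complex representation of $\mathcal P_n$ is isomorphic to ${\rm Cent}(s_1^2)$. 3. ${\rm Cent}(s_1^2)$ is presented by the generators $g$, $h_i$ ($2\le i\le n$), $s_j$ ($1\le j\le n$), $\Lambda_k$ ($1\le k\le n-1$) (each symbol standing for the element of the same name) and the following relations, in which the indices run over all values for which the generators exist, unless restricted: - (Q1) $g^2=1$. - (Q2) $gh_ig=h_i$. - (Q3) $gs_1g=s_1^3$, and $gs_jg=s_j$ for $j\ne1$. - (Q4) $g\Lambda_1g=\Lambda_1s_2^2$,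 and $g\Lambda_kg=\Lambda_k$ for $k\neq1$. - (R1) $h_i^2=s_j^4=\Lambda_k^2=1$. - (R2) $(s_ih_i)^3=1$ for $2\le i\le n$. - (R3) $(s_i^3h_is_ih_i)^3=1$ for $2\le i\le n$. - (R4) $(s_i^2h_is_i^2h_i)^2=1$ for $2\le i\le n$. - (R5) $h_ih_{i'}=h_{i'}h_i$, $s_js_{j'}=s_{j'}s_j$, $\Lambda_k\Lambda_{k'}=\Lambda_{k'}\Lambda_k$. - (R6) $\Lambda_ks_j=s_j\Lambda_k$. - (R7) $\Lambda_kh_i=h_i\Lambda_k$ for $i\notin\{k,k+1\}$. - (R8) $h_is_i^2h_i\Lambda_i=\Lambda_ih_is_{i+1}^2s_i^2h_i$ for $2\le i\le n-1$. - (R9) $h_{i+1}s_{i+1}^2h_{i+1}\Lambda_i=\Lambda_ih_{i+1}s_{i+1}^2s_i^2h_{i+1}$ for $1\le i\le n-1$. - (R10) $\Lambda_ih_i\Lambda_i=s_ih_i\Lambda_is_{i+1}s_ih_is_i$ for $2\le i\le n-1$. - (R11) $\Lambda_jh_{j+1}\Lambda_j=s_{j+1}h_{j+1}\Lambda_js_{j+1}s_jh_{j+1}s_{j+1}$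 for $1\le j\le n-1$. - (R12) $\Lambda_jh_{j+1}h_j\Lambda_jh_{j+2}h_{j+1}\Lambda_{j+1}h_{j+2}h_{j+1}\Lambda_jh_{j+1}h_j\Lambda_j=\Lambda_{j+1}h_{j+2}h_{j+1}\Lambda_{j+1}h_{j+1}h_j\Lambda_jh_{j+1}h_j\Lambda_{j+1}h_{j+2}h_{j+1}\Lambda_{j+1}$ for $2\le j\le n-2$. - (R13) $(\Lambda_jh_{j+1}h_j\Lambda_jh_{j+1}h_j\Lambda_{j+1})^3=1$ for $2\le j\le n-2$. - (R14) $(\Lambda_{j+1}h_{j+2}h_{j+1}\Lambda_{j+1}h_{j+2}h_{j+1}\Lambda_j)^3=1$ for $1\le j\le n-2$. Consequently $\mathcal{IN}_n$, and the inertia subgroup of every non-trivial irreducible representation of $\mathcal P_n$, is isomorphic to the group with this presentation. -/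

import Mathlib

noncomputable section

/- ### Gates on `n` qubits -/

/-- Unitary `2^n × 2^n` matrices; the rows and columns are indexed by bit strings of length `n`. -/
abbrev UnitaryN (n : ℕ) : Type := Matrix.unitaryGroup (Fin n → Fin 2) ℂ

/-- The tensor product `A 0 ⊗ A 1 ⊗ ⋯ ⊗ A (n-1)` of `2 × 2` matrices. -/
def tensorMat {n : ℕ} (A : Fin n → Matrix (Fin 2) (Fin 2) ℂ) :
    Matrix (Fin n → Fin 2) (Fin n → Fin 2) ℂ :=
  Matrix.of fun a b => ∏ j, A j (a j) (b j)

/-- `I ⊗ ⋯ ⊗ I ⊗ A ⊗ I ⊗ ⋯ ⊗ I`, with `A` in position `i`. -/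
def onQubitMat {n : ℕ} (i : Fin n) (A : Matrix (Fin 2) (Fin 2) ℂ) :
    Matrix (Fin n → Fin 2) (Fin n → Fin 2) ℂ :=
  tensorMat (Function.update (fun _ => 1) i A)

/-- The controlled `Z` gate with control qubit `p` and target qubit `q`. -/
def czMat {n : ℕ} (p q : Fin n) : Matrix (Fin n → Fin 2) (Fin n → Fin 2) ℂ :=
  Matrix.diagonal fun a => if a p = 1 ∧ a q = 1 then -1 else 1

theorem tensorMat_mul {n : ℕ} (A B : Fin n → Matrix (Fin 2) (Fin 2) ℂ) :
    tensorMat A * tensorMat B = tensorMat fun j => A j * B j := by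
  ext a b
  simp only [tensorMat, Matrix.mul_apply, Matrix.of_apply, ← Finset.prod_mul_distrib]
  rw [Finset.prod_univ_sum, Fintype.piFinset_univ]

theorem tensorMat_one {n : ℕ} : tensorMat (fun _ : Fin n => 1) = 1 := by
  ext a b
  simp only [tensorMat, Matrix.of_apply, Matrix.one_apply, Finset.prod_boole, Finset.mem_univ,
    true_implies, funext_iff]

theorem onQubitMat_mul {n : ℕ} (i : Fin n) (A B : Matrix (Fin 2) (Fin 2) ℂ) :
    onQubitMat i A * onQubitMat i B = onQubitMat i (A * B) := by
  rw [onQubitMat, onQubitMat, tensorMat_mul, onQubitMat]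
  congr 1
  funext j
  by_cases h : j = i
  · subst h; simp
  · simp [h]

theorem onQubitMat_one {n : ℕ} (i : Fin n) : onQubitMat i 1 = 1 := by
  rw [onQubitMat, ← tensorMat_one]
  congr 1
  funext j
  by_cases h : j = i
  · subst h; simp
  · simp [h]

theorem onQubitMat_comm {n : ℕ} {i j : Fin n} (hij : i ≠ j) (A B : Matrix (Fin 2) (Fin 2) ℂ) :
    onQubitMat i A * onQubitMat j B = onQubitMat j B * onQubitMat i A := by
  simp only [onQubitMat, tensorMat_mul]
  congr 1
  funext k
  by_cases h : k = i
  · subst h; simp [hij]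
  · simp [h]

theorem star_onQubitMat {n : ℕ} (i : Fin n) (A : Matrix (Fin 2) (Fin 2) ℂ) :
    star (onQubitMat i A) = onQubitMat i (star A) := by
  ext a b
  simp only [onQubitMat, tensorMat, Matrix.star_apply, Matrix.of_apply, star_prod]
  refine Finset.prod_congr rfl fun j _ => ?_
  by_cases h : j = i
  · subst h; simp
  · simp [h, Matrix.one_apply, eq_comm, apply_ite star]

theorem onQubitMat_apply {n : ℕ} (i : Fin n) (A : Matrix (Fin 2) (Fin 2) ℂ)
    (a b : Fin n → Fin 2) :
    onQubitMat i A a b = if ∀ j, j ≠ i → a j = b j then A (a i) (b i) else 0 := by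
  rw [onQubitMat, tensorMat, Matrix.of_apply, ← Finset.mul_prod_erase _ _ (Finset.mem_univ i)]
  have : ∀ j ∈ Finset.univ.erase i,
      (Function.update (fun _ => 1) i A : Fin n → Matrix (Fin 2) (Fin 2) ℂ) j (a j) (b j)
        = if a j = b j then 1 else 0 := by
    intro j hj
    rw [Function.update_of_ne (Finset.ne_of_mem_erase hj), Matrix.one_apply]
  rw [Finset.prod_congr rfl this, Finset.prod_boole]
  simp

/-- The one-qubit unitary `A` acting on the `i`-th of `n` qubits. -/
def onQubit {n : ℕ} (i : Fin n) : Matrix.unitaryGroup (Fin 2) ℂ →* UnitaryN n where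
  toFun A := ⟨onQubitMat i A, by
    rw [Matrix.mem_unitaryGroup_iff, star_onQubitMat, onQubitMat_mul,
      Matrix.mem_unitaryGroup_iff.1 A.2, onQubitMat_one]⟩
  map_one' := Subtype.ext (onQubitMat_one i)
  map_mul' A B := Subtype.ext (onQubitMat_mul i A B).symm

theorem onQubit_comm {n : ℕ} {i j : Fin n} (hij : i ≠ j) (A B : Matrix.unitaryGroup (Fin 2) ℂ) :
    onQubit i A * onQubit j B = onQubit j B * onQubit i A :=
  Subtype.ext (onQubitMat_comm hij A B)

/-- The `Z` gate. -/
def gateZ : Matrix.unitaryGroup (Fin 2) ℂ := ⟨!![1, 0; 0, -1], by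
  rw [Matrix.mem_unitaryGroup_iff]
  ext i j; fin_cases i <;> fin_cases j <;> simp [Matrix.mul_apply, Fin.sum_univ_two]⟩

/-- The `X` gate. -/
def gateX : Matrix.unitaryGroup (Fin 2) ℂ := ⟨!![0, 1; 1, 0], by
  rw [Matrix.mem_unitaryGroup_iff]
  ext i j; fin_cases i <;> fin_cases j <;> simp [Matrix.mul_apply, Fin.sum_univ_two]⟩

/-- The phase gate `S = diag(1, i)`. -/
def gateS : Matrix.unitaryGroup (Fin 2) ℂ := ⟨!![1, 0; 0, Complex.I], by
  rw [Matrix.mem_unitaryGroup_iff]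
  ext i j; fin_cases i <;> fin_cases j <;> simp [Matrix.mul_apply, Fin.sum_univ_two]⟩

theorem inv_sqrt_two_mul_self :
    ((Real.sqrt 2 : ℂ))⁻¹ * ((Real.sqrt 2 : ℂ))⁻¹ = 1 / 2 := by
  rw [← mul_inv, ← Complex.ofReal_mul, Real.mul_self_sqrt (by norm_num)]
  norm_num

/-- The Hadamard gate. -/
def gateH : Matrix.unitaryGroup (Fin 2) ℂ :=
  ⟨((Real.sqrt 2 : ℂ))⁻¹ • !![1, 1; 1, -1], by
    rw [Matrix.mem_unitaryGroup_iff]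
    ext i j; fin_cases i <;> fin_cases j <;>
      simp [Matrix.mul_apply, Fin.sum_univ_two, inv_sqrt_two_mul_self] <;> norm_num⟩

/-- The controlled `Z` gate as a unitary matrix. -/
def gateCZ {n : ℕ} (p q : Fin n) : UnitaryN n := ⟨czMat p q, by
  rw [Matrix.mem_unitaryGroup_iff, czMat, Matrix.star_eq_conjTranspose,
    Matrix.diagonal_conjTranspose, Matrix.diagonal_mul_diagonal, ← Matrix.diagonal_one]
  congr 1
  funext a
  by_cases h : a p = 1 ∧ a q = 1 <;> simp [h]⟩

/-- The scalar matrix `i • 1`. -/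
def phaseI (n : ℕ) : UnitaryN n := ⟨Complex.I • 1, by
  rw [Matrix.mem_unitaryGroup_iff]
  simp [smul_smul]⟩

/- ### The Pauli group, the Clifford group, and their projective versions -/

/-- The `n`-qubit Pauli group `⟨X_1, …, X_n, Z_1, …, Z_n, i⟩`. -/
def PauliGroup (n : ℕ) : Subgroup (UnitaryN n) :=
  Subgroup.closure
    (Set.range (fun i : Fin n => onQubit i gateX) ∪ Set.range (fun i : Fin n => onQubit i gateZ)
      ∪ {phaseI n})

/-- The `n`-qubit Clifford group: the normalizer of the Pauli group in the unitary group. -/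
def CliffordGroup (n : ℕ) : Subgroup (UnitaryN n) :=
  Subgroup.normalizer (PauliGroup n : Set (UnitaryN n))

/-- The global phases in the Clifford group. -/
def phases (n : ℕ) : Subgroup (CliffordGroup n) where
  carrier := {U | ∃ c : ℂ, ((U : UnitaryN n) : Matrix (Fin n → Fin 2) (Fin n → Fin 2) ℂ) = c • 1}
  one_mem' := ⟨1, by simp⟩
  mul_mem' := by
    rintro U V ⟨c, hc⟩ ⟨d, hd⟩
    exact ⟨c * d, by simp [hc, hd, smul_smul, mul_comm]⟩
  inv_mem' := by
    rintro U ⟨c, hc⟩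
    exact ⟨star c, by simp [hc]⟩

instance phases_normal (n : ℕ) : (phases n).Normal where
  conj_mem := by
    rintro U ⟨c, hc⟩ V
    refine ⟨c, ?_⟩
    have hV := Matrix.mem_unitaryGroup_iff.1 (V : UnitaryN n).2
    simp [hc, hV]

/-- The `n`-qubit projective Clifford group. Its product is written from left to right, as for
quantum circuits: `u * v` is the class of the matrix product `V * U`. -/
abbrev ProjClifford (n : ℕ) : Type := (CliffordGroup n ⧸ phases n)ᵐᵒᵖ

/-- The class in the projective Clifford group of a Clifford operator. -/
def projClass {n : ℕ} (U : UnitaryN n) (hU : U ∈ CliffordGroup n) : ProjClifford n :=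
  MulOpposite.op (QuotientGroup.mk ⟨U, hU⟩)

/-- The projective Pauli group: the image of the Pauli group in the projective Clifford group. -/
def ProjPauli (n : ℕ) : Subgroup (ProjClifford n) :=
  (((PauliGroup n).subgroupOf (CliffordGroup n)).map (QuotientGroup.mk' (phases n))).op

instance projPauli_normal (n : ℕ) : (ProjPauli n).Normal := by
  have h : ((PauliGroup n).subgroupOf (CliffordGroup n)).Normal :=
    Subgroup.normal_in_normalizer
  exact (h.map _ (QuotientGroup.mk'_surjective _)).op

/- ### The generating gates are Clifford operators -/

theorem onQubit_X_mem {n : ℕ} (i : Fin n) : onQubit i gateX ∈ PauliGroup n :=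
  Subgroup.subset_closure (Or.inl (Or.inl ⟨i, rfl⟩))

theorem onQubit_Z_mem {n : ℕ} (i : Fin n) : onQubit i gateZ ∈ PauliGroup n :=
  Subgroup.subset_closure (Or.inl (Or.inr ⟨i, rfl⟩))

theorem phaseI_mem (n : ℕ) : phaseI n ∈ PauliGroup n :=
  Subgroup.subset_closure (Or.inr rfl)

theorem phaseI_comm {n : ℕ} (U : UnitaryN n) : U * phaseI n = phaseI n * U :=
  Subtype.ext (by simp [phaseI])

/-- A unitary of finite order that conjugates the `X_i` and `Z_i` into the Pauli group is a
Clifford operator. -/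
theorem mem_cliffordGroup {n : ℕ} (U : UnitaryN n) (m : ℕ) (hm : U ^ (m + 1) = 1)
    (hX : ∀ i, U * onQubit i gateX * U⁻¹ ∈ PauliGroup n)
    (hZ : ∀ i, U * onQubit i gateZ * U⁻¹ ∈ PauliGroup n) : U ∈ CliffordGroup n := by
  have h1 : ∀ P ∈ PauliGroup n, U * P * U⁻¹ ∈ PauliGroup n := by
    intro P hP
    have hle : PauliGroup n ≤ (PauliGroup n).comap (MulAut.conj U).toMonoidHom := by
      conv_lhs => rw [PauliGroup]
      rw [Subgroup.closure_le]
      rintro _ ((⟨i, rfl⟩ | ⟨i, rfl⟩) | rfl)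
      · exact hX i
      · exact hZ i
      · change U * phaseI n * U⁻¹ ∈ PauliGroup n
        rw [phaseI_comm, mul_inv_cancel_right]
        exact phaseI_mem n
    exact hle hP
  have h2 : ∀ k : ℕ, ∀ P ∈ PauliGroup n, U ^ k * P * (U ^ k)⁻¹ ∈ PauliGroup n := by
    intro k
    induction k with
    | zero => intro P hP; simpa using hP
    | succ k ih =>
      intro P hP
      have := h1 _ (ih P hP)
      rw [pow_succ', _root_.mul_inv_rev]
      simpa only [mul_assoc] using this
  have hinv : U ^ m = U⁻¹ := by
    rw [pow_succ] at hm
    exact eq_inv_of_mul_eq_one_left hm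
  refine Subgroup.mem_normalizer_iff.2 fun P => ⟨h1 P, fun hP => ?_⟩
  have := h2 m _ hP
  rw [hinv] at this
  simpa [mul_assoc] using this

theorem gateH_mul_self : gateH * gateH = 1 := by
  apply Subtype.ext
  ext i j; fin_cases i <;> fin_cases j <;>
    simp [gateH, inv_sqrt_two_mul_self] <;> norm_num

theorem gateH_conj_X : gateH * gateX * gateH⁻¹ = gateZ := by
  rw [mul_inv_eq_iff_eq_mul]
  apply Subtype.ext
  ext i j; fin_cases i <;> fin_cases j <;>
    simp [gateH, gateX, gateZ]

theorem gateH_conj_Z : gateH * gateZ * gateH⁻¹ = gateX := by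
  rw [mul_inv_eq_iff_eq_mul]
  apply Subtype.ext
  ext i j; fin_cases i <;> fin_cases j <;>
    simp [gateH, gateX, gateZ]

theorem gateS_pow_four : gateS ^ 4 = 1 := by
  apply Subtype.ext
  ext i j; fin_cases i <;> fin_cases j <;>
    simp [gateS, pow_succ]

theorem gateS_conj_Z : gateS * gateZ * gateS⁻¹ = gateZ := by
  rw [mul_inv_eq_iff_eq_mul]
  apply Subtype.ext
  ext i j; fin_cases i <;> fin_cases j <;>
    simp [gateS, gateZ]

theorem gateS_conj_X {n : ℕ} (i : Fin n) :
    onQubit i gateS * onQubit i gateX * (onQubit i gateS)⁻¹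
      = phaseI n * (onQubit i gateX * onQubit i gateZ) := by
  rw [mul_inv_eq_iff_eq_mul, ← map_mul, ← map_mul, mul_assoc, ← map_mul]
  apply Subtype.ext
  change onQubitMat i ↑(gateS * gateX) = (Complex.I • 1) * onQubitMat i ↑(gateX * gateZ * gateS)
  ext a b
  have key : ∀ x y : Fin 2, (gateS * gateX : Matrix.unitaryGroup (Fin 2) ℂ).1 x y
      = Complex.I * (gateX * gateZ * gateS : Matrix.unitaryGroup (Fin 2) ℂ).1 x y := by
    intro x y
    fin_cases x <;> fin_cases y <;>
      simp [gateS, gateX, gateZ]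
  rw [Matrix.smul_mul, Matrix.one_mul, Matrix.smul_apply, onQubitMat_apply, onQubitMat_apply,
    smul_eq_mul, key]
  split_ifs <;> simp

theorem gateCZ_mul_self {n : ℕ} (p q : Fin n) : gateCZ p q * gateCZ p q = 1 := by
  apply Subtype.ext
  change czMat p q * czMat p q = 1
  rw [czMat, Matrix.diagonal_mul_diagonal, ← Matrix.diagonal_one]
  congr 1
  funext a
  by_cases h : a p = 1 ∧ a q = 1 <;> simp [h]

theorem gateCZ_comm {n : ℕ} (p q : Fin n) : gateCZ p q = gateCZ q p := by
  apply Subtype.ext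
  change czMat p q = czMat q p
  simp only [czMat, and_comm]

theorem onQubit_Z_eq {n : ℕ} (i : Fin n) :
    (onQubit i gateZ : UnitaryN n).1 = Matrix.diagonal fun a => if a i = 1 then -1 else 1 := by
  change onQubitMat i gateZ = _
  ext a b
  rw [onQubitMat_apply, Matrix.diagonal_apply]
  by_cases hab : a = b
  · subst hab
    have : ∀ x : Fin 2, gateZ.1 x x = if x = 1 then -1 else 1 := by
      intro x; fin_cases x <;> simp [gateZ]
    simp [this]
  · rw [if_neg hab]
    split_ifs with h
    · have hi : a i ≠ b i := fun hi => hab (funext fun j => by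
        by_cases hj : j = i
        · rw [hj, hi]
        · exact h j hj)
      have : ∀ x y : Fin 2, x ≠ y → gateZ.1 x y = 0 := by
        intro x y; fin_cases x <;> fin_cases y <;> simp [gateZ]
      exact this _ _ hi
    · rfl

theorem gateCZ_conj_Z {n : ℕ} (p q i : Fin n) :
    gateCZ p q * onQubit i gateZ * (gateCZ p q)⁻¹ = onQubit i gateZ := by
  rw [mul_inv_eq_iff_eq_mul]
  apply Subtype.ext
  change czMat p q * (onQubit i gateZ : UnitaryN n).1 = (onQubit i gateZ : UnitaryN n).1 * czMat p q
  rw [onQubit_Z_eq, czMat, Matrix.diagonal_mul_diagonal, Matrix.diagonal_mul_diagonal]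
  simp only [mul_comm]

theorem gateCZ_conj_X_left {n : ℕ} {p q : Fin n} (hpq : p ≠ q) :
    gateCZ p q * onQubit p gateX * (gateCZ p q)⁻¹ = onQubit p gateX * onQubit q gateZ := by
  rw [mul_inv_eq_iff_eq_mul]
  apply Subtype.ext
  change czMat p q * onQubitMat p gateX
    = onQubitMat p gateX * (onQubit q gateZ : UnitaryN n).1 * czMat p q
  rw [onQubit_Z_eq, czMat, Matrix.mul_assoc, Matrix.diagonal_mul_diagonal]
  ext a b
  rw [Matrix.diagonal_mul, Matrix.mul_diagonal, onQubitMat_apply]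
  by_cases h : ∀ j, j ≠ p → a j = b j
  swap
  · rw [if_neg h, mul_zero, zero_mul]
  rw [if_pos h]
  have hq : a q = b q := h q hpq.symm
  rw [hq]
  generalize a p = x
  generalize b p = y
  generalize b q = z
  fin_cases x <;> fin_cases y <;> fin_cases z <;> simp [gateX]

theorem gateCZ_conj_X_of_ne {n : ℕ} {p q i : Fin n} (hp : p ≠ i) (hq : q ≠ i) :
    gateCZ p q * onQubit i gateX * (gateCZ p q)⁻¹ = onQubit i gateX := by
  rw [mul_inv_eq_iff_eq_mul]
  apply Subtype.ext
  change czMat p q * onQubitMat i gateX = onQubitMat i gateX * czMat p q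
  ext a b
  rw [czMat, Matrix.diagonal_mul, Matrix.mul_diagonal, onQubitMat_apply]
  by_cases h : ∀ j, j ≠ i → a j = b j
  · rw [if_pos h, h p hp, h q hq, mul_comm]
  · rw [if_neg h, mul_zero, zero_mul]

theorem onQubit_conj_of_ne {n : ℕ} {i j : Fin n} (hij : i ≠ j)
    (A B : Matrix.unitaryGroup (Fin 2) ℂ) :
    onQubit i A * onQubit j B * (onQubit i A)⁻¹ = onQubit j B := by
  rw [onQubit_comm hij, mul_inv_cancel_right]

theorem onQubit_H_mem {n : ℕ} (i : Fin n) : onQubit i gateH ∈ CliffordGroup n := by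
  refine mem_cliffordGroup _ 1 (by rw [pow_two, ← map_mul, gateH_mul_self, map_one]) ?_ ?_
  · intro j
    by_cases h : i = j
    · subst h
      rw [← map_mul, ← map_inv, ← map_mul, gateH_conj_X]
      exact onQubit_Z_mem i
    · rw [onQubit_conj_of_ne h]
      exact onQubit_X_mem j
  · intro j
    by_cases h : i = j
    · subst h
      rw [← map_mul, ← map_inv, ← map_mul, gateH_conj_Z]
      exact onQubit_X_mem i
    · rw [onQubit_conj_of_ne h]
      exact onQubit_Z_mem j

theorem onQubit_S_mem {n : ℕ} (i : Fin n) : onQubit i gateS ∈ CliffordGroup n := by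
  refine mem_cliffordGroup _ 3 (by rw [← map_pow, gateS_pow_four, map_one]) ?_ ?_
  · intro j
    by_cases h : i = j
    · subst h
      rw [gateS_conj_X]
      exact mul_mem (phaseI_mem n) (mul_mem (onQubit_X_mem i) (onQubit_Z_mem i))
    · rw [onQubit_conj_of_ne h]
      exact onQubit_X_mem j
  · intro j
    by_cases h : i = j
    · subst h
      rw [← map_mul, ← map_inv, ← map_mul, gateS_conj_Z]
      exact onQubit_Z_mem i
    · rw [onQubit_conj_of_ne h]
      exact onQubit_Z_mem j

theorem gateCZ_mem {n : ℕ} {p q : Fin n} (hpq : p ≠ q) : gateCZ p q ∈ CliffordGroup n := by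
  refine mem_cliffordGroup _ 1 (by rw [pow_two, gateCZ_mul_self]) ?_ ?_
  · intro j
    by_cases hp : p = j
    · subst hp
      rw [gateCZ_conj_X_left hpq]
      exact mul_mem (onQubit_X_mem _) (onQubit_Z_mem _)
    · by_cases hq : q = j
      · subst hq
        rw [gateCZ_comm, gateCZ_conj_X_left hpq.symm]
        exact mul_mem (onQubit_X_mem _) (onQubit_Z_mem _)
      · rw [gateCZ_conj_X_of_ne hp hq]
        exact onQubit_X_mem j
  · intro j
    rw [gateCZ_conj_Z]
    exact onQubit_Z_mem j

/- ### The generators `h_i`, `s_i`, `Λ_k` of the projective Clifford group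

Qubits are numbered `1, …, n` here; qubit `i` is tensor position `i - 1` in `Fin n`. -/

/-- The class `h_i` of the Hadamard gate on qubit `i`. -/
def clH (n i : ℕ) (hi : 1 ≤ i ∧ i ≤ n := by omega) : ProjClifford n :=
  projClass (onQubit (⟨i - 1, by omega⟩ : Fin n) gateH) (onQubit_H_mem _)

/-- The class `s_i` of the phase gate on qubit `i`. -/
def clS (n i : ℕ) (hi : 1 ≤ i ∧ i ≤ n := by omega) : ProjClifford n :=
  projClass (onQubit (⟨i - 1, by omega⟩ : Fin n) gateS) (onQubit_S_mem _)

/-- The class `Λ_k` of the controlled `Z` gate on qubits `k` and `k + 1`. -/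
def clL (n k : ℕ) (hk : 1 ≤ k ∧ k + 1 ≤ n := by omega) : ProjClifford n :=
  projClass (gateCZ (⟨k - 1, by omega⟩ : Fin n) ⟨k, by omega⟩)
    (gateCZ_mem (by rw [Ne, Fin.mk.injEq]; omega))

/-- The element `g = h_1 s_1 h_1 s_1^3 h_1`. -/
def clG (n : ℕ) (hn : 1 ≤ n := by omega) : ProjClifford n :=
  clH n 1 * clS n 1 * clH n 1 * clS n 1 ^ 3 * clH n 1

/-- The centralizer of an element of the projective Clifford group. -/
abbrev clCent {n : ℕ} (u : ProjClifford n) : Subgroup (ProjClifford n) :=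
  Subgroup.centralizer {u}

/- ### Inertia subgroups -/

/-- The inertia subgroup in `G` of a representation `ρ` of a normal subgroup `N`: the elements
`c` of `G` such that `ρ` is isomorphic to its conjugate `p ↦ ρ (c p c⁻¹)`. -/
def inertiaSubgroup {G : Type*} [Group G] {N : Subgroup G} [N.Normal] {V : Type*}
    [AddCommGroup V] [Module ℂ V] (ρ : Representation ℂ N V) : Subgroup G where
  carrier := {c | ∃ e : V ≃ₗ[ℂ] V, ∀ (p : N) (v : V), e (ρ p v) = ρ (MulAut.conjNormal c p) (e v)}
  one_mem' := ⟨LinearEquiv.refl ℂ V, fun p v => by simp⟩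
  mul_mem' := by
    rintro c d ⟨e, he⟩ ⟨f, hf⟩
    refine ⟨f.trans e, fun p v => ?_⟩
    simp only [LinearEquiv.trans_apply, hf, he, map_mul, MulAut.mul_apply]
  inv_mem' := by
    rintro c ⟨e, he⟩
    refine ⟨e.symm, fun p v => ?_⟩
    rw [LinearEquiv.symm_apply_eq, he, LinearEquiv.apply_symm_apply, ← MulAut.mul_apply,
      ← map_mul, mul_inv_cancel, map_one, MulAut.one_apply]

/-- The element `M = h_2 Λ_1 s_2^2 h_2 h_1 s_1^2 h_2 Λ_1 h_2`. -/
def clM (n : ℕ) (hn : 2 ≤ n := by omega) : ProjClifford n :=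
  clH n 2 * clL n 1 * clS n 2 ^ 2 * clH n 2 * clH n 1 * clS n 1 ^ 2 * clH n 2 * clL n 1 * clH n 2

/-- The explicit inertia subgroup `IN_n` (for `n ≥ 2`): it is `⟨h_1, h_2, s_2, h_1 s_1^2 h_1, M⟩`
for `n = 2` and `⟨h_1, …, h_n, s_2, …, s_n, M, Λ_2, …, Λ_{n-1}⟩` for `n ≥ 3`. -/
def explicitIN (n : ℕ) (hn : 2 ≤ n) : Subgroup (ProjClifford n) :=
  Subgroup.closure
    ({x | ∃ (i : ℕ) (hi : 1 ≤ i ∧ i ≤ n), x = clH n i}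
      ∪ {x | ∃ (j : ℕ) (hj : 2 ≤ j ∧ j ≤ n), x = clS n j}
      ∪ {clM n}
      ∪ {x | ∃ (k : ℕ) (hk : 2 ≤ k ∧ k + 1 ≤ n), x = clL n k}
      ∪ {x | n = 2 ∧ x = clH n 1 * clS n 1 ^ 2 * clH n 1})

/- ### The presentation -/

/-- The symbols `g`, `h_i` (`2 ≤ i ≤ n`), `s_j` (`1 ≤ j ≤ n`), `Λ_k` (`1 ≤ k ≤ n - 1`). -/
inductive INSymbol (n : ℕ) : Type
  | g : INSymbol n
  | h (i : ℕ) (hi : 2 ≤ i ∧ i ≤ n) : INSymbol n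
  | s (j : ℕ) (hj : 1 ≤ j ∧ j ≤ n) : INSymbol n
  | L (k : ℕ) (hk : 1 ≤ k ∧ k + 1 ≤ n) : INSymbol n

namespace INSymbol

/-- The letter `g` in the free group. -/
def fg {n : ℕ} : FreeGroup (INSymbol n) := FreeGroup.of g

/-- The letter `h_i` in the free group. -/
def fh {n : ℕ} (i : ℕ) (hi : 2 ≤ i ∧ i ≤ n := by omega) : FreeGroup (INSymbol n) :=
  FreeGroup.of (h i hi)

/-- The letter `s_j` in the free group. -/
def fs {n : ℕ} (j : ℕ) (hj : 1 ≤ j ∧ j ≤ n := by omega) : FreeGroup (INSymbol n) :=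
  FreeGroup.of (s j hj)

/-- The letter `Λ_k` in the free group. -/
def fL {n : ℕ} (k : ℕ) (hk : 1 ≤ k ∧ k + 1 ≤ n := by omega) : FreeGroup (INSymbol n) :=
  FreeGroup.of (L k hk)

/-- The element of the projective Clifford group named by a symbol. -/
def toClifford {n : ℕ} (hn : 2 ≤ n) : INSymbol n → ProjClifford n
  | g => clG n
  | h i hi => clH n i
  | s j hj => clS n j
  | L k hk => clL n k

end INSymbol

open INSymbol in
/-- The defining relations: `INRelation n u v` says that `u = v` is one of them. -/
inductive INRelation (n : ℕ) : FreeGroup (INSymbol n) → FreeGroup (INSymbol n) → Prop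
  | Q1 : INRelation n (fg ^ 2) 1
  | Q2 (i : ℕ) (hi : 2 ≤ i ∧ i ≤ n) : INRelation n (fg * fh i * fg) (fh i)
  | Q3_first (hn : 1 ≤ n) : INRelation n (fg * fs 1 * fg) (fs 1 ^ 3)
  | Q3 (j : ℕ) (hj : 1 ≤ j ∧ j ≤ n) (hj1 : j ≠ 1) : INRelation n (fg * fs j * fg) (fs j)
  | Q4_first (hn : 2 ≤ n) : INRelation n (fg * fL 1 * fg) (fL 1 * fs 2 ^ 2)
  | Q4 (k : ℕ) (hk : 1 ≤ k ∧ k + 1 ≤ n) (hk1 : k ≠ 1) : INRelation n (fg * fL k * fg) (fL k)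
  | R1_h (i : ℕ) (hi : 2 ≤ i ∧ i ≤ n) : INRelation n (fh i ^ 2) 1
  | R1_s (j : ℕ) (hj : 1 ≤ j ∧ j ≤ n) : INRelation n (fs j ^ 4) 1
  | R1_L (k : ℕ) (hk : 1 ≤ k ∧ k + 1 ≤ n) : INRelation n (fL k ^ 2) 1
  | R2 (i : ℕ) (hi : 2 ≤ i ∧ i ≤ n) : INRelation n ((fs i * fh i) ^ 3) 1
  | R3 (i : ℕ) (hi : 2 ≤ i ∧ i ≤ n) : INRelation n ((fs i ^ 3 * fh i * fs i * fh i) ^ 3) 1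
  | R4 (i : ℕ) (hi : 2 ≤ i ∧ i ≤ n) : INRelation n ((fs i ^ 2 * fh i * fs i ^ 2 * fh i) ^ 2) 1
  | R5_h (i i' : ℕ) (hi : 2 ≤ i ∧ i ≤ n) (hi' : 2 ≤ i' ∧ i' ≤ n) :
      INRelation n (fh i * fh i') (fh i' * fh i)
  | R5_s (j j' : ℕ) (hj : 1 ≤ j ∧ j ≤ n) (hj' : 1 ≤ j' ∧ j' ≤ n) :
      INRelation n (fs j * fs j') (fs j' * fs j)
  | R5_L (k k' : ℕ) (hk : 1 ≤ k ∧ k + 1 ≤ n) (hk' : 1 ≤ k' ∧ k' + 1 ≤ n) :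
      INRelation n (fL k * fL k') (fL k' * fL k)
  | R6 (j k : ℕ) (hj : 1 ≤ j ∧ j ≤ n) (hk : 1 ≤ k ∧ k + 1 ≤ n) :
      INRelation n (fL k * fs j) (fs j * fL k)
  | R7 (i k : ℕ) (hi : 2 ≤ i ∧ i ≤ n) (hk : 1 ≤ k ∧ k + 1 ≤ n) (h1 : i ≠ k) (h2 : i ≠ k + 1) :
      INRelation n (fL k * fh i) (fh i * fL k)
  | R8 (i : ℕ) (hi : 2 ≤ i ∧ i + 1 ≤ n) :
      INRelation n (fh i * fs i ^ 2 * fh i * fL i) (fL i * fh i * fs (i + 1) ^ 2 * fs i ^ 2 * fh i)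
  | R9 (i : ℕ) (hi : 1 ≤ i ∧ i + 1 ≤ n) :
      INRelation n (fh (i + 1) * fs (i + 1) ^ 2 * fh (i + 1) * fL i)
        (fL i * fh (i + 1) * fs (i + 1) ^ 2 * fs i ^ 2 * fh (i + 1))
  | R10 (i : ℕ) (hi : 2 ≤ i ∧ i + 1 ≤ n) :
      INRelation n (fL i * fh i * fL i)
        (fs i * fh i * fL i * fs (i + 1) * fs i * fh i * fs i)
  | R11 (j : ℕ) (hj : 1 ≤ j ∧ j + 1 ≤ n) :
      INRelation n (fL j * fh (j + 1) * fL j)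
        (fs (j + 1) * fh (j + 1) * fL j * fs (j + 1) * fs j * fh (j + 1) * fs (j + 1))
  | R12 (j : ℕ) (hj : 2 ≤ j ∧ j + 2 ≤ n) :
      INRelation n
        (fL j * fh (j + 1) * fh j * fL j * fh (j + 2) * fh (j + 1) * fL (j + 1) * fh (j + 2)
          * fh (j + 1) * fL j * fh (j + 1) * fh j * fL j)
        (fL (j + 1) * fh (j + 2) * fh (j + 1) * fL (j + 1) * fh (j + 1) * fh j * fL j * fh (j + 1)
          * fh j * fL (j + 1) * fh (j + 2) * fh (j + 1) * fL (j + 1))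
  | R13 (j : ℕ) (hj : 2 ≤ j ∧ j + 2 ≤ n) :
      INRelation n ((fL j * fh (j + 1) * fh j * fL j * fh (j + 1) * fh j * fL (j + 1)) ^ 3) 1
  | R14 (j : ℕ) (hj : 1 ≤ j ∧ j + 2 ≤ n) :
      INRelation n
        ((fL (j + 1) * fh (j + 2) * fh (j + 1) * fL (j + 1) * fh (j + 2) * fh (j + 1) * fL j) ^ 3) 1

/-- The relators `u v⁻¹` of the presentation. -/
def inRelators (n : ℕ) : Set (FreeGroup (INSymbol n)) :=
  {r | ∃ u v, INRelation n u v ∧ r = u * v⁻¹}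

/-- The group given by the symbols `INSymbol n` and the relations `INRelation n`. -/
abbrev INPresented (n : ℕ) : Type := PresentedGroup (inRelators n)

end

/-! The projective Clifford group acts on Pauli operators by conjugation, faithfully because a
matrix commuting with all X_i and Z_i is scalar (`cliffAct_ext`). As s_1² is the class of Z_1, an
element commutes with s_1² exactly when it fixes Z_1 up to sign, and with s_1 exactly when it fixes
Z_1. The involution g sends Z_1 to -Z_1, which gives the semidirect product. The generators of the
stabilizer of Z_1 come from transitivity of the gates on Pauli involutions (`exists_act_pZ`,
`exists_act_pX`, `fixer_pZ`).

The core is that no further relations are needed. The relations Q reduce this to the subgroup of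
words without g. Let G_d be generated by the abstract gates on the qubits d, …, n, and let K_d be
generated by the same gates except h_d. The key statement `FixesZ d` says that an element of G_d
whose image fixes Z_d lies in K_d; it is proved by descending induction on d. Given `FixesZ (d +
1)`, a conjugate of L_d by an element of G_{d+1} depends only on the image of Z_{d+1} (`conj_eq`),
so it may be treated as a Pauli operator controlled by qubit d. These conjugates and the powers of
s_d make up a subgroup normalized by G_{d+1}, and K_d is its product with G_{d+1}
(`exists_controlled_mul`). With this factorization, G_d is a union of four double cosets of K_d,
represented by 1, the bit flip, h_d and the swap of qubits d and d+1 (`inCells_of_mem`). Only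
elements of K_d itself fix Z_d, which is `FixesZ d`. Injectivity follows by another descent: an
element of G_d in the kernel lies in K_d, its controlled factor fixes X_d and is therefore trivial,
and what remains lies in G_{d+1} (`eq_one_of_map_eq_one`). On qubit 1, where there is no Hadamard
generator, only this last argument is needed.

The word calculations rest on the swap (L h k)³. The word L h k is a Coxeter element of the braid
group on six strands, which explains how its cube permutes gates. In these terms R12 is a braid-like
relation between neighbouring swaps (`three_iff_swap_braid`), and R14 is multiplicativity of
controlled Pauli operators (`controlled_mul`).

For inertia subgroups, an irreducible representation of the projective Pauli group acts by signs,
and a non-trivial sign character records commutation with a noncentral Pauli involution Q. Its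
inertia subgroup is the stabilizer of ±Q, conjugate to that of ±Z_1
(`nonempty_inertiaSubgroup_equiv`). The explicit subgroup is the conjugate of Cent(s_1²) by h_1 s_1
h_1 (`map_conjU`). -/

/-! ### Gate relations on one and two qubits in an abstract group -/

/-- The relations of the phase gate `s` and the Hadamard gate `h` of one qubit. -/
structure OneQubit {Γ : Type*} [Group Γ] (s h : Γ) : Prop where
  hh : h * h = 1
  ss : s * s * s * s = 1
  sh : s * h * s * h * s * h = 1

/-- The relations of the gates `s`, `h` of one qubit with the phase gate `t` of a neighbouring
qubit and the controlled `Z` gate `L` of the two qubits. -/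
structure HalfLink {Γ : Type*} [Group Γ] (s h t L : Γ) : Prop extends OneQubit s h where
  tt : t * t * t * t = 1
  LL : L * L = 1
  ts : t * s = s * t
  Lt : L * t = t * L
  Ls : L * s = s * L
  hL : h * s * s * h * L = L * h * s * s * t * t * h
  LhL : L * h * L = s * h * L * s * t * h * s

/-- The relations of the gates `s`, `h` and `t`, `k` of two neighbouring qubits. -/
structure Link {Γ : Type*} [Group Γ] (s h t k L : Γ) : Prop where
  left : HalfLink s h t L
  right : HalfLink t k s L
  hk : h * k = k * h

section
variable {Γ : Type*} [Group Γ] {s h t k L : Γ}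

theorem OneQubit.hsh (H : OneQubit s h) : h * s * h = s * s * s * h * s * s * s := by
  obtain ⟨h1, h2, h3⟩ := H
  grind

/-- The word `h * s * s * h` plays the bit flip, which inverts the phase gate. -/
theorem OneQubit.xsx (H : OneQubit s h) : h * s * s * h * s * h * s * s * h = s * s * s := by
  obtain ⟨h1, h2, h3⟩ := H
  grind

theorem OneQubit.h_inv (H : OneQubit s h) : h⁻¹ = h := inv_eq_of_mul_eq_one_left H.hh

theorem OneQubit.s_inv (H : OneQubit s h) : s⁻¹ = s * s * s := by
  rw [inv_eq_iff_mul_eq_one, ← H.ss]; simp only [mul_assoc]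

theorem HalfLink.L_inv (H : HalfLink s h t L) : L⁻¹ = L := inv_eq_of_mul_eq_one_left H.LL

/-- This commutation is not among the defining relations; `LhL` forces it. Put x = h s² h. Since L h
L is an involution, comparing `LhL` with its inverse gives x (L t) x = L t⁻¹, hence x commutes with
t². Conjugating `LhL` once more by L then gives h s² t h = h s² h t. -/
theorem HalfLink.ht (H : HalfLink s h t L) : h * t = t * h := by
  obtain ⟨⟨hh, ss, sh⟩, tt, LL, ts, Lt, Ls, hL, LhL⟩ := H
  clear hL
  grind (acSteps := 1000000)

/-- Lets `simp` apply an equation for a two-letter word inside a right-associated product. -/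
theorem mul_eq_assoc {a b c : Γ} (h : a * b = c) (y : Γ) : a * (b * y) = c * y := by
  rw [← h, mul_assoc]

/-- A bit flip moved across a controlled Z leaves a Z, which is t², on the other qubit. This is `hL`
with the letters t moved out past h and s. -/
theorem HalfLink.xL (H : HalfLink s h t L) : h * s * s * h * L = L * t * t * (h * s * s * h) := by
  rw [H.hL]
  simp only [mul_assoc, ← H.ht, mul_eq_assoc H.ts, mul_eq_assoc H.ht.symm]

/-- With the qubit of t as control, L and h L h are controlled Z and controlled X. Their product is
a controlled Y up to a phase on the control, and s conjugates controlled X to controlled Y. -/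
theorem HalfLink.LC (H : HalfLink s h t L) :
    L * (h * L * h) = t * s * (h * L * h) * s⁻¹ := by
  have ht := H.ht
  have hsh := H.toOneQubit.hsh
  have h1 : L * (h * L * h) = s * h * L * t * s * (h * s * h) := by
    rw [show L * (h * L * h) = L * h * L * h by simp only [mul_assoc], H.LhL]
    have ts := H.ts
    clear hsh
    grind
  rw [h1, hsh, H.s_inv, show s * h * L * t * s * (s * s * s * h * s * s * s)
    = s * h * L * t * (s * s * s * s) * h * s * s * s by simp only [mul_assoc], H.ss, mul_one,
    show s * h * L * t * h * s * s * s = s * (h * (L * t)) * h * s * s * s by simp only [mul_assoc],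
    H.Lt, ← mul_assoc h, ht]
  have ts := H.ts
  clear h1 hsh ht
  grind

theorem Link.symm (H : Link s h t k L) : Link t k s h L := ⟨H.right, H.left, H.hk.symm⟩

/-- In the braid group on six strands with standard generators `a, b, c, d, e`, the Coxeter element
`δ = cbade` satisfies `δ² a = d δ²`. -/
theorem braid_coxeter {a b c d e : Γ} (hab : a * b * a = b * a * b) (hbc : b * c * b = c * b * c)
    (hcd : c * d * c = d * c * d) (ac : a * c = c * a) (ad : a * d = d * a)
    (bd : b * d = d * b) (be : b * e = e * b) (ae : a * e = e * a) (ce : c * e = e * c) :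
    c * b * a * d * e * (c * b * a) * a = d * (c * b * a * d * e * (c * b * a)) := by
  -- In the chain a – b – c – d – e the pairs a, b and d, e lie on opposite sides of c, so they
  -- commute.
  have e1 : b * a * d * e = d * e * (b * a) := by
    rw [mul_assoc b, ad, ← mul_assoc, bd, mul_assoc (d * b), ae, ← mul_assoc, mul_assoc d b, be]
    simp only [mul_assoc]
  have e2 : a * b * a * a = b * (a * b * a) := by
    rw [hab]; simp only [mul_assoc] at hab ⊢; rw [hab]
  have e3 : c * b * a * d * e * (c * b * a) = c * d * e * b * c * (a * b * a) := by
    calc _ = c * (b * a * d * e) * (c * b * a) := by simp only [mul_assoc]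
      _ = c * d * e * b * (a * c) * (b * a) := by rw [e1]; simp only [mul_assoc]
      _ = _ := by rw [ac]; simp only [mul_assoc]
  calc _ = c * d * e * b * c * (a * b * a * a) := by rw [e3]; simp only [mul_assoc]
    _ = c * d * e * (b * c * b) * (a * b * a) := by rw [e2]; simp only [mul_assoc]
    _ = c * d * (c * e) * b * c * (a * b * a) := by rw [hbc, ce]; simp only [mul_assoc]
    _ = d * (c * d * e * b * c * (a * b * a)) := by
      rw [← mul_assoc (c * d), hcd]; simp only [mul_assoc]
    _ = _ := by rw [e3]

namespace Link

/-- The phase rotation around `X`. -/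
theorem h_eq (H : OneQubit s h) : h = s * (h * s * h) * s := by
  obtain ⟨h1, h2, h3⟩ := H
  grind

/-- Both sides are equal to h. -/
theorem braid_su (H : OneQubit s h) : s * (h * s * h) * s = h * s * h * s * (h * s * h) := by
  obtain ⟨h1, h2, h3⟩ := H
  grind

theorem kt (H : Link s h t k L) : k * s = s * k := H.right.ht

/-- The relation `u r u = r u r` for `u = h s h` and `r = L s t`. -/
theorem braid_ur (H : HalfLink s h t L) :
    h * s * h * (L * s * t) * (h * s * h) = L * s * t * (h * s * h) * (L * s * t) := by
  have ht := H.ht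
  have xL := H.xL
  obtain ⟨⟨hh, ss, sh⟩, tt, LL, ts, Lt, Ls, hL, LhL⟩ := H
  clear hL
  grind (acSteps := 1000000)

end Link
end

/-- The swap of two neighbouring qubits. -/
def swapWord {Γ : Type*} [Group Γ] (h k L : Γ) : Γ := L * h * k * (L * h * k) * (L * h * k)

namespace Link
variable {Γ : Type*} [Group Γ] {s h t k L : Γ}

/-- The elements s, h s h, L s t, k t k, t are quarter turns about Z, X, ZZ', X', Z'. Neighbours in
this chain braid and the others commute, so the product of all five, each once, is a Coxeter
element. -/
theorem coxeter_eq (H : Link s h t k L) :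
    L * h * k = L * s * t * (h * s * h) * s * (k * t * k) * t := by
  have ht := H.left.ht
  have e1 : L * s * t * (h * s * h) * s * (k * t * k) * t
      = L * s * (t * h) * s * h * s * (k * t * k) * t := by simp only [mul_assoc]
  have e2 : t * s * h * s * (k * t * k) * t = s * h * s * (t * (k * t * k) * t) := by
    have ts := H.left.ts
    simp only [mul_assoc, mul_eq_assoc ts, mul_eq_assoc ht.symm]
  have e3 : L * s * (t * h) * s * h * s * (k * t * k) * t
      = L * s * h * (t * s * h * s * (k * t * k) * t) := by
    rw [← ht]; simp only [mul_assoc]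
  rw [e1, e3, e2, ← h_eq H.right.toOneQubit,
    show L * s * h * (s * h * s * k) = L * (s * (h * s * h) * s) * k by simp only [mul_assoc],
    ← h_eq H.left.toOneQubit]

/-- This is `braid_coxeter` for the chain of quarter turns; the last two factors k t k and t of the
second Coxeter element commute with s. -/
theorem coxeter_sq_mul (H : Link s h t k L) :
    L * h * k * (L * h * k) * s = k * t * k * (L * h * k * (L * h * k)) := by
  have ts := H.left.ts
  have ht := H.left.ht
  have kt := H.kt
  have hk := H.hk
  have Lt := H.left.Lt
  have Ls := H.left.Ls
  have comm : ∀ {x y z : Γ}, x * y = y * x → x * z = z * x → x * (y * z) = y * z * x :=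
    fun h1 h2 => Commute.mul_right h1 h2
  have sw : s * (k * t * k) = k * t * k * s := comm (comm kt.symm ts.symm) kt.symm
  have ut : h * s * h * t = t * (h * s * h) := (comm (comm ht.symm ts) ht.symm).symm
  have uk : k * (h * s * h) = h * s * h * k := comm (comm hk.symm kt) hk.symm
  have uw : h * s * h * (k * t * k) = k * t * k * (h * s * h) := comm (comm uk.symm ut) uk.symm
  have rt : L * s * t * t = t * (L * s * t) := (comm (comm Lt.symm ts) rfl).symm
  have key := braid_coxeter (a := s) (b := h * s * h) (c := L * s * t) (d := k * t * k) (e := t)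
    (braid_su H.left.toOneQubit) (braid_ur H.left)
    (by
      have := braid_ur H.right
      rw [show L * t * s = L * s * t by rw [mul_assoc, ts, ← mul_assoc]] at this
      exact this.symm)
    (comm (comm Ls.symm rfl) ts.symm) sw uw ut ts.symm rt
  have e1 : s * ((k * t * k) * t) = (k * t * k) * t * s := comm sw ts.symm
  rw [H.coxeter_eq]
  calc _ = L * s * t * (h * s * h) * s * (k * t * k) * t * (L * s * t * (h * s * h) * s)
        * ((k * t * k) * t * s) := by simp only [mul_assoc]
    _ = L * s * t * (h * s * h) * s * (k * t * k) * t * (L * s * t * (h * s * h) * s) * s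
        * ((k * t * k) * t) := by rw [← e1]; simp only [mul_assoc]
    _ = _ := by rw [key]; simp only [mul_assoc]

/-- The square of the Coxeter element carries s to k t k, and its third factor carries k t k to t.
-/
theorem swap_s (H : Link s h t k L) : swapWord h k L * s = t * swapWord h k L := by
  have e1 : L * h * k * (k * t * k) = t * (L * h * k) := by
    simp only [mul_assoc, mul_eq_assoc H.right.hh, one_mul]
    rw [mul_eq_assoc H.left.ht, mul_assoc, ← mul_assoc, H.left.Lt, mul_assoc]
  rw [swapWord, mul_assoc (L * h * k), mul_assoc (L * h * k), H.coxeter_sq_mul, ← mul_assoc, e1]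
  simp only [mul_assoc]

theorem swap_hsh (H : Link s h t k L) :
    swapWord h k L * (h * s * h) = k * t * k * swapWord h k L := by
  have e1 : L * h * k * (h * s * h) = s * (L * h * k) := by
    rw [mul_assoc L, H.hk]
    simp only [mul_assoc, mul_eq_assoc H.left.hh, one_mul]
    rw [mul_eq_assoc H.kt, mul_assoc, ← mul_assoc, H.left.Ls, mul_assoc]
  rw [swapWord, mul_assoc _ (L * h * k), e1, ← mul_assoc, H.coxeter_sq_mul]
  simp only [mul_assoc]

/-- The Hadamard gate is a word in s and h s h, whose behaviour under the swap is known. -/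
theorem swap_h (H : Link s h t k L) : swapWord h k L * h = k * swapWord h k L := by
  have h1 := H.swap_s
  have h2 := H.swap_hsh
  generalize swapWord h k L = a at h1 h2
  rw [h_eq H.left.toOneQubit, h_eq H.right.toOneQubit, ← mul_assoc, ← mul_assoc, h1, mul_assoc t,
    h2, ← mul_assoc, mul_assoc _ a, h1]
  simp only [mul_assoc]

theorem swap_symm (H : Link s h t k L) : swapWord k h L = swapWord h k L := by
  simp only [swapWord, mul_assoc, H.hk]

theorem swap_k (H : Link s h t k L) : swapWord h k L * k = h * swapWord h k L := by
  rw [← H.swap_symm]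
  exact H.symm.swap_h

theorem swap_t (H : Link s h t k L) : swapWord h k L * t = s * swapWord h k L := by
  rw [← H.swap_symm]
  exact H.symm.swap_s

/-- The two words are conjugate by h k, which commutes with the swap. -/
theorem swap_eq (H : Link s h t k L) :
    swapWord h k L = h * k * L * (h * k * L) * (h * k * L) := by
  have e : h * k * L * (h * k * L) * (h * k * L) * (h * k) = h * k * swapWord h k L := by
    simp only [swapWord, mul_assoc]
  have e2 : swapWord h k L * (h * k) = h * k * swapWord h k L := by
    rw [← mul_assoc, H.swap_h, mul_assoc, H.swap_k, ← mul_assoc, H.hk]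
  exact mul_right_cancel (e2.trans e.symm)

theorem swap_L (H : Link s h t k L) : swapWord h k L * L = L * swapWord h k L := by
  conv_rhs => rw [H.swap_eq]
  simp only [swapWord, mul_assoc]

theorem swap_swap (H : Link s h t k L) : swapWord h k L * swapWord h k L = 1 := by
  -- One factor is written as (k h L)³ and the other stays (L h k)³, so the involutions cancel from
  -- the middle outwards.
  conv_lhs => arg 1; rw [H.swap_eq, H.hk]
  simp only [swapWord, mul_assoc, mul_eq_assoc H.left.hh, mul_eq_assoc H.right.hh,
    mul_eq_assoc H.left.LL, one_mul, H.right.hh]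

theorem swap_inv (H : Link s h t k L) : (swapWord h k L)⁻¹ = swapWord h k L :=
  inv_eq_of_mul_eq_one_left H.swap_swap

theorem hkhk (H : Link s h t k L) (y : Γ) : h * (k * (h * (k * y))) = y := by
  rw [mul_eq_assoc H.hk.symm, mul_assoc, mul_eq_assoc H.left.hh, one_mul,
    mul_eq_assoc H.right.hh, one_mul]

/-- Relation R12 is built from blocks of this shape. Splitting off the swap leaves an involution
that commutes with it. -/
theorem LkhL_eq (H : Link s h t k L) :
    L * k * h * L = swapWord h k L * (h * k * L * h * k) := by
  rw [mul_assoc L k, ← H.hk]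
  have := H.hkhk 1
  rw [mul_one] at this
  simp only [swapWord, mul_assoc, this, H.hkhk, mul_eq_assoc H.left.LL, one_mul, mul_one]

theorem swap_hk (H : Link s h t k L) : Commute (swapWord h k L) (h * k) := by
  rw [Commute, SemiconjBy, ← mul_assoc, H.swap_h, mul_assoc, H.swap_k, ← mul_assoc, H.hk]

theorem swap_conj (H : Link s h t k L) :
    Commute (swapWord h k L) (h * k * L * h * k) := by
  rw [mul_assoc _ h k]
  exact (H.swap_hk.mul_right H.swap_L).mul_right H.swap_hk

theorem conj_sq (H : Link s h t k L) : h * k * L * h * k * (h * k * L * h * k) = 1 := by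
  have := H.hkhk 1
  rw [mul_one] at this
  simp only [mul_assoc, H.hkhk, this, mul_eq_assoc H.left.LL, one_mul]

theorem mul_conj (H : Link s h t k L) : h * k * L = h * k * L * h * k * (h * k) := by
  have := H.hkhk 1
  rw [mul_one] at this
  simp only [mul_assoc, this, mul_one]

/-- `h L h` in terms of the swap. -/
theorem hLh_eq (H : Link s h t k L) :
    h * L * h = k * L * k * swapWord h k L * (k * L * k) := by
  -- The words h L h and k L k are the two controlled NOT gates; the identity is the factorization
  -- of the swap into three of them.
  have e : k * L * k * swapWord h k L * (k * L * k)
      = k * L * (k * swapWord h k L) * (k * L * k) := by simp only [mul_assoc]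
  rw [e, ← H.swap_h, swapWord]
  simp only [mul_assoc, mul_eq_assoc H.left.LL, one_mul, H.hkhk]
  rw [mul_eq_assoc H.hk.symm, mul_assoc, mul_eq_assoc H.right.hh, one_mul, H.right.hh, mul_one]

/-- The right-hand side contains h only once, so it belongs to the double coset of h; this is what
left multiplication by h needs on the swap cell. -/
theorem h_swap (H : Link s h t k L) :
    h * (k * L * k * swapWord h k L) = L * h * k * L * k := by
  rw [mul_assoc (k * L), ← H.swap_h, swapWord]
  simp only [mul_assoc, mul_eq_assoc H.left.LL, one_mul, H.hkhk]
  rw [← H.hk, mul_eq_assoc H.left.hh, one_mul]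
end Link

/-! ### Families of gates on a row of qubits -/

/-- Gates `h i` (`lo ≤ i ≤ n`), `s i` (`1 ≤ i ≤ n`) and `L i` (`1 ≤ i < n`) on `n` qubits in a row
that satisfy the relations of the Hadamard, phase and controlled `Z` gates. -/
structure CliffordFamily {Γ : Type*} [Group Γ] (lo n : ℕ) (h s L : ℕ → Γ) : Prop where
  one_le : 1 ≤ lo
  le_two : lo ≤ 2
  one : ∀ i, lo ≤ i → i ≤ n → OneQubit (s i) (h i)
  left : ∀ i, lo ≤ i → i + 1 ≤ n → HalfLink (s i) (h i) (s (i + 1)) (L i)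
  right : ∀ i, 1 ≤ i → i + 1 ≤ n → HalfLink (s (i + 1)) (h (i + 1)) (s i) (L i)
  ss : ∀ i j, 1 ≤ i → i ≤ n → 1 ≤ j → j ≤ n → Commute (s i) (s j)
  hh : ∀ i j, lo ≤ i → i ≤ n → lo ≤ j → j ≤ n → Commute (h i) (h j)
  LL : ∀ i j, 1 ≤ i → i + 1 ≤ n → 1 ≤ j → j + 1 ≤ n → Commute (L i) (L j)
  Ls : ∀ i j, 1 ≤ i → i + 1 ≤ n → 1 ≤ j → j ≤ n → Commute (L i) (s j)
  Lh : ∀ i j, 1 ≤ i → i + 1 ≤ n → lo ≤ j → j ≤ n → j ≠ i → j ≠ i + 1 → Commute (L i) (h j)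
  three : ∀ j, lo ≤ j → j + 2 ≤ n →
    L j * h (j + 1) * h j * L j * h (j + 2) * h (j + 1) * L (j + 1) * h (j + 2)
      * h (j + 1) * L j * h (j + 1) * h j * L j
    = L (j + 1) * h (j + 2) * h (j + 1) * L (j + 1) * h (j + 1) * h j * L j * h (j + 1)
      * h j * L (j + 1) * h (j + 2) * h (j + 1) * L (j + 1)
  -- The range starts at 1 even when `lo = 2`, since h_j does not occur. The mirror-image relation
  -- R13 is not a field: it follows, see `cube'`.
  cube : ∀ j, 1 ≤ j → j + 2 ≤ n →
    (L (j + 1) * h (j + 2) * h (j + 1) * L (j + 1) * h (j + 2) * h (j + 1) * L j) ^ 3 = 1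

/-- The subgroup generated by the gates `h i` with `a ≤ i` and `s i`, `L i` with `d ≤ i`. -/
def gateGroup {Γ : Type*} [Group Γ] (n : ℕ) (h s L : ℕ → Γ) (a d : ℕ) : Subgroup Γ :=
  Subgroup.closure {x | (∃ i, a ≤ i ∧ i ≤ n ∧ x = h i) ∨ (∃ i, d ≤ i ∧ i ≤ n ∧ x = s i) ∨
    ∃ i, d ≤ i ∧ i + 1 ≤ n ∧ x = L i}

section gateGroup
variable {Γ : Type*} [Group Γ] {n : ℕ} {h s L : ℕ → Γ} {a d i : ℕ}

theorem h_mem_gateGroup (h1 : a ≤ i) (h2 : i ≤ n) : h i ∈ gateGroup n h s L a d :=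
  Subgroup.subset_closure (Or.inl ⟨i, h1, h2, rfl⟩)

theorem s_mem_gateGroup (h1 : d ≤ i) (h2 : i ≤ n) : s i ∈ gateGroup n h s L a d :=
  Subgroup.subset_closure (Or.inr (Or.inl ⟨i, h1, h2, rfl⟩))

theorem L_mem_gateGroup (h1 : d ≤ i) (h2 : i + 1 ≤ n) : L i ∈ gateGroup n h s L a d :=
  Subgroup.subset_closure (Or.inr (Or.inr ⟨i, h1, h2, rfl⟩))

theorem gateGroup_le {S : Subgroup Γ} (hS : ∀ i, a ≤ i → i ≤ n → h i ∈ S)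
    (sS : ∀ i, d ≤ i → i ≤ n → s i ∈ S) (LS : ∀ i, d ≤ i → i + 1 ≤ n → L i ∈ S) :
    gateGroup n h s L a d ≤ S := by
  rw [gateGroup, Subgroup.closure_le]
  rintro x (⟨i, h1, h2, rfl⟩ | ⟨i, h1, h2, rfl⟩ | ⟨i, h1, h2, rfl⟩)
  exacts [hS i h1 h2, sS i h1 h2, LS i h1 h2]

theorem gateGroup_mono {a' d' : ℕ} (ha : a ≤ a') (hd : d ≤ d') :
    gateGroup n h s L a' d' ≤ gateGroup n h s L a d :=
  gateGroup_le (fun _ h1 h2 => h_mem_gateGroup (ha.trans h1) h2)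
    (fun _ h1 h2 => s_mem_gateGroup (hd.trans h1) h2)
    (fun _ h1 h2 => L_mem_gateGroup (hd.trans h1) h2)

theorem commute_of_mem_gateGroup {x w : Γ} (hS : ∀ i, a ≤ i → i ≤ n → Commute (h i) x)
    (sS : ∀ i, d ≤ i → i ≤ n → Commute (s i) x) (LS : ∀ i, d ≤ i → i + 1 ≤ n → Commute (L i) x)
    (hw : w ∈ gateGroup n h s L a d) : Commute w x := by
  have : gateGroup n h s L a d ≤ Subgroup.centralizer {x} :=
    gateGroup_le (fun i h1 h2 => Subgroup.mem_centralizer_singleton_iff.2 (hS i h1 h2))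
      (fun i h1 h2 => Subgroup.mem_centralizer_singleton_iff.2 (sS i h1 h2))
      (fun i h1 h2 => Subgroup.mem_centralizer_singleton_iff.2 (LS i h1 h2))
  exact Subgroup.mem_centralizer_singleton_iff.1 (this hw)

theorem gateGroup_eq_bot (h1 : n < a) (h2 : n < d) : gateGroup n h s L a d = ⊥ := by
  rw [eq_bot_iff]
  exact gateGroup_le (fun i _ _ => by omega) (fun i _ _ => by omega) (fun i _ _ => by omega)

theorem map_gateGroup {Δ : Type*} [Group Δ] {h' s' L' : ℕ → Δ} (φ : Γ →* Δ)
    (hφ : ∀ i, a ≤ i → i ≤ n → φ (h i) = h' i) (sφ : ∀ i, d ≤ i → i ≤ n → φ (s i) = s' i)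
    (Lφ : ∀ i, d ≤ i → i + 1 ≤ n → φ (L i) = L' i) :
    (gateGroup n h s L a d).map φ = gateGroup n h' s' L' a d := by
  apply le_antisymm
  · rw [Subgroup.map_le_iff_le_comap]
    exact gateGroup_le
      (fun i h1 h2 => by rw [Subgroup.mem_comap, hφ i h1 h2]; exact h_mem_gateGroup h1 h2)
      (fun i h1 h2 => by rw [Subgroup.mem_comap, sφ i h1 h2]; exact s_mem_gateGroup h1 h2)
      (fun i h1 h2 => by rw [Subgroup.mem_comap, Lφ i h1 h2]; exact L_mem_gateGroup h1 h2)
  · exact gateGroup_le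
      (fun i h1 h2 => ⟨h i, h_mem_gateGroup h1 h2, hφ i h1 h2⟩)
      (fun i h1 h2 => ⟨s i, s_mem_gateGroup h1 h2, sφ i h1 h2⟩)
      (fun i h1 h2 => ⟨L i, L_mem_gateGroup h1 h2, Lφ i h1 h2⟩)

end gateGroup

/-- The relation `LhL` can be solved for t as a word in s, h and L. -/
theorem HalfLink.commute_t {Γ : Type*} [Group Γ] {s h t L w : Γ} (H : HalfLink s h t L)
    (hs : Commute w s) (hh : Commute w h) (hL : Commute w L) : Commute w t := by
  have e : t = (s * h * L * s)⁻¹ * (L * h * L) * (h * s)⁻¹ := by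
    rw [H.LhL]; group
  rw [e]
  exact (((((hs.mul_right hh).mul_right hL).mul_right hs).inv_right).mul_right
    ((hL.mul_right hh).mul_right hL)).mul_right ((hh.mul_right hs).inv_right)

namespace CliffordFamily
variable {Γ : Type*} [Group Γ] {lo n : ℕ} {h s L : ℕ → Γ} (F : CliffordFamily lo n h s L)
include F

theorem link {i : ℕ} (h1 : lo ≤ i) (h2 : i + 1 ≤ n) :
    Link (s i) (h i) (s (i + 1)) (h (i + 1)) (L i) :=
  ⟨F.left i h1 h2, F.right i (F.one_le.trans h1) h2,
    F.hh i (i + 1) h1 (by omega) (by omega) h2⟩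

end CliffordFamily

/-- Expanding, (D² x)³ = (D² x D⁻²)(D⁴ x D⁻⁴) D⁶ x. With D⁶ = 1, three conjugates of the involution
x multiply to 1. -/
theorem mul_conj_eq_of_cube {Γ : Type*} [Group Γ] {D x : Γ} (h6 : D * D * D * (D * D * D) = 1)
    (hx : x * x = 1) (hc : (D * D * x) ^ 3 = 1) :
    x * (D * D * x * (D * D)⁻¹) = D * D * D * D * x * (D * D * D * D)⁻¹ := by
  have hx' : x⁻¹ = x := inv_eq_of_mul_eq_one_left hx
  have e1 : (D * D * D * D * x * (D * D * D * D)⁻¹)⁻¹ = D * D * D * D * x * (D * D * D * D)⁻¹ := by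
    simp only [_root_.mul_inv_rev, inv_inv, hx', mul_assoc]
  have e2 : (D * D * x) ^ 3 = D * D * x * (D * D)⁻¹ * (D * D * D * D * x * (D * D * D * D)⁻¹)
      * (D * D * D * (D * D * D)) * x := by
    rw [pow_three]; simp [mul_assoc]
  rw [h6, mul_one, hc] at e2
  rw [← e1, eq_inv_iff_mul_eq_one]
  have := congrArg (fun y => x * y * x⁻¹) e2.symm
  simpa [mul_assoc] using this

/-- The relation between the gates of three qubits in a row, in terms of swaps. -/
theorem three_iff_swap_braid {Γ : Type*} [Group Γ] {s t u p q r x y : Γ} (l1 : Link s p t q x)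
    (l2 : Link t q u r y) (c13 : Commute p r) (c1 : Commute y p) (c3 : Commute x r)
    (cL : Commute x y) :
    x * q * p * x * r * q * y * r * q * x * q * p * x
      = y * r * q * y * q * p * x * q * p * y * r * q * y ↔
    swapWord p q x * y * swapWord p q x = swapWord q r y * x * swapWord q r y := by
  have hP := l1.LkhL_eq
  have hQ := l2.LkhL_eq
  have cP := l1.swap_conj
  have cQ := l2.swap_conj
  have pP := l1.conj_sq
  have pQ := l2.conj_sq
  have xP := l1.mul_conj
  have yQ := l2.mul_conj
  have ap := l1.swap_h
  have aq := l1.swap_k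
  have bq := l2.swap_h
  have br := l2.swap_k
  have ar : Commute (swapWord p q x) r := by
    have hqr : Commute q r := l2.hk
    have := (c3.mul_left c13).mul_left hqr
    exact (this.mul_left this).mul_left this
  have bp : Commute (swapWord q r y) p := by
    have hpq : Commute p q := l1.hk
    have := (c1.mul_left hpq.symm).mul_left c13.symm
    exact (this.mul_left this).mul_left this
  have pq : Commute p q := l1.hk
  have qr : Commute q r := l2.hk
  -- Conjugation by T = p q r takes x to P and y to Q, because r commutes with x and p commutes with
  -- y.
  have TP : p * q * r * x = p * q * x * p * q * (p * q * r) := by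
    calc _ = p * q * x * r := by rw [mul_assoc _ r x, ← c3.eq, ← mul_assoc]
      _ = p * q * x * p * q * (p * q) * r := congrArg (· * r) xP
      _ = _ := by simp only [mul_assoc]
  have TQ : p * q * r * y = q * r * y * q * r * (p * q * r) := by
    have e : p * (q * r) = q * r * p := (pq.mul_right c13).eq
    calc _ = q * r * y * p := by rw [mul_assoc p q r, e, mul_assoc _ p y, ← c1.eq, ← mul_assoc]
      _ = q * r * y * q * r * (q * r) * p := congrArg (· * p) yQ
      _ = q * r * y * q * r * (q * r * p) := by simp only [mul_assoc]
      _ = _ := by rw [← e]; simp only [mul_assoc]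
  have Ta : Commute (swapWord p q x) (p * q * r) := l1.swap_hk.mul_right ar
  have Tb : Commute (swapWord q r y) (p * q * r) := by
    rw [mul_assoc]; exact bp.mul_right l2.swap_hk
  have e1 : x * q * p * x * r * q * y * r * q * x * q * p * x
      = x * q * p * x * (q * r * y * q * r) * (x * q * p * x) := by
    rw [mul_assoc _ q r, qr.eq]; simp only [mul_assoc]
  have e2 : y * r * q * y * q * p * x * q * p * y * r * q * y
      = y * r * q * y * (p * q * x * p * q) * (y * r * q * y) := by
    rw [mul_assoc _ p q, pq.eq]; simp only [mul_assoc]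
  rw [e1, e2, hP, hQ]
  clear e1 e2
  generalize swapWord p q x = a, swapWord q r y = b, p * q * x * p * q = P,
    q * r * y * q * r = Q, p * q * r = T at *
  -- P and Q commute as conjugates by T of the commuting x and y.
  have PQ : P * Q = Q * P := by
    apply mul_right_cancel (b := T)
    rw [mul_assoc, ← TQ, ← mul_assoc, ← TP, mul_assoc, cL.eq, ← mul_assoc, TQ, mul_assoc, TP,
      mul_assoc]
  have e1 : a * P * Q * (a * P) * T = T * (a * y * a) := by
    calc _ = a * Q * a * T := by
          conv_lhs => arg 1; arg 2; rw [cP.eq]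
          rw [mul_assoc a P Q, PQ, mul_assoc a, mul_assoc Q, ← mul_assoc P P, pP]
          simp only [one_mul, mul_assoc]
      _ = _ := by
          rw [← mul_assoc T, ← mul_assoc T, ← Ta.eq, mul_assoc a T, TQ, ← mul_assoc, mul_assoc _ T,
            ← Ta.eq, ← mul_assoc]
  have e2 : b * Q * P * (b * Q) * T = T * (b * x * b) := by
    calc _ = b * P * b * T := by
          conv_lhs => arg 1; arg 2; rw [cQ.eq]
          rw [mul_assoc b Q P, ← PQ, mul_assoc b, mul_assoc P, ← mul_assoc Q Q, pQ]
          simp only [one_mul, mul_assoc]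
      _ = _ := by
          rw [← mul_assoc T, ← mul_assoc T, ← Tb.eq, mul_assoc b T, TP, ← mul_assoc, mul_assoc _ T,
            ← Tb.eq, ← mul_assoc]
  -- As P is an involution commuting with a and Q, the left side a P Q a P collapses to a Q a, the
  -- conjugate of a y a by T; the right side is treated in the same way.
  rw [← mul_left_inj T, e1, e2, mul_right_inj]

namespace CliffordFamily
variable {Γ : Type*} [Group Γ] {lo n : ℕ} {h s L : ℕ → Γ} (F : CliffordFamily lo n h s L)
include F

/-- Only neighbouring links give such a commutation directly. It spreads outwards because s_j is a
word in s_{j+1}, h_{j+1} and L_j (`commute_t`). -/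
theorem hs_of_lt (k : ℕ) : ∀ j, 1 ≤ j → j + 1 + k ≤ n → Commute (h (j + 1 + k)) (s j) := by
  have h0 := F.le_two
  induction k with
  | zero => exact fun j hj h1 => (F.right j hj h1).ht
  | succ k ih =>
    intro j hj h1
    refine (F.right j hj (by omega)).commute_t ?_ ?_ ?_
    · have := ih (j + 1) (by omega) (by omega)
      rwa [show j + 1 + 1 + k = j + 1 + (k + 1) by ring] at this
    · exact F.hh _ _ (by omega) h1 (by omega) (by omega)
    · exact (F.Lh _ _ hj (by omega) (by omega) h1 (by omega) (by omega)).symm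

theorem hs_of_gt (i : ℕ) (hi : lo ≤ i) : ∀ k, i + 1 + k ≤ n →
    Commute (h i) (s (i + 1 + k)) := by
  intro k
  have h0 := F.one_le
  induction k with
  | zero => exact fun h1 => (F.left i hi h1).ht
  | succ k ih =>
    intro h1
    refine (F.left (i + 1 + k) (by omega) (by omega)).commute_t (ih (by omega)) ?_ ?_
    · exact F.hh _ _ hi (by omega) (by omega) (by omega)
    · exact (F.Lh _ _ (by omega) (by omega) hi (by omega) (by omega) (by omega)).symm

theorem hs {i j : ℕ} (hi : lo ≤ i) (hi' : i ≤ n) (hj : 1 ≤ j) (hj' : j ≤ n) (hij : i ≠ j) :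
    Commute (h i) (s j) := by
  rcases lt_or_gt_of_ne hij with h1 | h1
  · obtain ⟨k, rfl⟩ := Nat.exists_eq_add_of_le (Nat.succ_le_of_lt h1)
    exact F.hs_of_gt i hi k hj'
  · obtain ⟨k, rfl⟩ := Nat.exists_eq_add_of_le (Nat.succ_le_of_lt h1)
    exact F.hs_of_lt k j hj hi'

/-- `s d` commutes with the gates on the qubits after `d`. -/
theorem commute_s {d : ℕ} {w : Γ} (hd : 1 ≤ d) (hn : d ≤ n)
    (hw : w ∈ gateGroup n h s L (d + 1) d) : Commute w (s d) := by
  have h0 := F.le_two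
  refine commute_of_mem_gateGroup (fun i h1 h2 => ?_) (fun i h1 h2 => ?_) (fun i h1 h2 => ?_) hw
  · exact F.hs (by omega) h2 hd hn (by omega)
  · exact F.ss _ _ (by omega) h2 hd hn
  · exact F.Ls _ _ (by omega) h2 hd hn

/-- The only gates that can fail to commute with L_d are the Hadamards on qubits d and d+1, and both
are excluded here. -/
theorem commute_L {d : ℕ} {w : Γ} (hd : 1 ≤ d) (hn : d + 1 ≤ n)
    (hw : w ∈ gateGroup n h s L (d + 2) (d + 1)) : Commute w (L d) := by
  have h0 := F.le_two
  refine commute_of_mem_gateGroup (fun i h1 h2 => ?_) (fun i h1 h2 => ?_) (fun i h1 h2 => ?_) hw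
  · exact (F.Lh _ _ hd hn (by omega) h2 (by omega) (by omega)).symm
  · exact (F.Ls _ _ hd hn (by omega) h2).symm
  · exact F.LL _ _ (by omega) h2 hd hn

theorem commute_h {d : ℕ} {w : Γ} (hd : lo ≤ d) (hn : d ≤ n)
    (hw : w ∈ gateGroup n h s L (d + 1) (d + 1)) : Commute w (h d) := by
  have h0 := F.one_le
  refine commute_of_mem_gateGroup (fun i h1 h2 => ?_) (fun i h1 h2 => ?_) (fun i h1 h2 => ?_) hw
  · exact F.hh _ _ (by omega) h2 hd hn
  · exact (F.hs hd hn (by omega) h2 (by omega)).symm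
  · exact F.Lh _ _ (by omega) h2 hd hn (by omega) (by omega)

/-- The relation `c(Z) c(X') = c(Z X')` for controlled Pauli gates with control qubit `d`. -/
theorem controlled_mul {d : ℕ} (hd : 1 ≤ d) (hn : d + 2 ≤ n) {D : Γ}
    (hD : D = L (d + 1) * h (d + 1) * h (d + 2)) :
    L d * (D * D * L d * (D * D)⁻¹) = D * D * D * D * L d * (D * D * D * D)⁻¹ := by
  have h0 := F.le_two
  have lk := F.link (i := d + 1) (by omega) (by omega)
  -- In the Clifford group D² takes Z_{d+1} to X_{d+2} and D⁴ takes it to Z_{d+1} X_{d+2}. The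
  -- hypothesis D⁶ = 1 is the involutivity of the swap, and the cube hypothesis is R14 with its
  -- Hadamards reordered.
  refine mul_conj_eq_of_cube ?_ (F.right d hd (by omega)).LL ?_
  · have := lk.swap_swap
    rwa [swapWord, ← hD] at this
  · have := F.cube d hd hn
    rw [mul_assoc (L (d + 1)) (h (d + 2)), ← (F.hh (d + 1) (d + 2) (by omega) (by omega) (by omega)
      hn).eq, mul_assoc _ (h (d + 2)), ← (F.hh (d + 1) (d + 2) (by omega) (by omega) (by omega)
      hn).eq] at this
    rw [hD]
    simpa only [mul_assoc] using this

/-- This is the form in which the three-qubit relation R12 is used: it moves L_{d+1} across the swap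
of qubits d and d+1. -/
theorem swap_braid {j : ℕ} (hj : lo ≤ j) (hn : j + 2 ≤ n) :
    swapWord (h j) (h (j + 1)) (L j) * L (j + 1) * swapWord (h j) (h (j + 1)) (L j)
      = swapWord (h (j + 1)) (h (j + 2)) (L (j + 1)) * L j
        * swapWord (h (j + 1)) (h (j + 2)) (L (j + 1)) := by
  have h0 := F.one_le
  exact (three_iff_swap_braid (F.link hj (by omega)) (F.link (i := j + 1) (by omega) (by omega))
    (F.hh j (j + 2) hj (by omega) (by omega) hn)
    (F.Lh (j + 1) j (by omega) (by omega) hj (by omega) (by omega) (by omega))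
    (F.Lh j (j + 2) (by omega) (by omega) (by omega) hn (by omega) (by omega))
    (F.LL j (j + 1) (by omega) (by omega) (by omega) (by omega))).1 (F.three j hj hn)

end CliffordFamily

/-! ### The action of the projective Clifford group on Pauli operators -/

noncomputable section

/-- The action `P ↦ U⁻¹ P U` of the class of `U` on the unitary matrices. -/
def cliffAct (n : ℕ) : ProjClifford n →* MulAut (UnitaryN n) :=
  (QuotientGroup.lift (phases n) (MulAut.conj.comp (CliffordGroup n).subtype) (by
    -- Conjugation by a scalar is trivial, so it descends to the quotient. The inversion composed
    -- with it turns the opposite product back into a left action.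
    rintro U ⟨c, hc⟩
    ext1 P
    apply Subtype.ext
    have h1 := Matrix.mem_unitaryGroup_iff.1 (U : UnitaryN n).2
    rw [hc] at h1
    simp only [MonoidHom.comp_apply, MulAut.conj_apply, Subgroup.coe_subtype, MulAut.one_apply]
    change (U : UnitaryN n).1 * P.1 * star (U : UnitaryN n).1 = P.1
    rw [hc, Matrix.smul_mul, Matrix.one_mul, ← mul_one P.1, ← Matrix.mul_smul, Matrix.mul_assoc,
      h1])).comp (MulEquiv.inv' _).symm.toMonoidHom

/-- The Pauli `X` operator of qubit `i` (the identity if there is no such qubit). -/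
def pX (n i : ℕ) : UnitaryN n :=
  if hi : 1 ≤ i ∧ i ≤ n then onQubit (⟨i - 1, by omega⟩ : Fin n) gateX else 1

/-- The Pauli `Z` operator of qubit `i` (the identity if there is no such qubit). -/
def pZ (n i : ℕ) : UnitaryN n :=
  if hi : 1 ≤ i ∧ i ≤ n then onQubit (⟨i - 1, by omega⟩ : Fin n) gateZ else 1

/-- The class of the Hadamard gate of qubit `i` (trivial if there is no such qubit). -/
def gH (n i : ℕ) : ProjClifford n := if hi : 1 ≤ i ∧ i ≤ n then clH n i hi else 1

/-- The class of the phase gate of qubit `i` (trivial if there is no such qubit). -/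
def gS (n i : ℕ) : ProjClifford n := if hi : 1 ≤ i ∧ i ≤ n then clS n i hi else 1

/-- The class of the controlled `Z` gate of the qubits `i` and `i + 1` (trivial if there are no
such qubits). -/
def gL (n i : ℕ) : ProjClifford n := if hi : 1 ≤ i ∧ i + 1 ≤ n then clL n i hi else 1

/-- The Pauli `Y` operator of qubit `i`. -/
def pY (n i : ℕ) : UnitaryN n := cliffAct n (gS n i) (pX n i)

variable {n i j : ℕ}

theorem cliffAct_projClass (U : UnitaryN n) (hU : U ∈ CliffordGroup n) (P : UnitaryN n) :
    cliffAct n (projClass U hU) P = U⁻¹ * P * U := by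
  change U⁻¹ * P * U⁻¹⁻¹ = _
  rw [inv_inv]

theorem exists_projClass (u : ProjClifford n) : ∃ U hU, u = projClass U hU := by
  induction u using MulOpposite.rec' with | _ q
  induction q using QuotientGroup.induction_on with | H U
  exact ⟨U.1, U.2, rfl⟩

theorem cliffAct_neg (u : ProjClifford n) (P : UnitaryN n) :
    cliffAct n u (-P) = -cliffAct n u P := by
  obtain ⟨U, hU, rfl⟩ := exists_projClass u
  simp only [cliffAct_projClass, mul_neg, neg_mul]

theorem cliffAct_phaseI (u : ProjClifford n) : cliffAct n u (phaseI n) = phaseI n := by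
  obtain ⟨U, hU, rfl⟩ := exists_projClass u
  rw [cliffAct_projClass, mul_assoc, ← phaseI_comm, inv_mul_cancel_left]

theorem phaseI_sq : phaseI n * phaseI n = -1 := by
  apply Subtype.ext
  change (Complex.I • (1 : Matrix (Fin n → Fin 2) (Fin n → Fin 2) ℂ)) * (Complex.I • 1) = -1
  simp [smul_smul]

/-- The action is by U⁻¹, so conjugation rules for the gates are read from right to left. -/
theorem cliffAct_eq_of {U P Q : UnitaryN n} {hU : U ∈ CliffordGroup n}
    (h : U * Q * U⁻¹ = P) : cliffAct n (projClass U hU) P = Q := by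
  rw [cliffAct_projClass, ← h]; group

theorem mul_self_pX : pX n i * pX n i = 1 := by
  unfold pX
  split_ifs
  · rw [← map_mul]
    have : gateX * gateX = 1 := by
      apply Subtype.ext
      ext i j; fin_cases i <;> fin_cases j <;> simp [gateX]
    rw [this, map_one]
  · exact mul_one 1

theorem mul_self_pZ : pZ n i * pZ n i = 1 := by
  unfold pZ
  split_ifs
  · rw [← map_mul]
    have : gateZ * gateZ = 1 := by
      apply Subtype.ext
      ext i j; fin_cases i <;> fin_cases j <;> simp [gateZ]
    rw [this, map_one]
  · exact mul_one 1

theorem pX_mul_pZ (hi : 1 ≤ i) (hi' : i ≤ n) : pX n i * pZ n i = -(pZ n i * pX n i) := by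
  unfold pX pZ
  rw [dif_pos ⟨hi, hi'⟩, dif_pos ⟨hi, hi'⟩, ← map_mul, ← map_mul]
  apply Subtype.ext
  change onQubitMat _ (gateX * gateZ : Matrix.unitaryGroup (Fin 2) ℂ).1
    = -onQubitMat _ (gateZ * gateX : Matrix.unitaryGroup (Fin 2) ℂ).1
  ext a b
  rw [Matrix.neg_apply, onQubitMat_apply, onQubitMat_apply]
  have : ∀ x y : Fin 2, (gateX * gateZ : Matrix.unitaryGroup (Fin 2) ℂ).1 x y
      = -(gateZ * gateX : Matrix.unitaryGroup (Fin 2) ℂ).1 x y := by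
    intro x y
    fin_cases x <;> fin_cases y <;> simp [gateX, gateZ]
  rw [this]
  split_ifs <;> simp

theorem onQubit_commute {i j : Fin n} (hij : i ≠ j) (A B) :
    Commute (onQubit i A : UnitaryN n) (onQubit j B) := onQubit_comm hij A B

theorem pX_comm_pX : Commute (pX n i) (pX n j) := by
  by_cases hij : i = j
  · rw [hij]
  unfold pX
  split_ifs
  · exact onQubit_commute (by rw [Ne, Fin.mk.injEq]; omega) _ _
  all_goals simp

theorem pZ_comm_pZ : Commute (pZ n i) (pZ n j) := by
  by_cases hij : i = j
  · rw [hij]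
  unfold pZ
  split_ifs
  · exact onQubit_commute (by rw [Ne, Fin.mk.injEq]; omega) _ _
  all_goals simp

theorem pX_comm_pZ (hij : i ≠ j) : Commute (pX n i) (pZ n j) := by
  unfold pX pZ
  split_ifs
  · exact onQubit_commute (by rw [Ne, Fin.mk.injEq]; omega) _ _
  all_goals simp

theorem act_gH_X : cliffAct n (gH n i) (pX n i) = pZ n i := by
  unfold gH pX pZ
  split_ifs with hi
  · apply cliffAct_eq_of
    rw [← map_mul, ← map_inv, ← map_mul, gateH_conj_Z]
  · simp

theorem act_gH_Z : cliffAct n (gH n i) (pZ n i) = pX n i := by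
  unfold gH pX pZ
  split_ifs with hi
  · apply cliffAct_eq_of
    rw [← map_mul, ← map_inv, ← map_mul, gateH_conj_X]
  · simp

theorem act_gH_X_ne (hij : i ≠ j) : cliffAct n (gH n i) (pX n j) = pX n j := by
  unfold gH pX
  split_ifs
  · apply cliffAct_eq_of
    exact onQubit_conj_of_ne (by rw [Ne, Fin.mk.injEq]; omega) _ _
  all_goals simp

theorem act_gH_Z_ne (hij : i ≠ j) : cliffAct n (gH n i) (pZ n j) = pZ n j := by
  unfold gH pZ
  split_ifs
  · apply cliffAct_eq_of
    exact onQubit_conj_of_ne (by rw [Ne, Fin.mk.injEq]; omega) _ _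
  all_goals simp

theorem act_gS_X_ne (hij : i ≠ j) : cliffAct n (gS n i) (pX n j) = pX n j := by
  unfold gS pX
  split_ifs
  · apply cliffAct_eq_of
    exact onQubit_conj_of_ne (by rw [Ne, Fin.mk.injEq]; omega) _ _
  all_goals simp

theorem act_gS_Z : cliffAct n (gS n i) (pZ n j) = pZ n j := by
  unfold gS pZ
  split_ifs with h1 h2
  · apply cliffAct_eq_of
    by_cases hij : i = j
    · subst hij
      rw [← map_mul, ← map_inv, ← map_mul, gateS_conj_Z]
    · exact onQubit_conj_of_ne (by rw [Ne, Fin.mk.injEq]; omega) _ _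
  all_goals simp

/-- This fixes the sign convention: S⁻¹ X S is minus the usual Y matrix, so here X = i Y Z. -/
theorem pX_eq_pY (hi : 1 ≤ i) (hi' : i ≤ n) : pX n i = phaseI n * (pY n i * pZ n i) := by
  have h1 : cliffAct n (gS n i) (phaseI n * (pX n i * pZ n i)) = pX n i := by
    unfold gS pX pZ
    rw [dif_pos ⟨hi, hi'⟩, dif_pos ⟨hi, hi'⟩, dif_pos ⟨hi, hi'⟩]
    apply cliffAct_eq_of
    exact gateS_conj_X _
  rw [map_mul, map_mul, cliffAct_phaseI, act_gS_Z] at h1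
  exact h1.symm

theorem act_gL_Z : cliffAct n (gL n i) (pZ n j) = pZ n j := by
  unfold gL pZ
  split_ifs
  · apply cliffAct_eq_of
    exact gateCZ_conj_Z _ _ _
  all_goals simp

theorem act_gL_X (hi : 1 ≤ i) (hi' : i + 1 ≤ n) :
    cliffAct n (gL n i) (pX n i) = pX n i * pZ n (i + 1) := by
  unfold gL pX pZ
  rw [dif_pos ⟨hi, hi'⟩, dif_pos ⟨hi, by omega⟩, dif_pos ⟨by omega, hi'⟩]
  rw [clL, cliffAct_projClass, inv_eq_of_mul_eq_one_left (gateCZ_mul_self _ _)]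
  have := gateCZ_conj_X_left (n := n) (p := ⟨i - 1, by omega⟩) (q := ⟨i, by omega⟩)
    (by rw [Ne, Fin.mk.injEq]; omega)
  rw [inv_eq_of_mul_eq_one_left (gateCZ_mul_self _ _)] at this
  exact this

theorem act_gL_X_succ (hi : 1 ≤ i) (hi' : i + 1 ≤ n) :
    cliffAct n (gL n i) (pX n (i + 1)) = pX n (i + 1) * pZ n i := by
  unfold gL pX pZ
  rw [dif_pos ⟨hi, hi'⟩, dif_pos ⟨by omega, hi'⟩, dif_pos ⟨hi, by omega⟩]
  rw [clL, cliffAct_projClass, gateCZ_comm, inv_eq_of_mul_eq_one_left (gateCZ_mul_self _ _)]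
  have := gateCZ_conj_X_left (n := n) (q := ⟨i - 1, by omega⟩) (p := ⟨i, by omega⟩)
    (by rw [Ne, Fin.mk.injEq]; omega)
  rw [inv_eq_of_mul_eq_one_left (gateCZ_mul_self _ _)] at this
  exact this

theorem act_gL_X_ne (h1 : j ≠ i) (h2 : j ≠ i + 1) :
    cliffAct n (gL n i) (pX n j) = pX n j := by
  unfold gL pX
  split_ifs
  · apply cliffAct_eq_of
    exact gateCZ_conj_X_of_ne (by rw [Ne, Fin.mk.injEq]; omega) (by rw [Ne, Fin.mk.injEq]; omega)
  all_goals simp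

theorem mul_self_pY : pY n i * pY n i = 1 := by
  rw [pY, ← map_mul, mul_self_pX, map_one]

theorem pY_mul_pZ (hi : 1 ≤ i) (hi' : i ≤ n) : pY n i * pZ n i = -(pZ n i * pY n i) := by
  have := congrArg (cliffAct n (gS n i)) (pX_mul_pZ hi hi')
  rwa [cliffAct_neg, map_mul, map_mul, act_gS_Z] at this

/-- Apply s to X = i Y Z, which yields Y = i s(Y) Z, and substitute into the original equation; i² =
-1 gives the sign. -/
theorem act_gS_Y (hi : 1 ≤ i) (hi' : i ≤ n) : cliffAct n (gS n i) (pY n i) = -pX n i := by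
  have h1 := congrArg (cliffAct n (gS n i)) (pX_eq_pY hi hi')
  rw [map_mul, map_mul, cliffAct_phaseI, act_gS_Z] at h1
  have h2 : cliffAct n (gS n i) (pX n i) = pY n i := rfl
  rw [h2] at h1
  have h3 := pX_eq_pY hi hi'
  rw [h1] at h3
  rw [h3]
  have e : ∀ A : UnitaryN n, phaseI n * (phaseI n * (A * pZ n i) * pZ n i)
      = phaseI n * phaseI n * (A * (pZ n i * pZ n i)) := fun A => by simp only [mul_assoc]
  rw [e, phaseI_sq, mul_self_pZ]
  simp

end

noncomputable section
variable {n i j : ℕ}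

theorem cliffAct_mul (u v : ProjClifford n) (P : UnitaryN n) :
    cliffAct n (u * v) P = cliffAct n u (cliffAct n v P) := by
  rw [map_mul]; rfl

theorem cliffAct_one (P : UnitaryN n) : cliffAct n 1 P = P := by
  rw [map_one]; rfl

theorem cliffAct_map_mul (u : ProjClifford n) (P Q : UnitaryN n) :
    cliffAct n u (P * Q) = cliffAct n u P * cliffAct n u Q :=
  map_mul (cliffAct n u) P Q

theorem cliffAct_map_one (u : ProjClifford n) : cliffAct n u 1 = 1 :=
  map_one (cliffAct n u)

theorem cliffAct_inv_eq {u : ProjClifford n} {P Q : UnitaryN n} (h : cliffAct n u P = Q) :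
    cliffAct n u⁻¹ Q = P := by
  rw [← h, ← cliffAct_mul, inv_mul_cancel, cliffAct_one]

theorem cliffAct_injective (u : ProjClifford n) {P Q : UnitaryN n}
    (h : cliffAct n u P = cliffAct n u Q) : P = Q :=
  (cliffAct n u).injective h

/-- A matrix that commutes with all `X_i` and all `Z_i` is scalar. -/
theorem eq_smul_one_of_commute (U : Matrix (Fin n → Fin 2) (Fin n → Fin 2) ℂ)
    (hX : ∀ i, onQubitMat i gateX.1 * U = U * onQubitMat i gateX.1)
    (hZ : ∀ i, onQubitMat i gateZ.1 * U = U * onQubitMat i gateZ.1) :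
    ∃ c : ℂ, U = c • 1 := by
  have hflip : ∀ (i : Fin n) (a b : Fin n → Fin 2),
      onQubitMat i gateX.1 a b = if b = Function.update a i (1 - a i) then 1 else 0 := by
    intro i a b
    rw [onQubitMat_apply]
    have key : ∀ x y : Fin 2, gateX.1 x y = if y = 1 - x then 1 else 0 := by
      intro x y; fin_cases x <;> fin_cases y <;> simp [gateX]
    rw [key, ← ite_and]
    refine if_congr ?_ rfl rfl
    rw [funext_iff]
    constructor
    · rintro ⟨h1, h2⟩ j
      by_cases hj : j = i
      · subst hj; simpa using h2
      · rw [Function.update_of_ne hj, h1 j hj]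
    · intro h
      refine ⟨fun j hj => ?_, ?_⟩
      · rw [h j, Function.update_of_ne hj]
      · rw [h i, Function.update_self]
  -- If a and b differ in bit i, commutation with Z_i gives U a b = -U a b.
  have hoff : ∀ a b, a ≠ b → U a b = 0 := by
    intro a b hab
    obtain ⟨i, hi⟩ := Function.ne_iff.1 hab
    have h1 := congrFun (congrFun (hZ i) a) b
    have h2 : onQubitMat i gateZ.1 = Matrix.diagonal fun a => if a i = 1 then (-1 : ℂ) else 1 :=
      onQubit_Z_eq i
    rw [h2, Matrix.diagonal_mul, Matrix.mul_diagonal] at h1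
    generalize U a b = x at h1 ⊢
    generalize a i = p at h1 hi
    generalize b i = q at h1 hi
    have h3 : -x = x → x = 0 := fun h => by
      have : (2 : ℂ) * x = 0 := by linear_combination -h
      simpa using this
    fin_cases p <;> fin_cases q <;> simp at h1 hi ⊢
    · exact h3 h1.symm
    · exact h3 h1
  -- Commutation with X_i says that flipping bit i does not change the diagonal entry.
  have hdiag : ∀ (i : Fin n) a, U (Function.update a i (1 - a i)) (Function.update a i (1 - a i))
      = U a a := by
    intro i a
    have h1 := congrFun (congrFun (hX i) a) (Function.update a i (1 - a i))
    simp only [Matrix.mul_apply, hflip, ite_mul, one_mul, zero_mul, mul_ite, mul_one, mul_zero,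
      Finset.sum_ite_eq', Finset.mem_univ, if_true] at h1
    rw [h1]
    rw [Finset.sum_eq_single a]
    · simp
    · intro c _ hc
      rw [hoff a c hc.symm, ite_self]
    · simp
  -- The bits of a are switched on one at a time, starting from the zero string.
  have hall : ∀ (a : Fin n → Fin 2) (S : Finset (Fin n)),
      U (fun i => if i ∈ S then a i else 0) (fun i => if i ∈ S then a i else 0) = U 0 0 := by
    intro a S
    induction S using Finset.induction_on with
    | empty => rfl
    | insert i S hi ih =>
      by_cases h0 : a i = 0
      · rw [← ih]
        have : (fun j => if j ∈ insert i S then a j else 0) = fun j => if j ∈ S then a j else 0 := by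
          funext j
          by_cases hj : j = i
          · subst hj; simp [h0]
          · simp [hj]
        rw [this]
      · rw [← ih, ← hdiag i (fun j => if j ∈ S then a j else 0)]
        have h1 : a i = 1 := by
          generalize a i = x at h0 ⊢
          fin_cases x <;> simp at h0 ⊢
        have : (fun j => if j ∈ insert i S then a j else 0)
            = Function.update (fun j => if j ∈ S then a j else 0) i
              (1 - if i ∈ S then a i else 0) := by
          funext j
          by_cases hj : j = i
          · subst hj; simp [h1, hi]
          · simp [hj]
        rw [this]
  refine ⟨U 0 0, ?_⟩
  ext a b
  rw [Matrix.smul_apply, Matrix.one_apply]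
  split_ifs with hab
  · subst hab
    have := hall a Finset.univ
    simpa using this
  · simpa using hoff a b hab

theorem pX_fin (i : Fin n) : pX n (i + 1) = onQubit i gateX := by
  rw [pX, dif_pos ⟨by omega, by omega⟩]; rfl

theorem pZ_fin (i : Fin n) : pZ n (i + 1) = onQubit i gateZ := by
  rw [pZ, dif_pos ⟨by omega, by omega⟩]; rfl

/-- A unitary fixing all X_i and Z_i commutes with them, hence is scalar, and scalars are trivial in
the quotient. -/
theorem eq_one_of_cliffAct {u : ProjClifford n}
    (hX : ∀ i, 1 ≤ i → i ≤ n → cliffAct n u (pX n i) = pX n i)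
    (hZ : ∀ i, 1 ≤ i → i ≤ n → cliffAct n u (pZ n i) = pZ n i) : u = 1 := by
  obtain ⟨U, hU, rfl⟩ := exists_projClass u
  have key : ∀ P : UnitaryN n, cliffAct n (projClass U hU) P = P → P.1 * U.1 = U.1 * P.1 := by
    intro P hP
    rw [cliffAct_projClass, mul_assoc, inv_mul_eq_iff_eq_mul] at hP
    exact congrArg Subtype.val hP
  have h1 : ∃ c : ℂ, U.1 = c • 1 := by
    apply eq_smul_one_of_commute
    · intro i
      have := key _ (hX (i + 1) (by omega) (by omega))
      rw [pX_fin] at this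
      exact this
    · intro i
      have := key _ (hZ (i + 1) (by omega) (by omega))
      rw [pZ_fin] at this
      exact this
  have h2 : (⟨U, hU⟩ : CliffordGroup n) ∈ phases n := h1
  exact congrArg MulOpposite.op ((QuotientGroup.eq_one_iff _).2 h2)

/-- Faithfulness of the action. Relations among the concrete gates are verified by comparing images
of the X_i and Z_i. -/
theorem cliffAct_ext {u v : ProjClifford n}
    (hX : ∀ i, 1 ≤ i → i ≤ n → cliffAct n u (pX n i) = cliffAct n v (pX n i))
    (hZ : ∀ i, 1 ≤ i → i ≤ n → cliffAct n u (pZ n i) = cliffAct n v (pZ n i)) : u = v := by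
  rw [← inv_mul_eq_one]
  exact (eq_one_of_cliffAct
    (fun i h1 h2 => by rw [cliffAct_mul]; exact cliffAct_inv_eq (hX i h1 h2))
    (fun i h1 h2 => by rw [cliffAct_mul]; exact cliffAct_inv_eq (hZ i h1 h2)))

end

/-! ### Pauli operators supported on the last qubits -/

noncomputable section
variable {n d i j : ℕ}

theorem unitaryN_neg_ne (P : UnitaryN n) : -P ≠ P := by
  intro h
  have h1 : (-1 : UnitaryN n) = 1 := by
    apply mul_right_cancel (b := P)
    rw [neg_mul, one_mul, h]
  have h2 := congrFun (congrFun (congrArg Subtype.val h1) 0) 0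
  change (-1 : Matrix (Fin n → Fin 2) (Fin n → Fin 2) ℂ) 0 0 = (1 : Matrix _ _ ℂ) 0 0 at h2
  rw [Matrix.neg_apply, Matrix.one_apply_eq] at h2
  norm_num at h2

/-- The Pauli operators supported on the qubits `d, d + 1, …, n`. -/
def pauliFrom (n d : ℕ) : Subgroup (UnitaryN n) :=
  Subgroup.closure ({P | ∃ i, d ≤ i ∧ i ≤ n ∧ (P = pX n i ∨ P = pZ n i)} ∪ {phaseI n})

theorem pX_mem (h1 : d ≤ i) (h2 : i ≤ n) : pX n i ∈ pauliFrom n d :=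
  Subgroup.subset_closure (Or.inl ⟨i, h1, h2, Or.inl rfl⟩)

theorem pZ_mem (h1 : d ≤ i) (h2 : i ≤ n) : pZ n i ∈ pauliFrom n d :=
  Subgroup.subset_closure (Or.inl ⟨i, h1, h2, Or.inr rfl⟩)

theorem phaseI_mem_from : phaseI n ∈ pauliFrom n d := Subgroup.subset_closure (Or.inr rfl)

theorem neg_mem_from {P : UnitaryN n} (hP : P ∈ pauliFrom n d) : -P ∈ pauliFrom n d := by
  have := mul_mem (mul_mem (phaseI_mem_from (n := n) (d := d)) phaseI_mem_from) hP
  rwa [phaseI_sq, neg_mul, one_mul] at this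

theorem pY_eq (hi : 1 ≤ i) (hi' : i ≤ n) : pY n i = (phaseI n)⁻¹ * pX n i * pZ n i := by
  conv_rhs => rw [pX_eq_pY hi hi']
  rw [inv_mul_cancel_left, mul_assoc, mul_self_pZ, mul_one]

theorem pY_mem (h0 : 1 ≤ i) (h1 : d ≤ i) (h2 : i ≤ n) : pY n i ∈ pauliFrom n d := by
  rw [pY_eq h0 h2]
  exact mul_mem (mul_mem (inv_mem phaseI_mem_from) (pX_mem h1 h2)) (pZ_mem h1 h2)

theorem pauliFrom_le {S : Subgroup (UnitaryN n)} (hX : ∀ i, d ≤ i → i ≤ n → pX n i ∈ S)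
    (hZ : ∀ i, d ≤ i → i ≤ n → pZ n i ∈ S) (hp : phaseI n ∈ S) : pauliFrom n d ≤ S := by
  rw [pauliFrom, Subgroup.closure_le]
  rintro P (⟨i, h1, h2, rfl | rfl⟩ | rfl)
  exacts [hX i h1 h2, hZ i h1 h2, hp]

theorem pauliFrom_mono {d' : ℕ} (h : d ≤ d') : pauliFrom n d' ≤ pauliFrom n d :=
  pauliFrom_le (fun _ h1 h2 => pX_mem (h.trans h1) h2) (fun _ h1 h2 => pZ_mem (h.trans h1) h2)
    phaseI_mem_from

theorem pauliFrom_one : pauliFrom n 1 = PauliGroup n := by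
  apply le_antisymm
  · refine pauliFrom_le (fun i h1 h2 => ?_) (fun i h1 h2 => ?_) (phaseI_mem n)
    · rw [pX, dif_pos ⟨h1, h2⟩]; exact onQubit_X_mem _
    · rw [pZ, dif_pos ⟨h1, h2⟩]; exact onQubit_Z_mem _
  · rw [PauliGroup, Subgroup.closure_le]
    rintro _ ((⟨i, rfl⟩ | ⟨i, rfl⟩) | rfl)
    · change onQubit i gateX ∈ _
      rw [← pX_fin]; exact pX_mem (by omega) (by omega)
    · change onQubit i gateZ ∈ _
      rw [← pZ_fin]; exact pZ_mem (by omega) (by omega)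
    · exact phaseI_mem_from

theorem commute_of_mem_from {P A : UnitaryN n} (hX : ∀ i, d ≤ i → i ≤ n → Commute (pX n i) A)
    (hZ : ∀ i, d ≤ i → i ≤ n → Commute (pZ n i) A) (hP : P ∈ pauliFrom n d) : Commute P A := by
  have : pauliFrom n d ≤ Subgroup.centralizer {A} :=
    pauliFrom_le (fun i h1 h2 => Subgroup.mem_centralizer_singleton_iff.2 (hX i h1 h2))
      (fun i h1 h2 => Subgroup.mem_centralizer_singleton_iff.2 (hZ i h1 h2))
      (Subgroup.mem_centralizer_singleton_iff.2 (phaseI_comm A).symm)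
  exact Subgroup.mem_centralizer_singleton_iff.1 (this hP)

theorem commute_pX {P : UnitaryN n} (hP : P ∈ pauliFrom n (d + 1)) : Commute P (pX n d) :=
  commute_of_mem_from (fun _ _ _ => pX_comm_pX) (fun _ _ _ => (pX_comm_pZ (by omega)).symm) hP

theorem commute_pZ {P : UnitaryN n} (hP : P ∈ pauliFrom n (d + 1)) : Commute P (pZ n d) :=
  commute_of_mem_from (fun _ _ _ => pX_comm_pZ (by omega)) (fun _ _ _ => pZ_comm_pZ) hP

theorem commute_phaseI (P : UnitaryN n) : Commute P (phaseI n) := phaseI_comm P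

theorem commute_pY {P : UnitaryN n} (h1 : 1 ≤ d) (h2 : d ≤ n) (hP : P ∈ pauliFrom n (d + 1)) :
    Commute P (pY n d) := by
  rw [pY_eq h1 h2]
  exact (((commute_phaseI P).inv_right).mul_right (commute_pX hP)).mul_right (commute_pZ hP)

/-- A Pauli operator on the qubits `d, …, n` is a Pauli operator on qubit `d` times a Pauli
operator on the other qubits. -/
theorem exists_decomposition (h1 : 1 ≤ d) (h2 : d ≤ n) {P : UnitaryN n}
    (hP : P ∈ pauliFrom n d) : ∃ A Q, (A = 1 ∨ A = pX n d ∨ A = pY n d ∨ A = pZ n d) ∧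
      Q ∈ pauliFrom n (d + 1) ∧ P = A * Q := by
  -- A factor on the later qubits passes through A and is absorbed in Q.
  have hsmall : ∀ R ∈ pauliFrom n (d + 1), ∀ P : UnitaryN n,
      (∃ A Q, (A = 1 ∨ A = pX n d ∨ A = pY n d ∨ A = pZ n d) ∧
        Q ∈ pauliFrom n (d + 1) ∧ P = A * Q) →
      ∃ A Q, (A = 1 ∨ A = pX n d ∨ A = pY n d ∨ A = pZ n d) ∧
        Q ∈ pauliFrom n (d + 1) ∧ R * P = A * Q := by
    rintro R hR P ⟨A, Q, hA, hQ, rfl⟩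
    refine ⟨A, R * Q, hA, mul_mem hR hQ, ?_⟩
    have : Commute R A := by
      rcases hA with rfl | rfl | rfl | rfl
      exacts [Commute.one_right R, commute_pX hR, commute_pY h1 h2 hR, commute_pZ hR]
    rw [← mul_assoc, this.eq, mul_assoc]
  have hZ : ∀ P : UnitaryN n,
      (∃ A Q, (A = 1 ∨ A = pX n d ∨ A = pY n d ∨ A = pZ n d) ∧
        Q ∈ pauliFrom n (d + 1) ∧ P = A * Q) →
      ∃ A Q, (A = 1 ∨ A = pX n d ∨ A = pY n d ∨ A = pZ n d) ∧
        Q ∈ pauliFrom n (d + 1) ∧ pZ n d * P = A * Q := by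
    rintro P ⟨A, Q, rfl | rfl | rfl | rfl, hQ, rfl⟩
    · exact ⟨pZ n d, Q, by simp only [or_true], hQ, by rw [one_mul]⟩
    · refine ⟨pY n d, -(phaseI n * Q), by simp only [true_or, or_true],
        neg_mem_from (mul_mem phaseI_mem_from hQ), ?_⟩
      have : pZ n d * pX n d = -(pY n d * phaseI n) := by
        rw [← neg_eq_iff_eq_neg, ← pX_mul_pZ h1 h2, phaseI_comm, pX_eq_pY h1 h2, mul_assoc,
          mul_assoc, mul_self_pZ, mul_one]
      rw [← mul_assoc, this, neg_mul, mul_neg, mul_assoc]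
    · refine ⟨pX n d, -((phaseI n)⁻¹ * Q), by simp only [true_or, or_true],
        neg_mem_from (mul_mem (inv_mem phaseI_mem_from) hQ), ?_⟩
      have : pZ n d * pY n d = -(pX n d * (phaseI n)⁻¹) := by
        rw [← neg_eq_iff_eq_neg, ← pY_mul_pZ h1 h2, ((commute_phaseI _).inv_right).eq,
          pX_eq_pY h1 h2, inv_mul_cancel_left]
      rw [← mul_assoc, this, neg_mul, mul_neg, mul_assoc]
    · exact ⟨1, Q, by simp only [true_or], hQ, by rw [← mul_assoc, mul_self_pZ]⟩
  have hX : ∀ P : UnitaryN n,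
      (∃ A Q, (A = 1 ∨ A = pX n d ∨ A = pY n d ∨ A = pZ n d) ∧
        Q ∈ pauliFrom n (d + 1) ∧ P = A * Q) →
      ∃ A Q, (A = 1 ∨ A = pX n d ∨ A = pY n d ∨ A = pZ n d) ∧
        Q ∈ pauliFrom n (d + 1) ∧ pX n d * P = A * Q := by
    rintro P ⟨A, Q, rfl | rfl | rfl | rfl, hQ, rfl⟩
    · exact ⟨pX n d, Q, by simp only [true_or, or_true], hQ, by rw [one_mul]⟩
    · exact ⟨1, Q, by simp only [true_or], hQ, by rw [← mul_assoc, mul_self_pX]⟩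
    · refine ⟨pZ n d, -(phaseI n * Q), by simp only [or_true],
        neg_mem_from (mul_mem phaseI_mem_from hQ), ?_⟩
      have : pX n d * pY n d = -(pZ n d * phaseI n) := by
        rw [pX_eq_pY h1 h2, mul_assoc, mul_assoc, ← neg_eq_iff_eq_neg, ← mul_neg, ← mul_neg,
          ← pY_mul_pZ h1 h2, ← mul_assoc (pY n d), mul_self_pY, one_mul, phaseI_comm]
      rw [← mul_assoc, this, neg_mul, mul_neg, mul_assoc]
    · refine ⟨pY n d, phaseI n * Q, by simp only [true_or, or_true],
        mul_mem phaseI_mem_from hQ, ?_⟩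
      have : pX n d * pZ n d = pY n d * phaseI n := by
        rw [phaseI_comm, pX_eq_pY h1 h2, mul_assoc, mul_assoc, mul_self_pZ, mul_one]
      rw [← mul_assoc, this, mul_assoc]
  -- Left multiplication by a generator keeps the shape A Q; products of two operators on qubit d
  -- put their phase into Q.
  refine Subgroup.closure_induction_left (p := fun P _ => ∃ A Q,
    (A = 1 ∨ A = pX n d ∨ A = pY n d ∨ A = pZ n d) ∧ Q ∈ pauliFrom n (d + 1) ∧ P = A * Q)
    ⟨1, 1, Or.inl rfl, one_mem _, by rw [mul_one]⟩ ?_ ?_ hP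
  · rintro R (⟨i, hi, hi', rfl | rfl⟩ | rfl) P _ ih
    · rcases hi.eq_or_lt with rfl | hi
      · exact hX _ ih
      · exact hsmall _ (pX_mem hi hi') _ ih
    · rcases hi.eq_or_lt with rfl | hi
      · exact hZ _ ih
      · exact hsmall _ (pZ_mem hi hi') _ ih
    · exact hsmall _ phaseI_mem_from _ ih
  · rintro R (⟨i, hi, hi', rfl | rfl⟩ | rfl) P _ ih
    · rcases hi.eq_or_lt with rfl | hi
      · rw [inv_eq_of_mul_eq_one_left mul_self_pX]; exact hX _ ih
      · exact hsmall _ (inv_mem (pX_mem hi hi')) _ ih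
    · rcases hi.eq_or_lt with rfl | hi
      · rw [inv_eq_of_mul_eq_one_left mul_self_pZ]; exact hZ _ ih
      · exact hsmall _ (inv_mem (pZ_mem hi hi')) _ ih
    · exact hsmall _ (inv_mem phaseI_mem_from) _ ih

/-- The only involutions among the scalars in the Pauli group are `±1`. -/
theorem eq_one_or_of_mem_from_succ {P : UnitaryN n} (hP : P ∈ pauliFrom n (n + 1))
    (h2 : P * P = 1) : P = 1 ∨ P = -1 := by
  -- No qubit has index at least n+1, so only the phase generator is left.
  have h : P ∈ Subgroup.zpowers (phaseI n) :=
    pauliFrom_le (fun i h1 h2 => by omega) (fun i h1 h2 => by omega)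
      (Subgroup.mem_zpowers _) hP
  obtain ⟨k, rfl⟩ := h
  simp only at h2 ⊢
  have h4 : (phaseI n) ^ (2 : ℤ) = -1 := by rw [zpow_ofNat, pow_two, phaseI_sq]
  rcases Int.even_or_odd' k with ⟨m, rfl | rfl⟩
  · rw [zpow_mul, h4]
    rcases Int.even_or_odd m with hm | hm
    · left; rw [hm.neg_one_zpow]
    · right; rw [hm.neg_one_zpow]
  · exfalso
    rw [← zpow_add, show (2 * m + 1 + (2 * m + 1) : ℤ) = 2 * (2 * m + 1) by ring, zpow_mul, h4,
      Odd.neg_one_zpow ⟨m, rfl⟩] at h2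
    exact unitaryN_neg_ne _ h2

end

/-! ### Transitivity of the gates on Pauli operators -/

noncomputable section
variable {n d i j : ℕ}

/-- The subgroup of the projective Clifford group generated by `h_i` with `a ≤ i` and `s_i`, `Λ_i`
with `d ≤ i`. -/
abbrev cliffGates (n a d : ℕ) : Subgroup (ProjClifford n) :=
  gateGroup n (gH n) (gS n) (gL n) a d

/-- The elements of the projective Clifford group that fix the operator `P`. -/
def fixer (P : UnitaryN n) : Subgroup (ProjClifford n) where
  carrier := {u | cliffAct n u P = P}
  one_mem' := cliffAct_one P
  mul_mem' {u v} hu hv := by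
    change cliffAct n (u * v) P = P
    rw [cliffAct_mul, hv, hu]
  inv_mem' {u} hu := cliffAct_inv_eq hu

theorem mem_fixer {P : UnitaryN n} {u : ProjClifford n} : u ∈ fixer P ↔ cliffAct n u P = P :=
  Iff.rfl

theorem act_pX_of_lt {u : ProjClifford n} {a b : ℕ} (hu : u ∈ cliffGates n a b) (ha : d < a)
    (hb : d < b) : cliffAct n u (pX n d) = pX n d :=
  (gateGroup_le (S := fixer (pX n d)) (fun _ _ _ => act_gH_X_ne (by omega))
    (fun _ _ _ => act_gS_X_ne (by omega)) (fun _ _ _ => act_gL_X_ne (by omega) (by omega)) hu)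

theorem act_pZ_of_lt {u : ProjClifford n} {a b : ℕ} (hu : u ∈ cliffGates n a b) (ha : d < a) :
    cliffAct n u (pZ n d) = pZ n d :=
  (gateGroup_le (S := fixer (pZ n d)) (fun _ _ _ => act_gH_Z_ne (by omega))
    (fun _ _ _ => act_gS_Z) (fun _ _ _ => act_gL_Z) hu)

theorem act_pY_of_lt {u : ProjClifford n} {a b : ℕ} (hu : u ∈ cliffGates n a b) (ha : d < a)
    (hb : d < b) (h1 : 1 ≤ d) (h2 : d ≤ n) : cliffAct n u (pY n d) = pY n d := by
  rw [pY_eq h1 h2, cliffAct_map_mul, cliffAct_map_mul, act_pX_of_lt hu ha hb, act_pZ_of_lt hu ha,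
    map_inv, cliffAct_phaseI]

theorem act_mem_from_of_gens {u : ProjClifford n} {e : ℕ}
    (hX : ∀ i, d ≤ i → i ≤ n → cliffAct n u (pX n i) ∈ pauliFrom n e)
    (hZ : ∀ i, d ≤ i → i ≤ n → cliffAct n u (pZ n i) ∈ pauliFrom n e) {P : UnitaryN n}
    (hP : P ∈ pauliFrom n d) : cliffAct n u P ∈ pauliFrom n e :=
  (pauliFrom_le (S := (pauliFrom n e).comap (cliffAct n u).toMonoidHom) hX hZ
    (by
      change cliffAct n u (phaseI n) ∈ pauliFrom n e
      rw [cliffAct_phaseI]; exact phaseI_mem_from)) hP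

/-- The gates on the qubits `d, …, n` preserve the Pauli operators on these qubits. -/
theorem act_mem_from {u : ProjClifford n} {a : ℕ} (hd : 1 ≤ d)
    (hu : u ∈ cliffGates n a d) :
    ∀ P ∈ pauliFrom n d, cliffAct n u P ∈ pauliFrom n d := by
  have key : ∀ v : ProjClifford n,
      (∀ i, d ≤ i → i ≤ n → cliffAct n v (pX n i) ∈ pauliFrom n d ∧
        cliffAct n v⁻¹ (pX n i) ∈ pauliFrom n d) →
      (∀ i, d ≤ i → i ≤ n → cliffAct n v (pZ n i) ∈ pauliFrom n d ∧
        cliffAct n v⁻¹ (pZ n i) ∈ pauliFrom n d) →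
      (∀ P ∈ pauliFrom n d, cliffAct n v P ∈ pauliFrom n d) ∧
        ∀ P ∈ pauliFrom n d, cliffAct n v⁻¹ P ∈ pauliFrom n d := fun v hX hZ =>
    ⟨fun P hP => act_mem_from_of_gens (fun i h1 h2 => (hX i h1 h2).1)
      (fun i h1 h2 => (hZ i h1 h2).1) hP, fun P hP => act_mem_from_of_gens
      (fun i h1 h2 => (hX i h1 h2).2) (fun i h1 h2 => (hZ i h1 h2).2) hP⟩
  -- Preservation is required of both v and its inverse, so that closure under inversion is
  -- immediate.
  let S : Subgroup (ProjClifford n) :=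
    { carrier := {v | (∀ P ∈ pauliFrom n d, cliffAct n v P ∈ pauliFrom n d) ∧
        ∀ P ∈ pauliFrom n d, cliffAct n v⁻¹ P ∈ pauliFrom n d}
      one_mem' := ⟨fun P hP => by rwa [cliffAct_one], fun P hP => by rwa [inv_one, cliffAct_one]⟩
      mul_mem' := fun {v w} hv hw =>
        ⟨fun P hP => by rw [cliffAct_mul]; exact hv.1 _ (hw.1 _ hP),
          fun P hP => by rw [_root_.mul_inv_rev, cliffAct_mul]; exact hw.2 _ (hv.2 _ hP)⟩
      inv_mem' := fun {v} hv => ⟨hv.2, by simpa only [inv_inv] using hv.1⟩ }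
  have hle : cliffGates n a d ≤ S := by
    refine gateGroup_le (fun i h1 h2 => key _ (fun j h3 h4 => ?_) (fun j h3 h4 => ?_))
      (fun i h1 h2 => key _ (fun j h3 h4 => ?_) (fun j h3 h4 => ?_))
      (fun i h1 h2 => key _ (fun j h3 h4 => ?_) (fun j h3 h4 => ?_))
    · by_cases hij : i = j
      · subst hij
        rw [act_gH_X, cliffAct_inv_eq act_gH_Z]
        exact ⟨pZ_mem h3 h4, pZ_mem h3 h4⟩
      · rw [act_gH_X_ne hij, cliffAct_inv_eq (act_gH_X_ne hij)]
        exact ⟨pX_mem h3 h4, pX_mem h3 h4⟩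
    · by_cases hij : i = j
      · subst hij
        rw [act_gH_Z, cliffAct_inv_eq act_gH_X]
        exact ⟨pX_mem h3 h4, pX_mem h3 h4⟩
      · rw [act_gH_Z_ne hij, cliffAct_inv_eq (act_gH_Z_ne hij)]
        exact ⟨pZ_mem h3 h4, pZ_mem h3 h4⟩
    · by_cases hij : i = j
      · subst hij
        have h5 : cliffAct n (gS n i) (-pY n i) = pX n i := by
          rw [cliffAct_neg, act_gS_Y (hd.trans h1) h2, neg_neg]
        rw [cliffAct_inv_eq h5]
        exact ⟨pY_mem (hd.trans h1) h3 h4, neg_mem_from (pY_mem (hd.trans h1) h3 h4)⟩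
      · rw [act_gS_X_ne hij, cliffAct_inv_eq (act_gS_X_ne hij)]
        exact ⟨pX_mem h3 h4, pX_mem h3 h4⟩
    · rw [act_gS_Z, cliffAct_inv_eq act_gS_Z]
      exact ⟨pZ_mem h3 h4, pZ_mem h3 h4⟩
    · by_cases hij : j = i
      · subst hij
        have h5 : cliffAct n (gL n j) (pX n j * pZ n (j + 1)) = pX n j := by
          rw [cliffAct_map_mul, act_gL_Z, act_gL_X (hd.trans h1) h2, mul_assoc, mul_self_pZ,
            mul_one]
        rw [act_gL_X (hd.trans h1) h2, cliffAct_inv_eq h5]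
        exact ⟨mul_mem (pX_mem h3 h4) (pZ_mem (by omega) h2),
          mul_mem (pX_mem h3 h4) (pZ_mem (by omega) h2)⟩
      · by_cases hij' : j = i + 1
        · subst hij'
          have h5 : cliffAct n (gL n i) (pX n (i + 1) * pZ n i) = pX n (i + 1) := by
            rw [cliffAct_map_mul, act_gL_Z, act_gL_X_succ (hd.trans h1) h2, mul_assoc, mul_self_pZ,
              mul_one]
          rw [act_gL_X_succ (hd.trans h1) h2, cliffAct_inv_eq h5]
          exact ⟨mul_mem (pX_mem h3 h4) (pZ_mem h1 (by omega)),
            mul_mem (pX_mem h3 h4) (pZ_mem h1 (by omega))⟩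
        · rw [act_gL_X_ne hij hij', cliffAct_inv_eq (act_gL_X_ne hij hij')]
          exact ⟨pX_mem h3 h4, pX_mem h3 h4⟩
    · rw [act_gL_Z, cliffAct_inv_eq act_gL_Z]
      exact ⟨pZ_mem h3 h4, pZ_mem h3 h4⟩
  exact (hle hu).1

theorem mul_self_of_mul_commute {G : Type*} [Group G] {A Q : G} (hA : A * A = 1)
    (hAQ : Commute A Q) (h : A * Q * (A * Q) = 1) : Q * Q = 1 := by
  rw [hAQ.symm.mul_mul_mul_comm, hA, one_mul] at h
  exact h

/-- The gates on the qubits `d, …, n` act transitively on the nontrivial Pauli operators of order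
two on these qubits. -/
theorem exists_act_pZ_eq (m : ℕ) : ∀ d, 1 ≤ d → d + m = n → ∀ P ∈ pauliFrom n d, P * P = 1 →
    P ≠ 1 → P ≠ -1 → ∃ u ∈ cliffGates n d d, cliffAct n u (pZ n d) = P := by
  have main : ∀ d, 1 ≤ d → d ≤ n → (∀ P ∈ pauliFrom n (d + 1), P * P = 1 → P ≠ 1 → P ≠ -1 →
      d + 1 ≤ n ∧ ∃ u ∈ cliffGates n (d + 1) (d + 1), cliffAct n u (pZ n (d + 1)) = P) →
      ∀ P ∈ pauliFrom n d, P * P = 1 → P ≠ 1 → P ≠ -1 →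
        ∃ u ∈ cliffGates n d d, cliffAct n u (pZ n d) = P := by
    intro d h1 h2 ih P hP hPP hP1 hPn
    -- O is the orbit of Z_d. The gates of qubit d already put ±X_d, ±Y_d and ±Z_d in it, which
    -- settles P = A Q with Q = ±1.
    let O : UnitaryN n → Prop := fun P => ∃ u ∈ cliffGates n d d, cliffAct n u (pZ n d) = P
    have hO : ∀ u ∈ cliffGates n d d, ∀ P Q, O P → cliffAct n u P = Q → O Q := by
      rintro u hu P Q ⟨v, hv, rfl⟩ rfl
      exact ⟨u * v, mul_mem hu hv, cliffAct_mul _ _ _⟩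
    have mH : gH n d ∈ cliffGates n d d := h_mem_gateGroup le_rfl h2
    have mS : gS n d ∈ cliffGates n d d := s_mem_gateGroup le_rfl h2
    have oZ : O (pZ n d) := ⟨1, one_mem _, cliffAct_one _⟩
    have oX : O (pX n d) := hO _ mH _ _ oZ act_gH_Z
    have oY : O (pY n d) := hO _ mS _ _ oX rfl
    have oX' : O (-pX n d) := hO _ mS _ _ oY (act_gS_Y h1 h2)
    have oY' : O (-pY n d) := hO _ mS _ _ oX' (by rw [cliffAct_neg]; rfl)
    have oZ' : O (-pZ n d) := hO _ mH _ _ oX' (by rw [cliffAct_neg, act_gH_X])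
    obtain ⟨A, Q, hA, hQ, rfl⟩ := exists_decomposition h1 h2 hP
    have hQQ : Q * Q = 1 := by
      rcases hA with rfl | rfl | rfl | rfl
      · rwa [one_mul] at hPP
      · exact mul_self_of_mul_commute mul_self_pX (commute_pX hQ).symm hPP
      · exact mul_self_of_mul_commute mul_self_pY (commute_pY h1 h2 hQ).symm hPP
      · exact mul_self_of_mul_commute mul_self_pZ (commute_pZ hQ).symm hPP
    by_cases hQ1 : Q = 1
    · subst hQ1
      rw [mul_one] at hP1 ⊢
      rcases hA with rfl | rfl | rfl | rfl
      exacts [absurd rfl hP1, oX, oY, oZ]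
    by_cases hQn : Q = -1
    · subst hQn
      rw [mul_neg, mul_one] at hPn ⊢
      rcases hA with rfl | rfl | rfl | rfl
      exacts [absurd rfl hPn, oX', oY', oZ']
    -- For any other Q, induction gives Q = u(Z_{d+1}) with u acting on later qubits. Such u fixes
    -- A, so it is enough to reach A Z_{d+1}.
    obtain ⟨h3, u, hu, rfl⟩ := ih Q hQ hQQ hQ1 hQn
    have mH' : gH n (d + 1) ∈ cliffGates n d d := h_mem_gateGroup (by omega) h3
    have mL : gL n d ∈ cliffGates n d d := L_mem_gateGroup le_rfl h3
    have oXZ : O (pX n d * pZ n (d + 1)) := hO _ mL _ _ oX (act_gL_X h1 h3)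
    have oYZ : O (pY n d * pZ n (d + 1)) :=
      hO _ mS _ _ oXZ (by rw [cliffAct_map_mul, act_gS_Z]; rfl)
    have oZZ : O (pZ n d * pZ n (d + 1)) :=
      hO _ mH _ _ oXZ (by rw [cliffAct_map_mul, act_gH_X, act_gH_Z_ne (by omega)])
    have oZX : O (pZ n d * pX n (d + 1)) :=
      hO _ mH' _ _ oZZ (by rw [cliffAct_map_mul, act_gH_Z, act_gH_Z_ne (by omega)])
    -- L_d carries Z_d X_{d+1} to X_{d+1}; this is how an operator is moved off qubit d.
    have o1X : O (pX n (d + 1)) := hO _ mL _ _ oZX (by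
      rw [cliffAct_map_mul, act_gL_Z, act_gL_X_succ h1 h3, ← mul_assoc,
        ← (pX_comm_pZ (by omega : d + 1 ≠ d)).eq, mul_assoc, mul_self_pZ, mul_one])
    have o1Z : O (1 * pZ n (d + 1)) := hO _ mH' _ _ o1X (by rw [act_gH_X, one_mul])
    have hu' : u ∈ cliffGates n d d := gateGroup_mono (by omega) (by omega) hu
    have hAZ : O (A * pZ n (d + 1)) := by
      rcases hA with rfl | rfl | rfl | rfl
      exacts [o1Z, oXZ, oYZ, oZZ]
    have huA : cliffAct n u A = A := by
      rcases hA with rfl | rfl | rfl | rfl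
      exacts [cliffAct_map_one u, act_pX_of_lt hu (by omega) (by omega),
        act_pY_of_lt hu (by omega) (by omega) h1 h2, act_pZ_of_lt hu (by omega)]
    exact hO _ hu' _ _ hAZ (by rw [cliffAct_map_mul, huA])
  induction m with
  | zero =>
    intro d h1 h2
    refine main d h1 (by omega) fun P hP hPP hP1 hPn => ?_
    obtain rfl : d = n := by omega
    rcases eq_one_or_of_mem_from_succ hP hPP with h | h
    exacts [absurd h hP1, absurd h hPn]
  | succ m ih =>
    intro d h1 h2
    exact main d h1 (by omega) fun P hP hPP hP1 hPn =>
      ⟨by omega, ih (d + 1) (by omega) (by omega) P hP hPP hP1 hPn⟩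

theorem exists_act_pZ {P : UnitaryN n} (h1 : 1 ≤ d) (h2 : d ≤ n) (hP : P ∈ pauliFrom n d)
    (hPP : P * P = 1) (hP1 : P ≠ 1) (hPn : P ≠ -1) :
    ∃ u ∈ cliffGates n d d, cliffAct n u (pZ n d) = P :=
  exists_act_pZ_eq (n - d) d h1 (by omega) P hP hPP hP1 hPn

/-- A version for the qubits after `d`, of which there may be none. -/
theorem exists_act_pZ_succ {P : UnitaryN n} (h2 : d ≤ n)
    (hP : P ∈ pauliFrom n (d + 1)) (hPP : P * P = 1) (hP1 : P ≠ 1) (hPn : P ≠ -1) :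
    d + 1 ≤ n ∧ ∃ u ∈ cliffGates n (d + 1) (d + 1), cliffAct n u (pZ n (d + 1)) = P := by
  have h3 : d + 1 ≤ n := by
    by_contra h
    obtain rfl : d = n := by omega
    rcases eq_one_or_of_mem_from_succ hP hPP with h | h
    exacts [hP1 h, hPn h]
  exact ⟨h3, exists_act_pZ (by omega) h3 hP hPP hP1 hPn⟩

theorem anticommute_cases (h1 : 1 ≤ d) (h2 : d ≤ n) {P : UnitaryN n} (hP : P ∈ pauliFrom n d) :
    (P * pZ n d = pZ n d * P ∧ ∃ Q ∈ pauliFrom n (d + 1), P = Q ∨ P = pZ n d * Q) ∨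
    (P * pZ n d = -(pZ n d * P) ∧ ∃ Q ∈ pauliFrom n (d + 1), P = pX n d * Q ∨ P = pY n d * Q) := by
  obtain ⟨A, Q, hA, hQ, rfl⟩ := exists_decomposition h1 h2 hP
  have hc := (commute_pZ hQ).eq
  rcases hA with rfl | rfl | rfl | rfl
  · exact Or.inl ⟨by rw [one_mul, hc], Q, hQ, Or.inl (one_mul Q)⟩
  · exact Or.inr ⟨by rw [mul_assoc, hc, ← mul_assoc, ← mul_assoc, pX_mul_pZ h1 h2, neg_mul],
      Q, hQ, Or.inl rfl⟩
  · exact Or.inr ⟨by rw [mul_assoc, hc, ← mul_assoc, ← mul_assoc, pY_mul_pZ h1 h2, neg_mul],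
      Q, hQ, Or.inr rfl⟩
  · exact Or.inl ⟨by rw [mul_assoc, hc], Q, hQ, Or.inr rfl⟩

/-- The stabilizer of `Z_d` acts transitively on the Pauli operators of order two that do not
commute with `Z_d`. -/
theorem exists_act_pX {P : UnitaryN n} (h1 : 1 ≤ d) (h2 : d ≤ n) (hP : P ∈ pauliFrom n d)
    (hPP : P * P = 1) (hPZ : P * pZ n d = -(pZ n d * P)) :
    ∃ u ∈ cliffGates n (d + 1) d, cliffAct n u (pX n d) = P := by
  have mS : gS n d ∈ cliffGates n (d + 1) d := s_mem_gateGroup le_rfl h2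
  have hY : ∀ Q ∈ pauliFrom n (d + 1), (∃ u ∈ cliffGates n (d + 1) d,
      cliffAct n u (pX n d) = pX n d * Q) →
      ∃ u ∈ cliffGates n (d + 1) d, cliffAct n u (pX n d) = pY n d * Q := by
    rintro Q hQ ⟨u, hu, he⟩
    refine ⟨gS n d * u, mul_mem mS hu, ?_⟩
    have hQs : cliffAct n (gS n d) Q = Q :=
      (pauliFrom_le (S := (cliffAct n (gS n d)).toMonoidHom.eqLocus (MonoidHom.id _))
        (fun i _ _ => act_gS_X_ne (by omega)) (fun i _ _ => act_gS_Z) (cliffAct_phaseI _)) hQ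
    rw [cliffAct_mul, he, cliffAct_map_mul, hQs]
    rfl
  have hX : ∀ Q ∈ pauliFrom n (d + 1), Q * Q = 1 → ∃ u ∈ cliffGates n (d + 1) d,
      cliffAct n u (pX n d) = pX n d * Q := by
    intro Q hQ hQQ
    by_cases hQ1 : Q = 1
    · subst hQ1
      exact ⟨1, one_mem _, by rw [cliffAct_one, mul_one]⟩
    by_cases hQn : Q = -1
    · subst hQn
      -- s_d² is Z_d up to phase, and so negates X_d.
      refine ⟨gS n d * gS n d, mul_mem mS mS, ?_⟩
      rw [cliffAct_mul, mul_neg, mul_one]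
      exact act_gS_Y h1 h2
    -- L_d creates X_d Z_{d+1}, and u then moves Z_{d+1} to Q without touching X_d.
    obtain ⟨h3, u, hu, rfl⟩ := exists_act_pZ_succ h2 hQ hQQ hQ1 hQn
    refine ⟨u * gL n d, mul_mem (gateGroup_mono le_rfl (by omega) hu)
      (L_mem_gateGroup le_rfl h3), ?_⟩
    rw [cliffAct_mul, act_gL_X h1 h3, cliffAct_map_mul, act_pX_of_lt hu (by omega) (by omega)]
  rcases anticommute_cases h1 h2 hP with ⟨h, -⟩ | ⟨-, Q, hQ, rfl | rfl⟩
  · rw [h] at hPZ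
    exact absurd hPZ.symm (unitaryN_neg_ne _)
  · exact hX Q hQ (mul_self_of_mul_commute mul_self_pX (commute_pX hQ).symm hPP)
  · exact hY Q hQ (hX Q hQ (mul_self_of_mul_commute mul_self_pY (commute_pY h1 h2 hQ).symm hPP))

/-- The stabilizer of `Z_d` acts transitively on the Pauli operators of order two, other than
`±1` and `±Z_d`, that commute with `Z_d`. -/
theorem exists_act_pX_succ {P : UnitaryN n} (h1 : 1 ≤ d) (h2 : d ≤ n) (hP : P ∈ pauliFrom n d)
    (hPP : P * P = 1) (hPZ : P * pZ n d = pZ n d * P) (hP1 : P ≠ 1) (hPn : P ≠ -1)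
    (hP2 : P ≠ pZ n d) (hPn2 : P ≠ -pZ n d) :
    d + 1 ≤ n ∧ ∃ u ∈ cliffGates n (d + 1) d, cliffAct n u (pX n (d + 1)) = P := by
  rcases anticommute_cases h1 h2 hP with ⟨-, Q, hQ, rfl | rfl⟩ | ⟨h, -⟩
  · obtain ⟨h3, u, hu, rfl⟩ := exists_act_pZ_succ h2 hQ hPP hP1 hPn
    refine ⟨h3, u * gH n (d + 1), mul_mem (gateGroup_mono le_rfl (by omega) hu)
      (h_mem_gateGroup le_rfl h3), ?_⟩
    rw [cliffAct_mul, act_gH_X]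
  · have hQQ := mul_self_of_mul_commute mul_self_pZ (commute_pZ hQ).symm hPP
    obtain ⟨h3, u, hu, rfl⟩ := exists_act_pZ_succ h2 hQ hQQ
      (by rintro rfl; exact hP2 (mul_one _)) (by rintro rfl; exact hPn2 (by rw [mul_neg, mul_one]))
    -- L_d supplies the factor Z_d, after which the remaining gates act on later qubits only and
    -- turn X_{d+1} into Q.
    refine ⟨h3, u * gH n (d + 1) * gL n d, mul_mem (mul_mem (gateGroup_mono le_rfl (by omega) hu)
      (h_mem_gateGroup le_rfl h3)) (L_mem_gateGroup le_rfl h3), ?_⟩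
    rw [cliffAct_mul, act_gL_X_succ h1 h3, cliffAct_mul, cliffAct_map_mul, act_gH_X,
      act_gH_Z_ne (by omega), cliffAct_map_mul, act_pZ_of_lt (d := d) hu (by omega)]
    exact (commute_pZ hQ).eq
  · rw [hPZ] at h
    exact absurd h.symm (unitaryN_neg_ne _)

end

/-! ### Controlled Pauli operators in an abstract family -/

theorem zpow_cases_of_four {Γ : Type*} [Group Γ] {s : Γ} (ss : s * s * s * s = 1) (k : ℤ) :
    s ^ k = 1 ∨ s ^ k = s ∨ s ^ k = s * s ∨ s ^ k = s * s * s := by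
  have h4 : s ^ (4 : ℤ) = 1 := by
    rw [← ss, zpow_ofNat, pow_succ, pow_succ, pow_two]
  rw [← Int.emod_add_mul_ediv k 4, zpow_add, zpow_mul, h4, one_zpow, mul_one]
  have h1 := Int.emod_nonneg k (by norm_num : (4 : ℤ) ≠ 0)
  have h2 := Int.emod_lt_of_pos k (by norm_num : (0 : ℤ) < 4)
  generalize k % 4 = r at h1 h2
  interval_cases r
  · exact Or.inl (zpow_zero s)
  · exact Or.inr (Or.inl (zpow_one s))
  · exact Or.inr (Or.inr (Or.inl (by rw [zpow_ofNat, pow_two])))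
  · exact Or.inr (Or.inr (Or.inr (by rw [zpow_ofNat, pow_succ, pow_two])))

/-- Solve `LhL` for h L s t h and move t out past h. The result has one h between words without h,
so it lies in the double coset of h. -/
theorem Link.hsLh {Γ : Type*} [Group Γ] {s h t L : Γ} (H : HalfLink s h t L) :
    h * s * L * h = L * s * s * s * t * t * t * h * (L * s * s * s) := by
  have ht := H.ht
  have xL := H.xL
  obtain ⟨⟨hh, ss, sh⟩, tt, LL, ts, Lt, Ls, hL, LhL⟩ := H
  clear hL
  grind (acSteps := 1000000)

/-- Both sides are the inverses of those of `hsLh`. -/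
theorem Link.hsssLh {Γ : Type*} [Group Γ] {s h t L : Γ} (H : HalfLink s h t L) :
    h * s * s * s * L * h = s * L * h * (t * s * L) := by
  have ht := H.ht
  have xL := H.xL
  obtain ⟨⟨hh, ss, sh⟩, tt, LL, ts, Lt, Ls, hL, LhL⟩ := H
  clear hL
  grind (acSteps := 1000000)

/-- A homomorphism to the projective Clifford group that sends the gates of a family to the
gates of the same name. -/
structure IsCliffordHom {Γ : Type*} [Group Γ] (lo n : ℕ) (h s L : ℕ → Γ)
    (φ : Γ →* ProjClifford n) : Prop extends CliffordFamily lo n h s L where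
  map_h : ∀ i, lo ≤ i → i ≤ n → φ (h i) = gH n i
  map_s : ∀ i, 1 ≤ i → i ≤ n → φ (s i) = gS n i
  map_L : ∀ i, 1 ≤ i → i + 1 ≤ n → φ (L i) = gL n i

theorem pZ_ne_one {n i : ℕ} (h1 : 1 ≤ i) (h2 : i ≤ n) : pZ n i ≠ 1 := by
  intro h
  have := pX_mul_pZ h1 h2
  rw [h, mul_one, one_mul] at this
  exact unitaryN_neg_ne _ this.symm

theorem pZ_ne_neg_one {n i : ℕ} (h1 : 1 ≤ i) (h2 : i ≤ n) : pZ n i ≠ -1 := by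
  intro h
  have := pX_mul_pZ h1 h2
  rw [h, mul_neg, mul_one, neg_mul, one_mul, neg_neg] at this
  exact unitaryN_neg_ne _ this

theorem pX_ne_pZ {n i : ℕ} (h1 : 1 ≤ i) (h2 : i ≤ n) : pX n i ≠ pZ n i := by
  intro h
  have := pX_mul_pZ h1 h2
  rw [h] at this
  exact unitaryN_neg_ne _ this.symm

theorem pZ_ne_pZ {n i j : ℕ} (h1 : 1 ≤ i) (h2 : i ≤ n) (hij : i ≠ j) : pZ n i ≠ pZ n j := by
  intro h
  have h3 := pX_mul_pZ h1 h2
  have h4 := (pX_comm_pZ (n := n) hij).eq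
  rw [← h, h3] at h4
  exact unitaryN_neg_ne _ h4

theorem act_xWord {n i : ℕ} (h1 : 1 ≤ i) (h2 : i ≤ n) :
    cliffAct n (gH n i * gS n i * gS n i * gH n i) (pZ n i) = -pZ n i := by
  rw [cliffAct_mul, act_gH_Z, cliffAct_mul, cliffAct_mul,
    show cliffAct n (gS n i) (pX n i) = pY n i from rfl, act_gS_Y h1 h2, cliffAct_neg, act_gH_X]

/-- First step of the path Z_i → X_i Z_{i+1} → X_{i+1} → Z_{i+1} under the Coxeter element, whose
cube is the swap. -/
theorem act_cox_Z {n i : ℕ} (h1 : 1 ≤ i) (h2 : i + 1 ≤ n) :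
    cliffAct n (gL n i * gH n i * gH n (i + 1)) (pZ n i) = pX n i * pZ n (i + 1) := by
  rw [cliffAct_mul, act_gH_Z_ne (by omega), cliffAct_mul, act_gH_Z, act_gL_X h1 h2]

theorem act_cox_XZ {n i : ℕ} (h1 : 1 ≤ i) (h2 : i + 1 ≤ n) :
    cliffAct n (gL n i * gH n i * gH n (i + 1)) (pX n i * pZ n (i + 1)) = pX n (i + 1) := by
  rw [cliffAct_mul, cliffAct_map_mul, act_gH_Z, act_gH_X_ne (by omega), cliffAct_mul,
    cliffAct_map_mul, act_gH_X, act_gH_X_ne (by omega), cliffAct_map_mul, act_gL_Z,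
    act_gL_X_succ h1 h2, (pX_comm_pZ (by omega : i + 1 ≠ i)).eq, ← mul_assoc, mul_self_pZ, one_mul]

theorem act_cox_X {n i : ℕ} :
    cliffAct n (gL n i * gH n i * gH n (i + 1)) (pX n (i + 1)) = pZ n (i + 1) := by
  rw [cliffAct_mul, act_gH_X, cliffAct_mul, act_gH_Z_ne (by omega), act_gL_Z]

theorem act_swap_Z {n i : ℕ} (h1 : 1 ≤ i) (h2 : i + 1 ≤ n) :
    cliffAct n (swapWord (gH n i) (gH n (i + 1)) (gL n i)) (pZ n i) = pZ n (i + 1) := by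
  rw [swapWord, cliffAct_mul, cliffAct_mul, act_cox_Z h1 h2, act_cox_XZ h1 h2, act_cox_X]

namespace IsCliffordHom
variable {Γ : Type*} [Group Γ] {lo n : ℕ} {h s L : ℕ → Γ} {φ : Γ →* ProjClifford n}
  (F : IsCliffordHom lo n h s L φ) {d : ℕ}
include F

theorem map_gates {a b : ℕ} (ha : lo ≤ a) (hb : 1 ≤ b) :
    (gateGroup n h s L a b).map φ = cliffGates n a b :=
  map_gateGroup φ (fun i h1 h2 => F.map_h i (ha.trans h1) h2)
    (fun i h1 h2 => F.map_s i (hb.trans h1) h2) (fun i h1 h2 => F.map_L i (hb.trans h1) h2)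

theorem map_mem {a b : ℕ} (ha : lo ≤ a) (hb : 1 ≤ b) {w : Γ} (hw : w ∈ gateGroup n h s L a b) :
    φ w ∈ cliffGates n a b := by
  rw [← F.map_gates ha hb]; exact ⟨w, hw, rfl⟩

theorem exists_lift {a b : ℕ} (ha : lo ≤ a) (hb : 1 ≤ b) {u : ProjClifford n}
    (hu : u ∈ cliffGates n a b) : ∃ w ∈ gateGroup n h s L a b, φ w = u := by
  rw [← F.map_gates ha hb] at hu; exact hu

/-- The elements of `⟨h_i, s_i, L_i : d ≤ i⟩` that fix `Z_d` lie in the subgroup generated by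
the generators other than `h_d`. -/
def FixesZ (_ : IsCliffordHom lo n h s L φ) (d : ℕ) : Prop :=
  ∀ w ∈ gateGroup n h s L d d, cliffAct n (φ w) (pZ n d) = pZ n d →
    w ∈ gateGroup n h s L (d + 1) d

/-- If l and l' move Z_{d+1} to the same operator, then l'⁻¹ l fixes Z_{d+1}. By `FixesZ` it is a
word without h_{d+1}, hence commutes with L_d. Thus the conjugate is labelled by a Pauli operator.
-/
theorem conj_eq (hd : 1 ≤ d) (hn : d + 1 ≤ n) (hF : F.FixesZ (d + 1)) {l l' : Γ}
    (hl : l ∈ gateGroup n h s L (d + 1) (d + 1)) (hl' : l' ∈ gateGroup n h s L (d + 1) (d + 1))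
    (he : cliffAct n (φ l) (pZ n (d + 1)) = cliffAct n (φ l') (pZ n (d + 1))) :
    l * L d * l⁻¹ = l' * L d * l'⁻¹ := by
  have h1 : l'⁻¹ * l ∈ gateGroup n h s L (d + 2) (d + 1) := by
    apply hF _ (mul_mem (inv_mem hl') hl)
    rw [map_mul, map_inv, cliffAct_mul, he]
    exact cliffAct_inv_eq rfl
  have h2 := (F.commute_L hd hn h1).eq
  rw [mul_inv_eq_iff_eq_mul, mul_assoc (l' * L d), ← mul_right_inj l'⁻¹, ← mul_assoc, h2]
  group

/-- The conjugates of `L_d` by gates on the later qubits. -/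
theorem conj_cases (hd : 1 ≤ d) (hn : d + 1 ≤ n) (hF : F.FixesZ (d + 1)) {l : Γ}
    (hl : l ∈ gateGroup n h s L (d + 1) (d + 1)) :
    l * L d * l⁻¹ = L d ∨ l * L d * l⁻¹ = L d * s d * s d ∨
    (∃ v ∈ gateGroup n h s L (d + 2) (d + 1),
      l * L d * l⁻¹ = v * (h (d + 1) * L d * h (d + 1)) * v⁻¹) ∨
    (d + 2 ≤ n ∧ ∃ v ∈ gateGroup n h s L (d + 2) (d + 1), ∀ y ∈ gateGroup n h s L (d + 1) (d + 1),
      cliffAct n (φ y) (pZ n (d + 1)) = pX n (d + 2) →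
      l * L d * l⁻¹ = v * (y * L d * y⁻¹) * v⁻¹) := by
  have h2 := F.le_two
  have hl1 := F.right d hd hn
  have mh : h (d + 1) ∈ gateGroup n h s L (d + 1) (d + 1) := h_mem_gateGroup le_rfl hn
  have ms : s (d + 1) ∈ gateGroup n h s L (d + 1) (d + 1) := s_mem_gateGroup le_rfl hn
  have hφ := F.map_mem (by omega) (by omega) hl
  have hQ := act_mem_from (by omega) hφ _ (pZ_mem le_rfl hn)
  have hQQ : cliffAct n (φ l) (pZ n (d + 1)) * cliffAct n (φ l) (pZ n (d + 1)) = 1 := by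
    rw [← cliffAct_map_mul, mul_self_pZ, cliffAct_map_one]
  have hsub : gateGroup n h s L (d + 2) (d + 1) ≤ gateGroup n h s L (d + 1) (d + 1) :=
    gateGroup_mono (by omega) le_rfl
  -- To identify a conjugate it suffices to find any word v y with the same image of Z_{d+1}.
  have mk : ∀ v ∈ gateGroup n h s L (d + 2) (d + 1), ∀ y ∈ gateGroup n h s L (d + 1) (d + 1),
      cliffAct n (φ (v * y)) (pZ n (d + 1)) = cliffAct n (φ l) (pZ n (d + 1)) →
      l * L d * l⁻¹ = v * (y * L d * y⁻¹) * v⁻¹ := by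
    intro v hv y hy he
    rw [F.conj_eq hd hn hF hl (mul_mem (hsub hv) hy) he.symm]
    group
  by_cases h1 : cliffAct n (φ l) (pZ n (d + 1)) = pZ n (d + 1)
  · left
    have := F.conj_eq hd hn hF hl (one_mem _) (by rw [h1, map_one, cliffAct_one])
    simpa using this
  by_cases h1n : cliffAct n (φ l) (pZ n (d + 1)) = -pZ n (d + 1)
  · right; left
    -- The label -Z_{d+1} is reached by the bit flip of qubit d+1, and `xL` evaluates that
    -- conjugate.
    rw [F.conj_eq hd hn hF hl (mul_mem (mul_mem (mul_mem mh ms) ms) mh) (by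
      rw [h1n]
      simp only [map_mul φ, F.map_h (d + 1) (by omega) hn, F.map_s (d + 1) (by omega) hn]
      exact (act_xWord (by omega) hn).symm), hl1.xL]
    group
  have hne : cliffAct n (φ l) (pZ n (d + 1)) ≠ 1 := fun h => pZ_ne_one (by omega) hn
    (cliffAct_injective (φ l) (h.trans (cliffAct_map_one _).symm))
  have hnen : cliffAct n (φ l) (pZ n (d + 1)) ≠ -1 := fun h => pZ_ne_neg_one (by omega) hn
    (cliffAct_injective (φ l) (h.trans (by rw [cliffAct_neg, cliffAct_map_one])))
  -- All other labels form two orbits of the stabilizer of Z_{d+1}: those commuting with Z_{d+1},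
  -- represented by X_{d+2}, and those anticommuting with it, represented by X_{d+1}.
  rcases anticommute_cases (by omega) hn hQ with ⟨hc, -⟩ | ⟨hc, -⟩
  · right; right; right
    obtain ⟨h3, u, hu, he⟩ := exists_act_pX_succ (by omega) hn hQ hQQ hc hne hnen h1 h1n
    obtain ⟨v, hv, rfl⟩ := F.exists_lift (by omega) (by omega) hu
    exact ⟨h3, v, hv, fun y hy hy' => mk v hv y hy (by rw [map_mul, cliffAct_mul, hy', he])⟩
  · right; right; left
    obtain ⟨u, hu, he⟩ := exists_act_pX (by omega) hn hQ hQQ hc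
    obtain ⟨v, hv, rfl⟩ := F.exists_lift (by omega) (by omega) hu
    refine ⟨v, hv, ?_⟩
    have := mk v hv (h (d + 1)) mh (by
      rw [map_mul, cliffAct_mul, F.map_h _ (by omega) hn, act_gH_Z, he])
    rwa [hl1.toOneQubit.h_inv] at this

end IsCliffordHom

namespace IsCliffordHom
variable {Γ : Type*} [Group Γ] {lo n : ℕ} {h s L : ℕ → Γ} {φ : Γ →* ProjClifford n}
  (F : IsCliffordHom lo n h s L φ) {d : ℕ}
include F

/-- A controlled Z times a controlled P is a controlled ZP up to a phase on the control. It is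
checked on orbit representatives: ±Z directly, X on the same qubit by `LC`, and X on the next qubit
by `controlled_mul`. -/
theorem L_mul_conj (hd : 1 ≤ d) (hn : d + 1 ≤ n) (hF : F.FixesZ (d + 1)) {l : Γ}
    (hl : l ∈ gateGroup n h s L (d + 1) (d + 1)) :
    ∃ k : ℤ, L d * (l * L d * l⁻¹) = s d ^ k ∨
      ∃ l' ∈ gateGroup n h s L (d + 1) (d + 1), L d * (l * L d * l⁻¹) = s d ^ k * (l' * L d * l'⁻¹) := by
  have h2 := F.le_two
  have hl1 := F.right d hd hn
  have hsub : gateGroup n h s L (d + 2) (d + 1) ≤ gateGroup n h s L (d + 1) (d + 1) :=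
    gateGroup_mono (by omega) le_rfl
  have hsub' : gateGroup n h s L (d + 2) (d + 1) ≤ gateGroup n h s L (d + 1) d :=
    gateGroup_mono (by omega) (by omega)
  rcases F.conj_cases hd hn hF hl with h1 | h1 | ⟨v, hv, h1⟩ | ⟨h3, v, hv, h1⟩
  · exact ⟨0, Or.inl (by rw [h1, hl1.LL, zpow_zero])⟩
  · refine ⟨2, Or.inl ?_⟩
    rw [h1, ← mul_assoc, ← mul_assoc, hl1.LL, one_mul, zpow_ofNat, pow_two]
  · refine ⟨1, Or.inr ⟨v * s (d + 1) * h (d + 1), mul_mem (mul_mem (hsub hv)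
      (s_mem_gateGroup le_rfl hn)) (h_mem_gateGroup le_rfl hn), ?_⟩⟩
    have e1 : L d * (v * (h (d + 1) * L d * h (d + 1)) * v⁻¹)
        = v * (L d * (h (d + 1) * L d * h (d + 1))) * v⁻¹ := by
      rw [← mul_assoc, ← mul_assoc, ← (F.commute_L hd hn hv).eq]; simp only [mul_assoc]
    rw [h1, e1, hl1.LC, mul_assoc (s d), mul_assoc (s d), ← mul_assoc v (s d),
      (F.commute_s hd (by omega) (hsub' hv)).eq, zpow_one]
    simp only [_root_.mul_inv_rev, hl1.toOneQubit.h_inv, mul_assoc]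
  -- D² is the word y chosen to send Z_{d+1} to X_{d+2}, so that `controlled_mul` applies.
  · have D2 : cliffAct n (φ (L (d + 1) * h (d + 1) * h (d + 2) * (L (d + 1) * h (d + 1) * h (d + 2))))
        (pZ n (d + 1)) = pX n (d + 2) := by
      simp only [map_mul φ, F.map_h (d + 1) (by omega) hn, F.map_h (d + 2) (by omega) h3,
        F.map_L (d + 1) (by omega) h3]
      rw [cliffAct_mul, act_cox_Z (by omega) h3, act_cox_XZ (by omega) h3]
    have mD : L (d + 1) * h (d + 1) * h (d + 2) ∈ gateGroup n h s L (d + 1) (d + 1) :=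
      mul_mem (mul_mem (L_mem_gateGroup le_rfl h3) (h_mem_gateGroup le_rfl hn))
        (h_mem_gateGroup (by omega) h3)
    have key := F.controlled_mul hd h3 rfl
    rw [h1 _ (mul_mem mD mD) D2]
    generalize L (d + 1) * h (d + 1) * h (d + 2) = D at *
    refine ⟨0, Or.inr ⟨v * (D * D * D * D), mul_mem (hsub hv) (mul_mem (mul_mem (mul_mem mD mD) mD)
      mD), ?_⟩⟩
    have e1 : L d * (v * (D * D * L d * (D * D)⁻¹) * v⁻¹)
        = v * (L d * (D * D * L d * (D * D)⁻¹)) * v⁻¹ := by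
      rw [← mul_assoc, ← mul_assoc, ← (F.commute_L hd hn hv).eq]; simp only [mul_assoc]
    rw [e1, key]
    group

omit F in
theorem _root_.zpow_mul_conj {a c l : Γ} (k : ℤ) (hc : Commute l a) :
    l * (a ^ k * c) * l⁻¹ = a ^ k * (l * c * l⁻¹) := by
  rw [← mul_assoc, (hc.zpow_right k).eq]; simp only [mul_assoc]

theorem commute_s' (hd : 1 ≤ d) (hn : d ≤ n) {l : Γ}
    (hl : l ∈ gateGroup n h s L (d + 1) (d + 1)) : Commute l (s d) :=
  F.commute_s hd hn (gateGroup_mono le_rfl (by omega) hl)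

/-- The controlled Pauli operators with control qubit `d`. -/
def controlled (hd : 1 ≤ d) (hn : d ≤ n) (hF : F.FixesZ (d + 1)) : Subgroup Γ where
  carrier := {w | ∃ k : ℤ, w = s d ^ k ∨ (d + 1 ≤ n ∧
    ∃ l ∈ gateGroup n h s L (d + 1) (d + 1), w = s d ^ k * (l * L d * l⁻¹))}
  one_mem' := ⟨0, Or.inl (zpow_zero _).symm⟩
  mul_mem' := by
    have hc : d + 1 ≤ n → ∀ l ∈ gateGroup n h s L (d + 1) (d + 1), ∀ k : ℤ,
        Commute (l * L d * l⁻¹) (s d ^ k) := by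
      intro h1 l hl k
      refine Commute.zpow_right ?_ k
      exact ((F.commute_s' hd hn hl).mul_left (F.Ls d d hd h1 hd hn)).mul_left
        (F.commute_s' hd hn hl).inv_left
    rintro v w ⟨k, rfl | ⟨h1, l, hl, rfl⟩⟩ ⟨k', rfl | ⟨h1', l', hl', rfl⟩⟩
    · exact ⟨k + k', Or.inl (zpow_add _ _ _).symm⟩
    · exact ⟨k + k', Or.inr ⟨h1', l', hl', by simp only [zpow_add, mul_assoc]⟩⟩
    · exact ⟨k + k', Or.inr ⟨h1, l, hl, by
        rw [mul_assoc, (hc h1 l hl k').eq, zpow_add, ← mul_assoc]⟩⟩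
    -- Conjugating by l⁻¹ turns the first controlled operator into L_d, which reduces the product to
    -- `L_mul_conj`.
    · have e : s d ^ k * (l * L d * l⁻¹) * (s d ^ k' * (l' * L d * l'⁻¹))
          = s d ^ (k + k') * (l * (L d * ((l⁻¹ * l') * L d * (l⁻¹ * l')⁻¹)) * l⁻¹) := by
        rw [(hc h1 l hl k').mul_mul_mul_comm, zpow_add]
        group
      rw [e]
      obtain ⟨r, hr | ⟨m, hm, hr⟩⟩ := F.L_mul_conj hd h1 hF (mul_mem (inv_mem hl) hl')
      · refine ⟨k + k' + r, Or.inl ?_⟩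
        rw [hr, ← mul_one (s d ^ r), zpow_mul_conj r (F.commute_s' hd hn hl), zpow_add (s d) (k + k')]
        simp
      · refine ⟨k + k' + r, Or.inr ⟨h1, l * m, mul_mem hl hm, ?_⟩⟩
        rw [hr, zpow_mul_conj r (F.commute_s' hd hn hl), zpow_add (s d) (k + k')]
        simp only [mul_assoc, _root_.mul_inv_rev]
  inv_mem' := by
    rintro w ⟨k, rfl | ⟨h1, l, hl, rfl⟩⟩
    · exact ⟨-k, Or.inl (zpow_neg _ _).symm⟩
    · refine ⟨-k, Or.inr ⟨h1, l, hl, ?_⟩⟩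
      have e : (l * L d * l⁻¹)⁻¹ = l * L d * l⁻¹ := by
        rw [_root_.mul_inv_rev, _root_.mul_inv_rev, inv_inv, (F.right d hd h1).L_inv, mul_assoc]
      have hc : Commute (l * L d * l⁻¹) (s d ^ (-k)) := by
        refine Commute.zpow_right ?_ _
        exact ((F.commute_s' hd hn hl).mul_left (F.Ls d d hd h1 hd hn)).mul_left
          (F.commute_s' hd hn hl).inv_left
      rw [_root_.mul_inv_rev, e, ← zpow_neg, hc.eq]

theorem conj_mem_controlled (hd : 1 ≤ d) (hn : d ≤ n) (hF : F.FixesZ (d + 1)) {l w : Γ}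
    (hl : l ∈ gateGroup n h s L (d + 1) (d + 1)) (hw : w ∈ F.controlled hd hn hF) :
    l * w * l⁻¹ ∈ F.controlled hd hn hF := by
  obtain ⟨k, rfl | ⟨h1, m, hm, rfl⟩⟩ := hw
  · refine ⟨k, Or.inl ?_⟩
    rw [((F.commute_s' hd hn hl).zpow_right k).eq, mul_inv_cancel_right]
  · refine ⟨k, Or.inr ⟨h1, l * m, mul_mem hl hm, ?_⟩⟩
    rw [zpow_mul_conj k (F.commute_s' hd hn hl)]
    simp only [mul_assoc, _root_.mul_inv_rev]

/-- Every element of the subgroup generated by the gates on the qubits from `d` on, other than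
`h d`, is a controlled Pauli operator times an element acting on the later qubits. -/
theorem exists_controlled_mul (hd : 1 ≤ d) (hn : d ≤ n) (hF : F.FixesZ (d + 1)) {w : Γ}
    (hw : w ∈ gateGroup n h s L (d + 1) d) :
    ∃ v ∈ F.controlled hd hn hF, ∃ l ∈ gateGroup n h s L (d + 1) (d + 1), w = v * l := by
  have hle : gateGroup n h s L (d + 1) (d + 1) ≤
      Subgroup.normalizer (F.controlled hd hn hF : Set Γ) := by
    intro l hl
    rw [Subgroup.mem_normalizer_iff]
    refine fun w => ⟨F.conj_mem_controlled hd hn hF hl, fun h => ?_⟩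
    have := F.conj_mem_controlled hd hn hF (inv_mem hl) h
    simpa [mul_assoc] using this
  -- Since the later gates normalize the controlled operators, the join of the two subgroups is
  -- their product set, and it contains every generator.
  have key : gateGroup n h s L (d + 1) d ≤
      F.controlled hd hn hF ⊔ gateGroup n h s L (d + 1) (d + 1) := by
    refine gateGroup_le (fun i h1 h2 => ?_) (fun i h1 h2 => ?_) (fun i h1 h2 => ?_)
    · exact Subgroup.mem_sup_right (h_mem_gateGroup h1 h2)
    · rcases h1.eq_or_lt with rfl | h1
      · exact Subgroup.mem_sup_left ⟨1, Or.inl (zpow_one _).symm⟩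
      · exact Subgroup.mem_sup_right (s_mem_gateGroup h1 h2)
    · rcases h1.eq_or_lt with rfl | h1
      · exact Subgroup.mem_sup_left ⟨0, Or.inr ⟨h2, 1, one_mem _, by simp⟩⟩
      · exact Subgroup.mem_sup_right (L_mem_gateGroup h1 h2)
  have := key hw
  rw [← SetLike.mem_coe, Subgroup.coe_mul_of_right_le_normalizer_left _ _ hle] at this
  obtain ⟨v, hv, l, hl, rfl⟩ := this
  exact ⟨v, hv, l, hl, rfl⟩

end IsCliffordHom

/-! ### Double cosets of the stabilizer of Z_d, and injectivity -/

/-- The elements w with w b in b S form the subgroup b S b⁻¹, so generators are enough. -/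
theorem exists_mul_eq_mul {Γ : Type*} [Group Γ] {n a d : ℕ} {h s L : ℕ → Γ} {b w : Γ}
    {S : Subgroup Γ} (hS : ∀ i, a ≤ i → i ≤ n → ∃ k ∈ S, h i * b = b * k)
    (sS : ∀ i, d ≤ i → i ≤ n → ∃ k ∈ S, s i * b = b * k)
    (LS : ∀ i, d ≤ i → i + 1 ≤ n → ∃ k ∈ S, L i * b = b * k)
    (hw : w ∈ gateGroup n h s L a d) : ∃ k ∈ S, w * b = b * k := by
  have aux : ∀ u, (∃ k ∈ S, u * b = b * k) → u ∈ S.comap (MulAut.conj b⁻¹).toMonoidHom := by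
    rintro u ⟨k, hk, he⟩
    change b⁻¹ * u * b⁻¹⁻¹ ∈ S
    rwa [inv_inv, mul_assoc, he, inv_mul_cancel_left]
  have := gateGroup_le (fun i h1 h2 => aux _ (hS i h1 h2)) (fun i h1 h2 => aux _ (sS i h1 h2))
    (fun i h1 h2 => aux _ (LS i h1 h2)) hw
  change b⁻¹ * w * b⁻¹⁻¹ ∈ S at this
  rw [inv_inv] at this
  exact ⟨_, this, by group⟩

namespace IsCliffordHom
variable {Γ : Type*} [Group Γ] {lo n : ℕ} {h s L : ℕ → Γ} {φ : Γ →* ProjClifford n}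
  (F : IsCliffordHom lo n h s L φ) {d : ℕ}
include F

theorem act_Z_eq (hd : 1 ≤ d) {w : Γ} (hw : w ∈ gateGroup n h s L (d + 1) d) :
    cliffAct n (φ w) (pZ n d) = pZ n d := by
  have h2 := F.le_two
  have : gateGroup n h s L (d + 1) d ≤ (fixer (pZ n d)).comap φ := by
    refine gateGroup_le (fun i h1 h2 => ?_) (fun i h1 h2 => ?_) (fun i h1 h2 => ?_) <;>
      rw [Subgroup.mem_comap, mem_fixer]
    · rw [F.map_h i (by omega) h2, act_gH_Z_ne (by omega)]
    · rw [F.map_s i (by omega) h2, act_gS_Z]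
    · rw [F.map_L i (by omega) h2, act_gL_Z]
  exact mem_fixer.1 (this hw)

/-- Write w = v l with v controlled and l on the later qubits. As l fixes X_d, so does v. The powers
of s_d send X_d to ±X_d or ±Y_d, and a genuine controlled operator changes X_d on later qubits, so v
= 1 and l is covered by `hI`. -/
theorem eq_one_of_map_eq_one (hd : 1 ≤ d) (hn : d ≤ n) (h4 : s d * s d * s d * s d = 1)
    (hF : F.FixesZ (d + 1))
    (hI : ∀ w ∈ gateGroup n h s L (d + 1) (d + 1), φ w = 1 → w = 1) {w : Γ}
    (hw : w ∈ gateGroup n h s L (d + 1) d) (h1 : φ w = 1) : w = 1 := by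
  have h2 := F.le_two
  obtain ⟨v, hv, l, hl, rfl⟩ := F.exists_controlled_mul hd hn hF hw
  have hX : cliffAct n (φ v) (pX n d) = pX n d := by
    have h3 := congrArg (fun u => cliffAct n u (pX n d)) h1
    simp only [map_mul φ, cliffAct_one] at h3
    rwa [cliffAct_mul, act_pX_of_lt (F.map_mem (by omega) (by omega) hl) (by omega) (by omega)]
      at h3
  have hne := unitaryN_neg_ne (pX n d)
  have hv1 : v = 1 := by
    obtain ⟨k, rfl | ⟨h3, m, hm, rfl⟩⟩ := hv
    · have e1 : cliffAct n (gS n d) (pX n d) = pY n d := rfl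
      have e2 := act_gS_Y hd hn
      have hs := F.map_s d hd hn
      rcases zpow_cases_of_four h4 k with hk | hk | hk | hk
      · exact hk
      · exfalso
        rw [hk, hs, e1] at hX
        rw [hX, e1, hX] at e2
        exact hne e2.symm
      · exfalso
        rw [hk, map_mul φ, hs, cliffAct_mul, e1, e2] at hX
        exact hne hX
      · exfalso
        rw [hk, map_mul φ, map_mul φ, hs, cliffAct_mul, cliffAct_mul, e1, e2, cliffAct_neg,
          e1] at hX
        have e3 : pY n d = -pX n d := by rw [← hX, neg_neg]
        rw [e3, cliffAct_neg, e1, e3, neg_neg] at e2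
        exact hne e2.symm
    · exfalso
      have hs := F.map_s d hd hn
      have e0 := act_pX_of_lt (F.map_mem (by omega) (by omega) hm) (d := d) (by omega) (by omega)
      -- Conjugation by m, which fixes X_d, replaces the controlled operator by s_d^k L_d.
      have e1 : cliffAct n (φ (m⁻¹ * (s d ^ k * (m * L d * m⁻¹)) * m)) (pX n d) = pX n d := by
        rw [map_mul φ, map_mul φ, map_inv, cliffAct_mul, cliffAct_mul, e0, hX]
        exact cliffAct_inv_eq e0
      rw [show m⁻¹ * (s d ^ k * (m * L d * m⁻¹)) * m = s d ^ k * L d by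
        rw [← mul_assoc, ((F.commute_s' hd hn hm).inv_left.zpow_right k).eq]; group,
        map_mul φ, cliffAct_mul, F.map_L d hd h3, act_gL_X hd h3, cliffAct_map_mul] at e1
      have eZ : cliffAct n (φ (s d ^ k)) (pZ n (d + 1)) = pZ n (d + 1) := by
        have : s d ∈ (fixer (pZ n (d + 1))).comap φ := by
          rw [Subgroup.mem_comap, mem_fixer, hs, act_gS_Z]
        exact mem_fixer.1 (zpow_mem this k)
      have eX : cliffAct n (φ (s d ^ k)) (pX n (d + 1)) = pX n (d + 1) := by
        have : s d ∈ (fixer (pX n (d + 1))).comap φ := by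
          rw [Subgroup.mem_comap, mem_fixer, hs, act_gS_X_ne (by omega)]
        exact mem_fixer.1 (zpow_mem this k)
      have c1 : Commute (cliffAct n (φ (s d ^ k)) (pX n d)) (pX n (d + 1)) := by
        have := congrArg (cliffAct n (φ (s d ^ k))) (pX_comm_pX (n := n) (i := d) (j := d + 1)).eq
        rwa [cliffAct_map_mul, cliffAct_map_mul, eX] at this
      rw [eZ] at e1
      have c2 : Commute (pX n d) (pX n (d + 1)) := pX_comm_pX
      rw [← e1] at c2
      have c3 := pX_mul_pZ (n := n) (i := d + 1) (by omega) h3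
      generalize cliffAct n (φ (s d ^ k)) (pX n d) = A at *
      -- With A the image of X_d under s_d^k, the assumption says A Z_{d+1} = X_d. Both A and X_d
      -- commute with X_{d+1}, so Z_{d+1} would too.
      have c4 : Commute (pZ n (d + 1)) (pX n (d + 1)) := by
        have := (c1.inv_left.mul_left c2)
        rwa [inv_mul_cancel_left] at this
      rw [c4.eq] at c3
      exact unitaryN_neg_ne _ c3.symm
  subst hv1
  rw [one_mul] at h1 ⊢
  exact hI _ hl h1

/-- The bit flip of qubit d commutes with later gates, inverts s_d, and sends L_d to L_d s_{d+1}²;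
hence the cell of the flip is a single coset. -/
theorem xWord_normalizes (hd : lo ≤ d) (hn : d ≤ n) {k : Γ} (hk : k ∈ gateGroup n h s L (d + 1) d) :
    ∃ k' ∈ gateGroup n h s L (d + 1) d,
      k * (h d * s d * s d * h d) = h d * s d * s d * h d * k' := by
  have h0 := F.one_le
  have h1 := F.one d hd hn
  have ms : s d ∈ gateGroup n h s L (d + 1) d := s_mem_gateGroup le_rfl hn
  have far : ∀ w, w ∈ gateGroup n h s L (d + 1) (d + 1) → w ∈ gateGroup n h s L (d + 1) d →
      ∃ k' ∈ gateGroup n h s L (d + 1) d,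
        w * (h d * s d * s d * h d) = h d * s d * s d * h d * k' := by
    intro w hw hw'
    have c1 := F.commute_s' (by omega) hn hw
    have c2 := F.commute_h hd hn hw
    exact ⟨w, hw', (((c2.mul_right c1).mul_right c1).mul_right c2).eq⟩
  refine exists_mul_eq_mul (fun i i1 i2 => ?_) (fun i i1 i2 => ?_) (fun i i1 i2 => ?_) hk
  · exact far _ (h_mem_gateGroup i1 i2) (h_mem_gateGroup i1 i2)
  · rcases i1.eq_or_lt with rfl | i1
    · refine ⟨s d * s d * s d, mul_mem (mul_mem ms ms) ms, ?_⟩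
      have e := h1.xsx
      have hh := h1.hh
      have ss := h1.ss
      clear far ms
      generalize h d = p, s d = q at *
      grind (acSteps := 1000000)
    · exact far _ (s_mem_gateGroup i1 i2) (s_mem_gateGroup i1.le i2)
  · rcases i1.eq_or_lt with rfl | i1
    · have hl := F.left d hd i2
      have mt : s (d + 1) ∈ gateGroup n h s L (d + 1) d := s_mem_gateGroup (by omega) i2
      refine ⟨L d * s (d + 1) * s (d + 1), mul_mem (mul_mem (L_mem_gateGroup le_rfl i2) mt) mt, ?_⟩
      have e := hl.xL
      have ct : Commute (s (d + 1) * s (d + 1)) (h d * s d * s d * h d) := by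
        have c1 : Commute (s (d + 1)) (h d) := hl.ht.symm
        have c2 : Commute (s (d + 1)) (s d) := hl.ts
        have c3 := ((c1.mul_right c2).mul_right c2).mul_right c1
        exact c3.mul_left c3
      calc _ = L d * (s (d + 1) * s (d + 1) * s (d + 1) * s (d + 1)) * (h d * s d * s d * h d) := by
            rw [hl.tt, mul_one]
        _ = L d * s (d + 1) * s (d + 1) * (s (d + 1) * s (d + 1) * (h d * s d * s d * h d)) := by
            simp only [mul_assoc]
        _ = _ := by rw [ct.eq, ← mul_assoc _ (h d * s d * s d * h d), ← e]; simp only [mul_assoc]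
    · exact far _ (L_mem_gateGroup i1 i2) (L_mem_gateGroup i1.le i2)

/-- Across the swap s_{d+1} becomes s_d, L_{d+1} becomes a word without h_d by `swap_braid`, and all
other allowed gates commute with it. -/
theorem mul_swap (hd : lo ≤ d) (hn : d + 1 ≤ n) {v : Γ}
    (hv : v ∈ gateGroup n h s L (d + 2) (d + 1)) :
    ∃ k ∈ gateGroup n h s L (d + 1) d,
      v * swapWord (h d) (h (d + 1)) (L d) = swapWord (h d) (h (d + 1)) (L d) * k := by
  have h0 := F.one_le
  have lk := F.link hd hn
  have far : ∀ w, Commute w (h d) → Commute w (h (d + 1)) → Commute w (L d) →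
      w ∈ gateGroup n h s L (d + 1) d → ∃ k ∈ gateGroup n h s L (d + 1) d,
      w * swapWord (h d) (h (d + 1)) (L d) = swapWord (h d) (h (d + 1)) (L d) * k := by
    intro w c1 c2 c3 hw
    have c4 := (c3.mul_right c1).mul_right c2
    exact ⟨w, hw, ((c4.mul_right c4).mul_right c4).eq⟩
  refine exists_mul_eq_mul (fun i i1 i2 => ?_) (fun i i1 i2 => ?_) (fun i i1 i2 => ?_) hv
  · exact far _ (F.hh _ _ (by omega) i2 (by omega) (by omega))
      (F.hh _ _ (by omega) i2 (by omega) (by omega))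
      (F.Lh _ _ (by omega) hn (by omega) i2 (by omega) (by omega)).symm
      (h_mem_gateGroup (by omega) i2)
  · rcases i1.eq_or_lt with rfl | i1
    · exact ⟨s d, s_mem_gateGroup le_rfl (by omega), lk.swap_s.symm⟩
    · exact far _ (F.hs hd (by omega) (by omega) i2 (by omega)).symm
        (F.hs (by omega) hn (by omega) i2 (by omega)).symm
        (F.Ls _ _ (by omega) hn (by omega) i2).symm (s_mem_gateGroup (by omega) i2)
  · rcases i1.eq_or_lt with rfl | i1
    · have mL : L (d + 1) ∈ gateGroup n h s L (d + 1) d := L_mem_gateGroup (by omega) i2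
      have mD : L (d + 1) * h (d + 1) * h (d + 2) ∈ gateGroup n h s L (d + 1) d :=
        mul_mem (mul_mem mL (h_mem_gateGroup le_rfl (by omega))) (h_mem_gateGroup (by omega) i2)
      have ma : swapWord (h (d + 1)) (h (d + 2)) (L (d + 1)) ∈ gateGroup n h s L (d + 1) d :=
        mul_mem (mul_mem mD mD) mD
      refine ⟨_, mul_mem (mul_mem ma (L_mem_gateGroup le_rfl (by omega))) ma, ?_⟩
      rw [← F.swap_braid hd i2, ← mul_assoc, ← mul_assoc, lk.swap_swap, one_mul]
    · exact far _ (F.Lh _ _ (by omega) i2 (by omega) (by omega) (by omega) (by omega))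
        (F.Lh _ _ (by omega) i2 (by omega) (by omega) (by omega) (by omega))
        (F.LL _ _ (by omega) i2 (by omega) hn) (L_mem_gateGroup (by omega) i2)

end IsCliffordHom

namespace IsCliffordHom
variable {Γ : Type*} [Group Γ] {lo n : ℕ} {h s L : ℕ → Γ} {φ : Γ →* ProjClifford n}
  (F : IsCliffordHom lo n h s L φ) {d : ℕ}
include F

/-- The double coset of the swap of the qubits `d` and `d + 1`. -/
theorem mul_swapWord_cases (hd : lo ≤ d) (hn : d + 1 ≤ n) (hF : F.FixesZ (d + 1)) {w : Γ}
    (hw : w ∈ gateGroup n h s L (d + 1) d) :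
    ∃ l ∈ gateGroup n h s L (d + 1) (d + 1), ∃ k ∈ gateGroup n h s L (d + 1) d,
      w * swapWord (h d) (h (d + 1)) (L d) = l * swapWord (h d) (h (d + 1)) (L d) * k ∨
      w * swapWord (h d) (h (d + 1)) (L d)
        = l * (h (d + 1) * L d * h (d + 1) * swapWord (h d) (h (d + 1)) (L d)) * k := by
  have h0 := F.one_le
  have lk := F.link hd hn
  have hsub : gateGroup n h s L (d + 2) (d + 1) ≤ gateGroup n h s L (d + 1) (d + 1) :=
    gateGroup_mono (by omega) le_rfl
  have mL : L d ∈ gateGroup n h s L (d + 1) d := L_mem_gateGroup le_rfl hn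
  have mt : s (d + 1) ∈ gateGroup n h s L (d + 1) d := s_mem_gateGroup (by omega) hn
  set a := swapWord (h d) (h (d + 1)) (L d) with ha
  have aL : L d * a = a * L d := lk.swap_L.symm
  have as : ∀ r : ℤ, s d ^ r * a = a * s (d + 1) ^ r := by
    intro r
    have : SemiconjBy a (s (d + 1)) (s d) := lk.swap_t
    exact (this.zpow_right r).eq.symm
  -- The factorization is applied to w⁻¹ so that in w the factor on later qubits comes first and can
  -- be discarded.
  obtain ⟨v, hv, l₀, hl₀, e⟩ := F.exists_controlled_mul (by omega) (by omega) hF (inv_mem hw)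
  obtain ⟨l, hl, rfl⟩ : ∃ l ∈ gateGroup n h s L (d + 1) (d + 1), w = l * v⁻¹ :=
    ⟨l₀⁻¹, inv_mem hl₀, by rw [← inv_inv w, e, _root_.mul_inv_rev]⟩
  have hv := inv_mem hv
  generalize v⁻¹ = v at hv
  clear e
  suffices H : ∃ l ∈ gateGroup n h s L (d + 1) (d + 1), ∃ k ∈ gateGroup n h s L (d + 1) d,
      v * a = l * a * k ∨ v * a = l * (h (d + 1) * L d * h (d + 1) * a) * k by
    obtain ⟨m, hm, k, hk, e | e⟩ := H
    · exact ⟨l * m, mul_mem hl hm, k, hk, Or.inl (by rw [mul_assoc, e]; simp only [mul_assoc])⟩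
    · exact ⟨l * m, mul_mem hl hm, k, hk, Or.inr (by rw [mul_assoc, e]; simp only [mul_assoc])⟩
  obtain ⟨r, rfl | ⟨-, m, hm, rfl⟩⟩ := hv
  · exact ⟨1, one_mem _, _, zpow_mem mt r, Or.inl (by rw [as, one_mul])⟩
  rcases F.conj_cases (by omega) hn hF hm with e | e | ⟨v, hv, e⟩ | ⟨h3, v, hv, e⟩
  · refine ⟨1, one_mem _, _, mul_mem (zpow_mem mt r) mL, Or.inl ?_⟩
    rw [e, mul_assoc, aL, ← mul_assoc, as, one_mul, mul_assoc]
  · refine ⟨1, one_mem _, _, mul_mem (zpow_mem mt r) (mul_mem (mul_mem mL mt) mt), Or.inl ?_⟩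
    have e1 : s d * a = a * s (d + 1) := lk.swap_t.symm
    rw [e]
    simp only [mul_assoc, one_mul, e1, mul_eq_assoc e1, mul_eq_assoc aL, mul_eq_assoc (as r)]
  -- For a label anticommuting with Z_{d+1} the controlled NOT cannot be moved across the swap; this
  -- is the second alternative.
  · obtain ⟨k, hk, ek⟩ := F.mul_swap hd hn (inv_mem hv)
    refine ⟨v, hsub hv, _, mul_mem (zpow_mem mt r) hk, Or.inr ?_⟩
    have c1 : Commute (v * (h (d + 1) * L d * h (d + 1))) (s d ^ r) := by
      have c2 : Commute (h (d + 1)) (s d) := lk.kt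
      exact ((F.commute_s' (by omega) (by omega) (hsub hv)).mul_left
        ((c2.mul_left (F.Ls _ _ (by omega) hn (by omega) (by omega))).mul_left c2)).zpow_right r
    rw [e, ← mul_assoc, ← c1.eq, mul_assoc, ek, mul_assoc _ _ (a * k), ← mul_assoc _ a, as]
    simp only [mul_assoc]
  · obtain ⟨k, hk, ek⟩ := F.mul_swap hd hn (inv_mem hv)
    rw [← ha] at ek
    have lk' := F.link (by omega : lo ≤ d + 1) (by omega : d + 1 + 1 ≤ n)
    have mh : h (d + 2) ∈ gateGroup n h s L (d + 1) (d + 1) := h_mem_gateGroup (by omega) h3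
    have mh' : h (d + 2) ∈ gateGroup n h s L (d + 1) d := h_mem_gateGroup (by omega) h3
    have mL' : L (d + 1) ∈ gateGroup n h s L (d + 1) d := L_mem_gateGroup (by omega) h3
    have mD : L (d + 1) * h (d + 1) * h (d + 2) ∈ gateGroup n h s L (d + 1) (d + 1) :=
      mul_mem (mul_mem (L_mem_gateGroup le_rfl h3) (h_mem_gateGroup le_rfl (by omega))) mh
    have hb := F.swap_braid hd h3
    rw [← ha] at hb
    have bb := lk'.swap_swap
    have b_inv := lk'.swap_inv
    -- Here the word sending Z_{d+1} to X_{d+2} is taken to be the swap b followed by h_{d+2},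
    -- because b L_d b crosses the first swap by `swap_braid`.
    have eb := e (h (d + 2) * swapWord (h (d + 1)) (h (d + 2)) (L (d + 1)))
      (mul_mem mh (mul_mem (mul_mem mD mD) mD)) (by
        rw [map_mul φ, cliffAct_mul]
        simp only [swapWord, map_mul φ]
        rw [F.map_h _ (by omega) h3, F.map_h _ (by omega) (by omega), F.map_L _ (by omega) h3]
        have := act_swap_Z (n := n) (i := d + 1) (by omega) h3
        rw [swapWord] at this
        rw [this, act_gH_Z])
    set b := swapWord (h (d + 1)) (h (d + 2)) (L (d + 1)) with hbdef
    refine ⟨v * h (d + 2), mul_mem (hsub hv) mh, _, mul_mem (zpow_mem mt r) (mul_mem mL'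
      (mul_mem mh' hk)), Or.inl ?_⟩
    have hinv := (F.one (d + 2) (by omega) h3).h_inv
    have c1 : Commute (v * h (d + 2)) (s d ^ r) :=
      ((F.commute_s' (by omega) (by omega) (hsub hv)).mul_left
        (F.commute_s' (by omega) (by omega) mh)).zpow_right r
    have c2 : Commute (h (d + 2)) a := by
      have c3 : Commute (h (d + 2)) (L d * h d * h (d + 1)) :=
        ((F.Lh _ _ (by omega) hn (by omega) h3 (by omega) (by omega)).symm.mul_right
          (F.hh _ _ (by omega) h3 hd (by omega))).mul_right
          (F.hh _ _ (by omega) h3 (by omega) hn)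
      exact (c3.mul_right c3).mul_right c3
    have e2 : b * L d * b * a = a * L (d + 1) := by
      rw [← hb, mul_assoc, lk.swap_swap, mul_one]
    calc _ = s d ^ r * (v * h (d + 2)) * (b * L d * b) * h (d + 2) * (v⁻¹ * a) := by
          rw [eb, _root_.mul_inv_rev, hinv, b_inv]; simp only [mul_assoc]
      _ = v * h (d + 2) * s d ^ r * (b * L d * b) * (h (d + 2) * a) * k := by
          rw [c1.eq, ek]; simp only [mul_assoc]
      _ = v * h (d + 2) * s d ^ r * (b * L d * b * a) * h (d + 2) * k := by
          rw [c2.eq]; simp only [mul_assoc]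
      _ = v * h (d + 2) * (s d ^ r * a) * L (d + 1) * h (d + 2) * k := by
          rw [e2]; simp only [mul_assoc]
      _ = _ := by rw [as]; simp only [mul_assoc]

/-- The double coset decomposition of the subgroup generated by the gates on the qubits from `d`
on with respect to the subgroup without `h d`. -/
def InCells (_ : IsCliffordHom lo n h s L φ) (d : ℕ) (w : Γ) : Prop :=
  ∃ k ∈ gateGroup n h s L (d + 1) d, w = k ∨ w = h d * s d * s d * h d * k ∨
    ∃ l ∈ gateGroup n h s L (d + 1) d, w = l * h d * k ∨
      (d + 1 ≤ n ∧ w = l * swapWord (h d) (h (d + 1)) (L d) * k)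

theorem inCells_mul {w k : Γ} (hk : k ∈ gateGroup n h s L (d + 1) d) (hw : F.InCells d w) :
    F.InCells d (w * k) := by
  obtain ⟨m, hm, rfl | rfl | ⟨l, hl, rfl | ⟨h1, rfl⟩⟩⟩ := hw
  · exact ⟨_, mul_mem hm hk, Or.inl rfl⟩
  · exact ⟨_, mul_mem hm hk, Or.inr (Or.inl (mul_assoc _ _ _))⟩
  · exact ⟨_, mul_mem hm hk, Or.inr (Or.inr ⟨l, hl, Or.inl (mul_assoc _ _ _)⟩)⟩
  · exact ⟨_, mul_mem hm hk, Or.inr (Or.inr ⟨l, hl, Or.inr ⟨h1, mul_assoc _ _ _⟩⟩)⟩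

theorem mul_inCells (hd : lo ≤ d) (hn : d ≤ n) {w k : Γ} (hk : k ∈ gateGroup n h s L (d + 1) d)
    (hw : F.InCells d w) : F.InCells d (k * w) := by
  obtain ⟨m, hm, rfl | rfl | ⟨l, hl, rfl | ⟨h1, rfl⟩⟩⟩ := hw
  · exact ⟨_, mul_mem hk hm, Or.inl rfl⟩
  · obtain ⟨k', hk', e⟩ := F.xWord_normalizes hd hn hk
    exact ⟨_, mul_mem hk' hm, Or.inr (Or.inl (by rw [← mul_assoc, e, mul_assoc]))⟩
  · exact ⟨m, hm, Or.inr (Or.inr ⟨_, mul_mem hk hl, Or.inl (by simp only [mul_assoc])⟩)⟩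
  · exact ⟨m, hm, Or.inr (Or.inr ⟨_, mul_mem hk hl, Or.inr ⟨h1, by simp only [mul_assoc]⟩⟩)⟩

/-- Even powers give 1 and the bit flip. Odd powers stay in the double coset of h_d because h s h =
s³ h s³. -/
theorem h_mul_pow_mul_h (hd : lo ≤ d) (hn : d ≤ n) (r : ℤ) : F.InCells d (h d * s d ^ r * h d) := by
  have ms : s d ∈ gateGroup n h s L (d + 1) d := s_mem_gateGroup le_rfl hn
  have o := F.one d hd hn
  rcases zpow_cases_of_four o.ss r with e | e | e | e <;> rw [e]
  · exact ⟨1, one_mem _, Or.inl (by rw [mul_one, o.hh])⟩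
  · refine ⟨_, mul_mem (mul_mem ms ms) ms, Or.inr (Or.inr ⟨_, mul_mem (mul_mem ms ms) ms,
      Or.inl ?_⟩)⟩
    rw [o.hsh]; simp only [mul_assoc]
  · exact ⟨1, one_mem _, Or.inr (Or.inl (by simp only [mul_assoc, mul_one]))⟩
  · refine ⟨_, ms, Or.inr (Or.inr ⟨_, ms, Or.inl ?_⟩)⟩
    have hh := o.hh
    have ss := o.ss
    have hsh := o.hsh
    clear ms e
    grind (acSteps := 1000000)

/-- For r = 0 this is a controlled NOT, placed in the swap cell by `hLh_eq`. For odd r the product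
reduces to a word with a single h_d. -/
theorem h_mul_pow_mul_L_mul_h (hd : lo ≤ d) (hn : d + 1 ≤ n) (r : ℤ) :
    F.InCells d (h d * (s d ^ r * L d) * h d) := by
  have ms : s d ∈ gateGroup n h s L (d + 1) d := s_mem_gateGroup le_rfl (by omega)
  have mt : s (d + 1) ∈ gateGroup n h s L (d + 1) d := s_mem_gateGroup (by omega) hn
  have mk : h (d + 1) ∈ gateGroup n h s L (d + 1) d := h_mem_gateGroup le_rfl hn
  have mL : L d ∈ gateGroup n h s L (d + 1) d := L_mem_gateGroup le_rfl hn
  have mkLk := mul_mem (mul_mem mk mL) mk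
  have lk := F.link hd hn
  have o := lk.left.toOneQubit
  have cell0 : F.InCells d (h d * L d * h d) :=
    ⟨_, mkLk, Or.inr (Or.inr ⟨_, mkLk, Or.inr ⟨hn, lk.hLh_eq⟩⟩)⟩
  rcases zpow_cases_of_four o.ss r with e | e | e | e <;> rw [e]
  · rwa [one_mul]
  · have := Link.hsLh lk.left
    rw [← mul_assoc, this]
    exact ⟨_, mul_mem (mul_mem (mul_mem mL ms) ms) ms, Or.inr (Or.inr ⟨_, mul_mem (mul_mem (mul_mem
      (mul_mem (mul_mem (mul_mem mL ms) ms) ms) mt) mt) mt, Or.inl rfl⟩)⟩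
  -- The square s_d² between Hadamards contributes a bit flip x, and x crosses the swap to become
  -- the flip of qubit d+1.
  · have e1 : h d * (s d * s d * L d) * h d = h d * s d * s d * h d * (h d * L d * h d) := by
      simp only [mul_assoc, mul_eq_assoc o.hh, one_mul]
    rw [e1, lk.hLh_eq]
    obtain ⟨m, hm, em⟩ := F.xWord_normalizes hd (by omega) mkLk
    generalize h (d + 1) * L d * h (d + 1) = y at mkLk em ⊢
    have xx : h d * s d * s d * h d * (h d * s d * s d * h d) = 1 := by
      rw [← o.hh]
      simp only [mul_assoc, mul_eq_assoc o.hh, one_mul]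
      rw [← mul_assoc, ← mul_assoc, ← mul_assoc, ← mul_assoc, mul_assoc (h d), mul_assoc (h d),
        mul_assoc (h d), o.ss, mul_one]
    have xa : h d * s d * s d * h d * swapWord (h d) (h (d + 1)) (L d)
        = swapWord (h d) (h (d + 1)) (L d)
          * (h (d + 1) * s (d + 1) * s (d + 1) * h (d + 1)) := by
      have c1 : SemiconjBy (swapWord (h d) (h (d + 1)) (L d)) (h (d + 1)) (h d) := lk.swap_k
      have c2 : SemiconjBy (swapWord (h d) (h (d + 1)) (L d)) (s (d + 1)) (s d) := lk.swap_t
      exact (((c1.mul_right c2).mul_right c2).mul_right c1).eq.symm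
    refine ⟨_, mul_mem (mul_mem (mul_mem (mul_mem mk mt) mt) mk) mkLk,
      Or.inr (Or.inr ⟨_, hm, Or.inr ⟨hn, ?_⟩⟩)⟩
    generalize h d * s d * s d * h d = x at *
    have e2 : x * y = m * x := by
      rw [← mul_one (x * y), ← xx, ← mul_assoc, mul_assoc x y, em, ← mul_assoc, xx, one_mul]
    rw [← mul_assoc, ← mul_assoc, e2, mul_assoc m, xa]
    simp only [mul_assoc]
  · have := Link.hsssLh lk.left
    rw [← mul_assoc, ← mul_assoc, ← mul_assoc, this]
    exact ⟨_, mul_mem (mul_mem mt ms) mL, Or.inr (Or.inr ⟨_, mul_mem ms mL, Or.inl rfl⟩)⟩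

/-- The conjugating word l acts on later qubits, so it commutes with h_d and s_d and can be pulled
outside. -/
theorem h_mul_controlled_mul_h (hd : lo ≤ d) (hn : d ≤ n) {v : Γ} (hd' : 1 ≤ d)
    (hF : F.FixesZ (d + 1)) (hv : v ∈ F.controlled hd' hn hF) : F.InCells d (h d * v * h d) := by
  obtain ⟨r, rfl | ⟨h1, l, hl, rfl⟩⟩ := hv
  · exact F.h_mul_pow_mul_h hd hn r
  · have hl' : l ∈ gateGroup n h s L (d + 1) d := gateGroup_mono le_rfl (by omega) hl
    have c1 := F.commute_h hd hn hl
    have c2 := (F.commute_s' hd' hn hl).zpow_right r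
    have e : h d * (s d ^ r * (l * L d * l⁻¹)) * h d = l * (h d * (s d ^ r * L d) * h d) * l⁻¹ := by
      calc _ = h d * (s d ^ r * l) * L d * (l⁻¹ * h d) := by simp only [mul_assoc]
        _ = (h d * l) * s d ^ r * L d * (h d * l⁻¹) := by
          rw [← c2.eq, c1.inv_left.eq]; simp only [mul_assoc]
        _ = _ := by rw [← c1.eq]; simp only [mul_assoc]
    rw [e]
    exact F.inCells_mul (inv_mem hl') (F.mul_inCells hd hn hl' (F.h_mul_pow_mul_L_mul_h hd h1 r))

/-- The one nontrivial closure property: left multiplication by h_d permits only cells already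
listed. For the h_d cell, K_d is factored into controlled operators and later gates; for the swap
cell, `mul_swapWord_cases` is used. -/
theorem h_mul_inCells (hd : lo ≤ d) (hn : d ≤ n) (hF : F.FixesZ (d + 1)) {w : Γ}
    (hw : F.InCells d w) : F.InCells d (h d * w) := by
  have h0 := F.one_le
  have o := F.one d hd hn
  have ms : s d ∈ gateGroup n h s L (d + 1) d := s_mem_gateGroup le_rfl hn
  obtain ⟨k, hk, rfl | rfl | ⟨m, hm, rfl | ⟨h1, rfl⟩⟩⟩ := hw
  · exact ⟨_, hk, Or.inr (Or.inr ⟨1, one_mem _, Or.inl (by rw [one_mul])⟩)⟩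
  · refine ⟨k, hk, Or.inr (Or.inr ⟨_, mul_mem ms ms, Or.inl ?_⟩)⟩
    simp only [mul_assoc, mul_eq_assoc o.hh, one_mul]
  · obtain ⟨v, hv, l, hl, rfl⟩ := F.exists_controlled_mul (by omega) hn hF hm
    have e : h d * (v * l * h d * k) = h d * v * h d * (l * k) := by
      rw [mul_assoc v, (F.commute_h hd hn hl).eq]; simp only [mul_assoc]
    rw [e]
    exact F.inCells_mul (mul_mem (gateGroup_mono le_rfl (by omega) hl) hk)
      (F.h_mul_controlled_mul_h hd hn _ hF hv)
  · have lk := F.link hd h1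
    have mk : h (d + 1) ∈ gateGroup n h s L (d + 1) d := h_mem_gateGroup le_rfl h1
    have mL : L d ∈ gateGroup n h s L (d + 1) d := L_mem_gateGroup le_rfl h1
    obtain ⟨l, hl, k', hk', e | e⟩ := F.mul_swapWord_cases hd h1 hF hm
    · refine ⟨_, mul_mem mk (mul_mem hk' hk), Or.inr (Or.inr ⟨l, gateGroup_mono le_rfl (by omega) hl,
        Or.inr ⟨h1, ?_⟩⟩)⟩
      rw [e, ← mul_assoc, ← mul_assoc, ← mul_assoc, ← (F.commute_h hd hn hl).eq, mul_assoc l,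
        ← lk.swap_k]
      simp only [mul_assoc]
    · refine ⟨_, mul_mem (mul_mem (mul_mem mk mL) mk) (mul_mem hk' hk), Or.inr (Or.inr ⟨l * L d,
        mul_mem (gateGroup_mono le_rfl (by omega) hl) mL, Or.inl ?_⟩)⟩
      rw [e, ← mul_assoc, ← mul_assoc, ← mul_assoc, ← (F.commute_h hd hn hl).eq, mul_assoc l,
        lk.h_swap]
      simp only [mul_assoc]

/-- The union of the cells contains 1 and is stable under left multiplication by generators. The
four cells match the four types of image of Z_d: itself, its negative, operators anticommuting with
it, and the remaining ones. -/
theorem inCells_of_mem (hd : lo ≤ d) (hn : d ≤ n) (hF : F.FixesZ (d + 1)) {w : Γ}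
    (hw : w ∈ gateGroup n h s L d d) : F.InCells d w := by
  have h0 := F.one_le
  have hgen : ∀ x, ((∃ i, d ≤ i ∧ i ≤ n ∧ x = h i) ∨ (∃ i, d ≤ i ∧ i ≤ n ∧ x = s i) ∨
      ∃ i, d ≤ i ∧ i + 1 ≤ n ∧ x = L i) → x = h d ∨ x ∈ gateGroup n h s L (d + 1) d := by
    rintro x (⟨i, h1, h2, rfl⟩ | ⟨i, h1, h2, rfl⟩ | ⟨i, h1, h2, rfl⟩)
    · rcases h1.eq_or_lt with rfl | h1
      · exact Or.inl rfl
      · exact Or.inr (h_mem_gateGroup h1 h2)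
    · exact Or.inr (s_mem_gateGroup h1 h2)
    · exact Or.inr (L_mem_gateGroup h1 h2)
  rw [gateGroup] at hw
  induction hw using Subgroup.closure_induction_left with
  | one => exact ⟨1, one_mem _, Or.inl rfl⟩
  | mul_left x hx y hy ih =>
    rcases hgen x hx with rfl | h1
    · exact F.h_mul_inCells hd hn hF ih
    · exact F.mul_inCells hd hn h1 ih
  | inv_mul_cancel x hx y hy ih =>
    rcases hgen x hx with rfl | h1
    · rw [(F.one d hd hn).h_inv]
      exact F.h_mul_inCells hd hn hF ih
    · exact F.mul_inCells hd hn (inv_mem h1) ih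

/-- In the other three cells, Z_d goes to -Z_d, or to an image of X_d or of Z_{d+1} under an element
fixing Z_d. None of these equals Z_d. -/
theorem fixesZ_of_succ (hd : lo ≤ d) (hn : d ≤ n) (hF : F.FixesZ (d + 1)) : F.FixesZ d := by
  intro w hw hZ
  have h0 := F.one_le
  have inv : ∀ l ∈ gateGroup n h s L (d + 1) d, ∀ P, cliffAct n (φ l) P = pZ n d → P = pZ n d :=
    fun l hl P hP => cliffAct_injective (φ l) (hP.trans (F.act_Z_eq (by omega) hl).symm)
  obtain ⟨k, hk, rfl | rfl | ⟨l, hl, rfl | ⟨h1, rfl⟩⟩⟩ := F.inCells_of_mem hd hn hF hw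
  · exact hk
  · exfalso
    simp only [map_mul φ] at hZ
    rw [cliffAct_mul, F.act_Z_eq (by omega) hk, F.map_h d hd hn, F.map_s d (by omega) hn,
      act_xWord (by omega) hn] at hZ
    exact unitaryN_neg_ne _ hZ
  · exfalso
    rw [map_mul φ, map_mul φ, cliffAct_mul, F.act_Z_eq (by omega) hk, F.map_h d hd hn,
      cliffAct_mul, act_gH_Z] at hZ
    exact pX_ne_pZ (by omega) hn (inv l hl _ hZ)
  · exfalso
    have := act_swap_Z (n := n) (i := d) (by omega) h1
    rw [map_mul φ, map_mul φ, cliffAct_mul, F.act_Z_eq (by omega) hk, cliffAct_mul] at hZ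
    simp only [swapWord, map_mul φ] at hZ
    rw [F.map_h d hd hn, F.map_h (d + 1) (by omega) h1, F.map_L d (by omega) h1] at hZ
    rw [swapWord] at this
    rw [this] at hZ
    exact pZ_ne_pZ (by omega) hn (by omega) (inv l hl _ hZ).symm

theorem fixesZ_of_lt (hd : n < d) : F.FixesZ d := by
  intro w hw _
  rw [gateGroup_eq_bot hd hd, Subgroup.mem_bot] at hw
  rw [hw]; exact one_mem _

theorem fixesZ (hd : lo ≤ d) : F.FixesZ d := by
  by_cases hn : n < d
  · exact F.fixesZ_of_lt hn
  push Not at hn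
  induction hn using Nat.decreasingInduction with
  | of_succ k hk ih => exact F.fixesZ_of_succ hd (by omega) (ih (by omega))
  | self => exact F.fixesZ_of_succ hd le_rfl (F.fixesZ_of_lt (by omega))

/-- An element of the kernel fixes Z_d, so it is a word without h_d, and `eq_one_of_map_eq_one`
passes to the later qubits. The descent ends at the empty set of qubits. -/
theorem injective_gates (hd : lo ≤ d) :
    ∀ w ∈ gateGroup n h s L d d, φ w = 1 → w = 1 := by
  have h0 := F.one_le
  by_cases hn : n < d
  · intro w hw _
    rwa [gateGroup_eq_bot hn hn, Subgroup.mem_bot] at hw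
  push Not at hn
  have step : ∀ e, lo ≤ e → e ≤ n → (∀ w ∈ gateGroup n h s L (e + 1) (e + 1), φ w = 1 → w = 1) →
      ∀ w ∈ gateGroup n h s L e e, φ w = 1 → w = 1 := by
    intro e he hen ih w hw h1
    refine F.eq_one_of_map_eq_one (by omega) hen (F.one e he hen).ss (F.fixesZ (by omega)) ih ?_ h1
    exact F.fixesZ he w hw (by rw [h1, cliffAct_one])
  induction hn using Nat.decreasingInduction with
  | of_succ k hk ih => exact step k hd (by omega) (ih (by omega))
  | self =>
    refine step n hd le_rfl (fun w hw _ => ?_)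
    rwa [gateGroup_eq_bot (by omega) (by omega), Subgroup.mem_bot] at hw

/-- The homomorphism is injective on the subgroup generated by the gates other than `h 1`. -/
theorem injective_of_two_le (hn : 2 ≤ n) {w : Γ} (hw : w ∈ gateGroup n h s L 2 1) (h1 : φ w = 1) :
    w = 1 := by
  have h2 := F.le_two
  -- With `lo = 2` there are no one-qubit relations at qubit 1; the order of s_1 is read from its
  -- link with qubit 2, which exists as n ≥ 2.
  exact F.eq_one_of_map_eq_one (d := 1) le_rfl (by omega) (F.right 1 le_rfl hn).tt
    (F.fixesZ (by omega)) (F.injective_gates (by omega)) hw h1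

end IsCliffordHom

/-! ### The relations hold for the concrete gates -/

noncomputable section
variable {n i j : ℕ}

theorem act_gS_X : cliffAct n (gS n i) (pX n i) = pY n i := rfl

/-- Distributivity is stated for h and s separately so that `simp` does not open products under Λ;
those are matched whole by the table below, which keeps the order of factors canonical. -/
theorem act_gH_mul (P Q : UnitaryN n) :
    cliffAct n (gH n i) (P * Q) = cliffAct n (gH n i) P * cliffAct n (gH n i) Q :=
  cliffAct_map_mul _ _ _

theorem act_gS_mul (P Q : UnitaryN n) :
    cliffAct n (gS n i) (P * Q) = cliffAct n (gS n i) P * cliffAct n (gS n i) Q :=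
  cliffAct_map_mul _ _ _

theorem act_gH_Y (h1 : 1 ≤ i) (h2 : i ≤ n) : cliffAct n (gH n i) (pY n i) = -pY n i := by
  rw [pY_eq h1 h2, mul_assoc, cliffAct_map_mul, map_inv, cliffAct_phaseI, act_gH_mul, act_gH_X,
    act_gH_Z, pX_mul_pZ h1 h2, mul_neg, neg_neg]

theorem act_gH_Y_ne (h1 : 1 ≤ j) (h2 : j ≤ n) (hij : i ≠ j) :
    cliffAct n (gH n i) (pY n j) = pY n j := by
  rw [pY_eq h1 h2, mul_assoc, cliffAct_map_mul, map_inv, cliffAct_phaseI, act_gH_mul,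
    act_gH_X_ne hij, act_gH_Z_ne hij]

theorem act_gS_Y_ne (h1 : 1 ≤ j) (h2 : j ≤ n) (hij : i ≠ j) :
    cliffAct n (gS n i) (pY n j) = pY n j := by
  rw [pY_eq h1 h2, mul_assoc, cliffAct_map_mul, map_inv, cliffAct_phaseI, act_gS_mul,
    act_gS_X_ne hij, act_gS_Z]

theorem pX_mul_pZ_eq (h1 : 1 ≤ i) (h2 : i ≤ n) : pX n i * pZ n i = phaseI n * pY n i := by
  conv_lhs => rw [pX_eq_pY h1 h2]
  rw [mul_assoc, mul_assoc, mul_self_pZ, mul_one]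

theorem act_gL_X_succ' (h1 : 1 ≤ i) (h2 : i + 1 ≤ n) :
    cliffAct n (gL n i) (pX n (i + 1)) = pZ n i * pX n (i + 1) := by
  rw [act_gL_X_succ h1 h2, (pX_comm_pZ (by omega)).eq]

theorem act_gL_XZ (h1 : 1 ≤ i) (h2 : i + 1 ≤ n) :
    cliffAct n (gL n i) (pX n i * pZ n (i + 1)) = pX n i := by
  rw [cliffAct_map_mul, act_gL_Z, act_gL_X h1 h2, mul_assoc, mul_self_pZ, mul_one]

theorem act_gL_ZX (h1 : 1 ≤ i) (h2 : i + 1 ≤ n) :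
    cliffAct n (gL n i) (pZ n i * pX n (i + 1)) = pX n (i + 1) := by
  rw [cliffAct_map_mul, act_gL_Z, act_gL_X_succ' h1 h2, ← mul_assoc, mul_self_pZ, one_mul]

theorem act_gL_Y (h1 : 1 ≤ i) (h2 : i + 1 ≤ n) :
    cliffAct n (gL n i) (pY n i) = pY n i * pZ n (i + 1) := by
  rw [pY_eq h1 (by omega), mul_assoc, cliffAct_map_mul, map_inv, cliffAct_phaseI, cliffAct_map_mul,
    act_gL_Z, act_gL_X h1 h2, mul_assoc (pX n i), pZ_comm_pZ.eq]
  simp only [mul_assoc]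

theorem act_gL_Y_succ (h1 : 1 ≤ i) (h2 : i + 1 ≤ n) :
    cliffAct n (gL n i) (pY n (i + 1)) = pZ n i * pY n (i + 1) := by
  rw [pY_eq (by omega) h2, cliffAct_map_mul, cliffAct_map_mul, map_inv, cliffAct_phaseI,
    act_gL_Z, act_gL_X_succ' h1 h2, ← mul_assoc, ← (commute_phaseI (pZ n i)).inv_right.eq]
  simp only [mul_assoc]

theorem act_gL_YZ (h1 : 1 ≤ i) (h2 : i + 1 ≤ n) :
    cliffAct n (gL n i) (pY n i * pZ n (i + 1)) = pY n i := by
  rw [cliffAct_map_mul, act_gL_Z, act_gL_Y h1 h2, mul_assoc, mul_self_pZ, mul_one]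

/-- The images are X Z' and Z X'. Regrouping gives XZ · Z'X' = (iY)(-iY') = Y Y'. -/
theorem act_gL_XX (h1 : 1 ≤ i) (h2 : i + 1 ≤ n) :
    cliffAct n (gL n i) (pX n i * pX n (i + 1)) = pY n i * pY n (i + 1) := by
  have e : pX n i * pZ n (i + 1) * (pZ n i * pX n (i + 1))
      = pX n i * pZ n i * (pZ n (i + 1) * pX n (i + 1)) :=
    (pZ_comm_pZ : Commute (pZ n (i + 1)) (pZ n i)).mul_mul_mul_comm _ _
  have e2 : pZ n (i + 1) * pX n (i + 1) = -(phaseI n * pY n (i + 1)) := by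
    rw [← pX_mul_pZ_eq (by omega) h2, pX_mul_pZ (by omega) h2, neg_neg]
  rw [cliffAct_map_mul, act_gL_X h1 h2, act_gL_X_succ' h1 h2, e, e2, pX_mul_pZ_eq h1 (by omega),
    mul_neg, ← mul_assoc, mul_assoc _ (pY n i), (commute_phaseI (pY n i)).eq, ← mul_assoc, phaseI_sq]
  simp only [neg_mul, one_mul, neg_neg]

theorem act_gL_ZZ : cliffAct n (gL n i) (pZ n i * pZ n (i + 1)) = pZ n i * pZ n (i + 1) := by
  rw [cliffAct_map_mul, act_gL_Z, act_gL_Z]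

theorem neg_mul_unitary (P Q : UnitaryN n) : -P * Q = -(P * Q) := neg_mul P Q

theorem mul_neg_unitary (P Q : UnitaryN n) : P * -Q = -(P * Q) := mul_neg P Q

theorem cliffAct_ext_one (i : ℕ) {u v : ProjClifford n}
    (hX : cliffAct n u (pX n i) = cliffAct n v (pX n i))
    (hZ : cliffAct n u (pZ n i) = cliffAct n v (pZ n i))
    (fX : ∀ j, i ≠ j → cliffAct n u (pX n j) = cliffAct n v (pX n j))
    (fZ : ∀ j, i ≠ j → cliffAct n u (pZ n j) = cliffAct n v (pZ n j)) : u = v := by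
  refine cliffAct_ext (fun j _ _ => ?_) (fun j _ _ => ?_) <;> by_cases hj : i = j
  exacts [hj ▸ hX, fX j hj, hj ▸ hZ, fZ j hj]

theorem cliffAct_ext_pair (i : ℕ) {u v : ProjClifford n}
    (hX : cliffAct n u (pX n i) = cliffAct n v (pX n i))
    (hZ : cliffAct n u (pZ n i) = cliffAct n v (pZ n i))
    (hX' : cliffAct n u (pX n (i + 1)) = cliffAct n v (pX n (i + 1)))
    (hZ' : cliffAct n u (pZ n (i + 1)) = cliffAct n v (pZ n (i + 1)))
    (fX : ∀ j, i ≠ j → i + 1 ≠ j → cliffAct n u (pX n j) = cliffAct n v (pX n j))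
    (fZ : ∀ j, i ≠ j → i + 1 ≠ j → cliffAct n u (pZ n j) = cliffAct n v (pZ n j)) : u = v := by
  refine cliffAct_ext_one i hX hZ (fun j hj => ?_) (fun j hj => ?_) <;> by_cases hj' : i + 1 = j
  exacts [hj' ▸ hX', fX j hj hj', hj' ▸ hZ', fZ j hj hj']

theorem oneQubit_gates (h1 : 1 ≤ i) (h2 : i ≤ n) : OneQubit (gS n i) (gH n i) := by
  refine ⟨?_, ?_, ?_⟩ <;>
    refine cliffAct_ext_one i ?_ ?_ (fun j hj => ?_) (fun j hj => ?_) <;> first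
    | (simp only [cliffAct_mul, cliffAct_one, act_gH_X, act_gH_Z, act_gH_Y h1 h2, act_gS_X,
        act_gS_Z, act_gS_Y h1 h2, cliffAct_neg, neg_neg]; done)
    | simp only [cliffAct_mul, act_gH_X_ne hj, act_gH_Z_ne hj, act_gS_X_ne hj, act_gS_Z,
        cliffAct_one]

theorem halfLink_gates (h1 : 1 ≤ i) (h2 : i + 1 ≤ n) :
    HalfLink (gS n i) (gH n i) (gS n (i + 1)) (gL n i) := by
  have hi : i + 1 ≠ i := by omega
  have hi' : i ≠ i + 1 := by omega
  refine ⟨oneQubit_gates h1 (by omega), (oneQubit_gates (by omega) h2).ss, ?_, ?_, ?_, ?_, ?_, ?_⟩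
    <;> refine cliffAct_ext_pair i ?_ ?_ ?_ ?_ (fun j h5 h6 => ?_) (fun j h5 h6 => ?_) <;> first
    | (simp only [cliffAct_mul, cliffAct_one, act_gH_X, act_gH_Z, act_gH_Y h1 (by omega : i ≤ n),
      act_gS_X, act_gS_Z, act_gS_Y h1 (by omega : i ≤ n), act_gS_Y (by omega : 1 ≤ i + 1) h2,
      cliffAct_neg, neg_neg, act_gH_mul, act_gS_mul, neg_mul_unitary,
      act_gH_X_ne hi', act_gH_Z_ne hi', act_gS_X_ne hi,
      act_gS_X_ne hi', act_gS_Y_ne h1 (by omega : i ≤ n) hi,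
      act_gS_Y_ne (by omega : 1 ≤ i + 1) h2 hi', act_gH_Y_ne (by omega : 1 ≤ i + 1) h2 hi',
      act_gL_X h1 h2, act_gL_X_succ' h1 h2, act_gL_Y h1 h2, act_gL_Y_succ h1 h2, act_gL_XZ h1 h2,
      act_gL_ZX h1 h2, act_gL_XX h1 h2, act_gL_ZZ,
      act_gL_Z]; done)
    | simp only [cliffAct_mul, cliffAct_one, act_gL_Z, act_gS_Z, act_gH_X_ne h5, act_gH_Z_ne h5,
        act_gS_X_ne h5, act_gS_X_ne h6, act_gL_X_ne h5.symm h6.symm]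

theorem halfLink_gates_succ (h1 : 1 ≤ i) (h2 : i + 1 ≤ n) :
    HalfLink (gS n (i + 1)) (gH n (i + 1)) (gS n i) (gL n i) := by
  have hi : i + 1 ≠ i := by omega
  have hi' : i ≠ i + 1 := by omega
  have H := halfLink_gates h1 h2
  refine ⟨oneQubit_gates (by omega) h2, H.ss, H.LL, H.ts.symm, H.Ls, H.Lt, ?_, ?_⟩
    <;> refine cliffAct_ext_pair i ?_ ?_ ?_ ?_ (fun j h5 h6 => ?_) (fun j h5 h6 => ?_) <;> first
    | (simp only [cliffAct_mul, act_gH_X, act_gH_Z, act_gH_Y (by omega : 1 ≤ i + 1) h2,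
      act_gS_X, act_gS_Z, act_gS_Y h1 (by omega : i ≤ n), act_gS_Y (by omega : 1 ≤ i + 1) h2,
      cliffAct_neg, neg_neg, act_gH_mul, act_gS_mul, mul_neg_unitary,
      act_gH_X_ne hi, act_gH_Z_ne hi, act_gS_X_ne hi,
      act_gS_X_ne hi', act_gS_Y_ne h1 (by omega : i ≤ n) hi,
      act_gS_Y_ne (by omega : 1 ≤ i + 1) h2 hi', act_gH_Y_ne h1 (by omega : i ≤ n) hi,
      act_gL_X h1 h2, act_gL_X_succ' h1 h2, act_gL_Y h1 h2, act_gL_Y_succ h1 h2,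
      act_gL_XX h1 h2, act_gL_ZZ,
      act_gL_Z]; done)
    | simp only [cliffAct_mul, act_gL_Z, act_gS_Z, act_gH_X_ne h6, act_gH_Z_ne h6,
        act_gS_X_ne h5, act_gS_X_ne h6, act_gL_X_ne h5.symm h6.symm]

theorem commute_gS_gS (i j : ℕ) : Commute (gS n i) (gS n j) := by
  by_cases hij : i = j
  · rw [hij]
  refine cliffAct_ext (fun k h3 h4 => ?_) (fun k h3 h4 => by simp only [cliffAct_mul, act_gS_Z])
  rw [cliffAct_mul, cliffAct_mul]
  by_cases h1 : i = k
  · subst h1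
    rw [act_gS_X_ne (Ne.symm hij), act_gS_X, act_gS_Y_ne h3 h4 (Ne.symm hij)]
  rw [act_gS_X_ne h1]
  by_cases h2 : j = k
  · subst h2
    rw [act_gS_X, act_gS_Y_ne h3 h4 hij]
  · rw [act_gS_X_ne h2, act_gS_X_ne h1]

theorem commute_gH_gH (i j : ℕ) : Commute (gH n i) (gH n j) := by
  by_cases hij : i = j
  · rw [hij]
  refine cliffAct_ext_one i ?_ ?_ (fun k h1 => ?_) (fun k h1 => ?_) <;>
    rw [cliffAct_mul, cliffAct_mul]
  · rw [act_gH_X_ne (Ne.symm hij), act_gH_X, act_gH_Z_ne (Ne.symm hij)]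
  · rw [act_gH_Z_ne (Ne.symm hij), act_gH_Z, act_gH_X_ne (Ne.symm hij)]
  · rw [act_gH_X_ne h1]
    by_cases h2 : j = k
    · subst h2
      rw [act_gH_X, act_gH_Z_ne hij]
    · rw [act_gH_X_ne h2, act_gH_X_ne h1]
  · rw [act_gH_Z_ne h1]
    by_cases h2 : j = k
    · subst h2
      rw [act_gH_Z, act_gH_X_ne hij]
    · rw [act_gH_Z_ne h2, act_gH_Z_ne h1]

/-- Each Λ multiplies X_k by 1 or by some Z_m. These factors are fixed by every Λ and commute with
each other. -/
theorem commute_gL_gL (h1 : 1 ≤ i) (h2 : i + 1 ≤ n) (h3 : 1 ≤ j) (h4 : j + 1 ≤ n) :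
    Commute (gL n i) (gL n j) := by
  have hL : ∀ {k l}, 1 ≤ k → k + 1 ≤ n → ∃ P, cliffAct n (gL n k) (pX n l) = pX n l * P ∧
      (∀ m, cliffAct n (gL n m) P = P) ∧ (∀ m, Commute P (pZ n m)) ∧ (P = 1 ∨ ∃ m, P = pZ n m) := by
    intro k l hk hk'
    rcases (show l = k ∨ l = k + 1 ∨ (l ≠ k ∧ l ≠ k + 1) by omega) with rfl | rfl | ⟨h5, h6⟩
    · exact ⟨_, act_gL_X hk hk', fun m => act_gL_Z, fun m => pZ_comm_pZ, Or.inr ⟨_, rfl⟩⟩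
    · exact ⟨_, act_gL_X_succ hk hk', fun m => act_gL_Z, fun m => pZ_comm_pZ, Or.inr ⟨_, rfl⟩⟩
    · exact ⟨1, by rw [act_gL_X_ne h5 h6, mul_one], fun m => cliffAct_map_one _,
        fun m => Commute.one_left _, Or.inl rfl⟩
  refine cliffAct_ext (fun k h5 h6 => ?_) (fun k h5 h6 => by simp only [cliffAct_mul, act_gL_Z])
  obtain ⟨P, e, f, c, -⟩ := hL (l := k) h1 h2
  obtain ⟨Q, e', f', -, rfl | ⟨m, rfl⟩⟩ := hL (l := k) h3 h4
  · rw [cliffAct_mul, cliffAct_mul, e', e, mul_one, e, cliffAct_map_mul, e', f, mul_one]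
  · rw [cliffAct_mul, cliffAct_mul, e', e, cliffAct_map_mul, cliffAct_map_mul, e', e, f, f',
      mul_assoc, mul_assoc, (c m).eq]

theorem commute_gL_gS (h1 : 1 ≤ i) (h2 : i + 1 ≤ n) (h3 : 1 ≤ j) (h4 : j ≤ n) :
    Commute (gL n i) (gS n j) := by
  rcases (show j = i ∨ j = i + 1 ∨ (j ≠ i ∧ j ≠ i + 1) by omega) with rfl | rfl | ⟨h5, h6⟩
  · exact (halfLink_gates h1 h2).Ls
  · exact (halfLink_gates h1 h2).Lt
  refine cliffAct_ext (fun k h7 h8 => ?_) (fun k h7 h8 => ?_)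
  · rw [cliffAct_mul, cliffAct_mul]
    by_cases hj : j = k
    · subst hj
      rw [act_gS_X, act_gL_X_ne h5 h6, act_gS_X, pY_eq h3 h4, cliffAct_map_mul, cliffAct_map_mul,
        map_inv, cliffAct_phaseI, act_gL_X_ne h5 h6, act_gL_Z]
    · rw [act_gS_X_ne hj]
      rcases (show k = i ∨ k = i + 1 ∨ (k ≠ i ∧ k ≠ i + 1) by omega) with rfl | rfl | ⟨h9, h10⟩
      · rw [act_gL_X h1 h2, act_gS_mul, act_gS_X_ne hj, act_gS_Z]
      · rw [act_gL_X_succ h1 h2, act_gS_mul, act_gS_X_ne hj, act_gS_Z]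
      · rw [act_gL_X_ne h9 h10, act_gS_X_ne hj]
  · simp only [cliffAct_mul, act_gL_Z, act_gS_Z]

theorem commute_gL_gH (h1 : 1 ≤ i) (h2 : i + 1 ≤ n) (h5 : j ≠ i) (h6 : j ≠ i + 1) :
    Commute (gL n i) (gH n j) := by
  refine cliffAct_ext (fun k h7 h8 => ?_) (fun k h7 h8 => ?_)
  · rw [cliffAct_mul, cliffAct_mul]
    by_cases hj : j = k
    · subst hj
      rw [act_gH_X, act_gL_X_ne h5 h6, act_gH_X, act_gL_Z]
    · rw [act_gH_X_ne hj]
      rcases (show k = i ∨ k = i + 1 ∨ (k ≠ i ∧ k ≠ i + 1) by omega) with rfl | rfl | ⟨h9, h10⟩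
      · rw [act_gL_X h1 h2, act_gH_mul, act_gH_X_ne hj, act_gH_Z_ne h6]
      · rw [act_gL_X_succ h1 h2, act_gH_mul, act_gH_X_ne hj, act_gH_Z_ne h5]
      · rw [act_gL_X_ne h9 h10, act_gH_X_ne hj]
  · rw [cliffAct_mul, cliffAct_mul]
    by_cases hj : j = k
    · subst hj
      rw [act_gH_Z, act_gL_Z, act_gL_X_ne h5 h6, act_gH_Z]
    · rw [act_gH_Z_ne hj, act_gL_Z, act_gH_Z_ne hj]

end

/-- R13 is the mirror image of R14. With a and b the two neighbouring swaps, a b a reverses the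
three qubits, exchanging L_j with L_{j+1} and h_j with h_{j+2}, so it conjugates one cube to the
other. -/
theorem CliffordFamily.cube' {Γ : Type*} [Group Γ] {lo n : ℕ} {h s L : ℕ → Γ}
    (F : CliffordFamily lo n h s L) {j : ℕ} (hj : lo ≤ j) (hn : j + 2 ≤ n) :
    (L j * h (j + 1) * h j * L j * h (j + 1) * h j * L (j + 1)) ^ 3 = 1 := by
  have h0 := F.one_le
  have l1 := F.link hj (by omega : j + 1 ≤ n)
  have l2 := F.link (by omega : lo ≤ j + 1) (by omega : j + 1 + 1 ≤ n)
  have hb := F.swap_braid hj hn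
  have hc := F.cube j (by omega) hn
  have c13 := F.hh j (j + 2) hj (by omega) (by omega) hn
  have c1 := F.Lh (j + 1) j (by omega) (by omega) hj (by omega) (by omega) (by omega)
  have c3 := F.Lh j (j + 2) (by omega) (by omega) (by omega) hn (by omega) (by omega)
  rw [show j + 1 + 1 = j + 2 by ring] at l2
  generalize h j = p, h (j + 1) = q, h (j + 2) = r, L j = x, L (j + 1) = y at *
  have pq : Commute p q := l1.hk
  have qr : Commute q r := l2.hk
  have ap : SemiconjBy (swapWord p q x) p q := l1.swap_h
  have aq : SemiconjBy (swapWord p q x) q p := l1.swap_k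
  have ax : SemiconjBy (swapWord p q x) x x := l1.swap_L
  have br : SemiconjBy (swapWord q r y) r q := l2.swap_k
  have ar : SemiconjBy (swapWord p q x) r r := by
    have := (c3.mul_left c13).mul_left qr
    exact (this.mul_left this).mul_left this
  have bp : SemiconjBy (swapWord q r y) p p := by
    have := (c1.mul_left pq.symm).mul_left c13.symm
    exact (this.mul_left this).mul_left this
  have aa := l1.swap_swap
  have bb := l2.swap_swap
  generalize swapWord p q x = a, swapWord q r y = b at *
  have hy : y = a * b * x * b * a := by
    rw [mul_assoc a b, mul_assoc a (b * x), ← hb]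
    simp only [mul_assoc, aa, mul_one, mul_eq_assoc aa, one_mul]
  have cr : SemiconjBy (a * b * a) r p := by
    rw [mul_assoc]; exact aq.mul_left (br.mul_left ar)
  have cq : SemiconjBy (a * b * a) q q := by
    rw [mul_assoc]; exact ap.mul_left (bp.mul_left aq)
  have cx : SemiconjBy (a * b * a) x y := by
    rw [SemiconjBy, hy, mul_assoc (a * b), ax.eq]
    simp only [mul_assoc, mul_eq_assoc aa, mul_eq_assoc bb, one_mul]
  have cy : SemiconjBy (a * b * a) y x := by
    rw [SemiconjBy, hy]
    simp only [mul_assoc, mul_eq_assoc aa, mul_eq_assoc bb, one_mul]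
    rw [← mul_assoc, ax.eq, mul_assoc]
  have key := ((((((cy.mul_right cr).mul_right cq).mul_right cy).mul_right cr).mul_right
    cq).mul_right cx).pow_right 3
  rw [mul_assoc x q, ← pq.eq, ← mul_assoc, mul_assoc _ q p, ← pq.eq, ← mul_assoc]
  rw [hc, SemiconjBy, mul_one] at key
  exact mul_eq_right.1 key.symm

noncomputable section
variable {n i j : ℕ}

theorem link_gates (h1 : 1 ≤ i) (h2 : i + 1 ≤ n) :
    Link (gS n i) (gH n i) (gS n (i + 1)) (gH n (i + 1)) (gL n i) :=
  ⟨halfLink_gates h1 h2, halfLink_gates_succ h1 h2, commute_gH_gH i (i + 1)⟩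

/-- The swap of the qubits `i` and `i + 1`. -/
def gSwap (n i : ℕ) : ProjClifford n := swapWord (gH n i) (gH n (i + 1)) (gL n i)

theorem act_gSwap_Z (h1 : 1 ≤ i) (h2 : i + 1 ≤ n) :
    cliffAct n (gSwap n i) (pZ n i) = pZ n (i + 1) := act_swap_Z h1 h2

theorem act_gSwap_Z_succ (h1 : 1 ≤ i) (h2 : i + 1 ≤ n) :
    cliffAct n (gSwap n i) (pZ n (i + 1)) = pZ n i := by
  have := (link_gates h1 h2).swap_swap
  rw [← act_gSwap_Z h1 h2, ← cliffAct_mul, gSwap, this, cliffAct_one]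

theorem act_gSwap_X (h1 : 1 ≤ i) (h2 : i + 1 ≤ n) :
    cliffAct n (gSwap n i) (pX n i) = pX n (i + 1) := by
  rw [← act_gH_Z, ← cliffAct_mul, gSwap, (link_gates h1 h2).swap_h, cliffAct_mul,
    act_swap_Z h1 h2, act_gH_Z]

theorem act_gSwap_X_succ (h1 : 1 ≤ i) (h2 : i + 1 ≤ n) :
    cliffAct n (gSwap n i) (pX n (i + 1)) = pX n i := by
  have := (link_gates h1 h2).swap_swap
  rw [← act_gSwap_X h1 h2, ← cliffAct_mul, gSwap, this, cliffAct_one]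

theorem act_gSwap_X_ne (h1 : i ≠ j) (h2 : i + 1 ≠ j) :
    cliffAct n (gSwap n i) (pX n j) = pX n j := by
  simp only [gSwap, swapWord, cliffAct_mul, act_gH_X_ne h1, act_gH_X_ne h2,
    act_gL_X_ne h1.symm h2.symm]

theorem act_gSwap_Z_ne (h1 : i ≠ j) (h2 : i + 1 ≠ j) :
    cliffAct n (gSwap n i) (pZ n j) = pZ n j := by
  simp only [gSwap, swapWord, cliffAct_mul, act_gH_Z_ne h1, act_gH_Z_ne h2, act_gL_Z]

theorem cliffAct_ext_three (i : ℕ) {u v : ProjClifford n}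
    (hX : ∀ j, j = i ∨ j = i + 1 ∨ j = i + 2 → cliffAct n u (pX n j) = cliffAct n v (pX n j))
    (hZ : ∀ j, j = i ∨ j = i + 1 ∨ j = i + 2 → cliffAct n u (pZ n j) = cliffAct n v (pZ n j))
    (fX : ∀ j, i ≠ j → i + 1 ≠ j → i + 2 ≠ j → cliffAct n u (pX n j) = cliffAct n v (pX n j))
    (fZ : ∀ j, i ≠ j → i + 1 ≠ j → i + 2 ≠ j → cliffAct n u (pZ n j) = cliffAct n v (pZ n j)) :
    u = v := by
  refine cliffAct_ext (fun j _ _ => ?_) (fun j _ _ => ?_) <;>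
    by_cases h : j = i ∨ j = i + 1 ∨ j = i + 2
  exacts [hX j h, fX j (by omega) (by omega) (by omega), hZ j h,
    fZ j (by omega) (by omega) (by omega)]

/-- Both sides are the controlled Z between qubits j and j+2. -/
theorem gSwap_braid (h1 : 1 ≤ j) (h2 : j + 2 ≤ n) :
    gSwap n j * gL n (j + 1) * gSwap n j = gSwap n (j + 1) * gL n j * gSwap n (j + 1) := by
  have s1 := act_gSwap_X h1 (by omega : j + 1 ≤ n)
  have s2 := act_gSwap_X_succ h1 (by omega : j + 1 ≤ n)
  have s3 := act_gSwap_Z h1 (by omega : j + 1 ≤ n)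
  have s4 := act_gSwap_Z_succ h1 (by omega : j + 1 ≤ n)
  have s5 := act_gSwap_X_ne (n := n) (i := j) (j := j + 2) (by omega) (by omega)
  have s6 := act_gSwap_Z_ne (n := n) (i := j) (j := j + 2) (by omega) (by omega)
  have t1 : _ = pX n (j + 2) := act_gSwap_X (i := j + 1) (by omega) h2
  have t2 : cliffAct n _ (pX n (j + 2)) = _ := act_gSwap_X_succ (i := j + 1) (by omega) h2
  have t3 : _ = pZ n (j + 2) := act_gSwap_Z (i := j + 1) (by omega) h2
  have t4 : cliffAct n _ (pZ n (j + 2)) = _ := act_gSwap_Z_succ (i := j + 1) (by omega) h2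
  have t5 := act_gSwap_X_ne (n := n) (i := j + 1) (j := j) (by omega) (by omega)
  have t6 := act_gSwap_Z_ne (n := n) (i := j + 1) (j := j) (by omega) (by omega)
  have l1 := act_gL_X h1 (by omega : j + 1 ≤ n)
  have l2 := act_gL_X_succ h1 (by omega : j + 1 ≤ n)
  have l3 := act_gL_X_ne (n := n) (i := j) (j := j + 2) (by omega) (by omega)
  have l4 : _ = _ * pZ n (j + 2) := act_gL_X (i := j + 1) (by omega) h2
  have l5 : cliffAct n _ (pX n (j + 2)) = pX n (j + 2) * _ :=
    act_gL_X_succ (i := j + 1) (by omega) h2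
  have l6 := act_gL_X_ne (n := n) (i := j + 1) (j := j) (by omega) (by omega)
  refine cliffAct_ext_three j ?_ ?_ (fun k h3 h4 h5 => ?_) (fun k h3 h4 h5 => ?_)
  · rintro k (rfl | rfl | rfl)
    · simp only [cliffAct_mul, s1, l4, cliffAct_map_mul, s2, s6, t5, l1, t3]
    · simp only [cliffAct_mul, s1, l6, s2, t1, l3, t2]
    · simp only [cliffAct_mul, cliffAct_map_mul, s5, l5, s4, t2, l2, t1, t6]
  · rintro k (rfl | rfl | rfl) <;> simp only [cliffAct_mul, act_gL_Z, s3, s4, s6, t3, t4, t6]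
  · simp only [cliffAct_mul, act_gSwap_X_ne h3 h4, act_gSwap_X_ne h4 h5,
      act_gL_X_ne h3.symm h4.symm, act_gL_X_ne h4.symm h5.symm]
  · simp only [cliffAct_mul, act_gSwap_Z_ne h3 h4, act_gSwap_Z_ne h4 h5, act_gL_Z]

theorem three_gates (h1 : 1 ≤ j) (h2 : j + 2 ≤ n) :
    gL n j * gH n (j + 1) * gH n j * gL n j * gH n (j + 2) * gH n (j + 1) * gL n (j + 1)
      * gH n (j + 2) * gH n (j + 1) * gL n j * gH n (j + 1) * gH n j * gL n j
    = gL n (j + 1) * gH n (j + 2) * gH n (j + 1) * gL n (j + 1) * gH n (j + 1) * gH n j * gL n j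
      * gH n (j + 1) * gH n j * gL n (j + 1) * gH n (j + 2) * gH n (j + 1) * gL n (j + 1) :=
  (three_iff_swap_braid (link_gates h1 (by omega)) (link_gates (i := j + 1) (by omega) (by omega))
    (commute_gH_gH _ _) (commute_gL_gH (by omega) h2 (by omega) (by omega))
    (commute_gL_gH h1 (by omega) (by omega) (by omega))
    (commute_gL_gL h1 (by omega) (by omega) h2)).2 (gSwap_braid h1 h2)

theorem act_cox_Z_succ (h1 : 1 ≤ i) (h2 : i + 1 ≤ n) :
    cliffAct n (gL n i * gH n i * gH n (i + 1)) (pZ n (i + 1)) = pZ n i * pX n (i + 1) := by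
  rw [cliffAct_mul, act_gH_Z, cliffAct_mul, act_gH_X_ne (by omega), act_gL_X_succ' h1 h2]

theorem act_cox_X_left : cliffAct n (gL n i * gH n i * gH n (i + 1)) (pX n i) = pZ n i := by
  rw [cliffAct_mul, act_gH_X_ne (by omega), cliffAct_mul, act_gH_X, act_gL_Z]

theorem act_cox_X_ne (h1 : i ≠ j) (h2 : i + 1 ≠ j) :
    cliffAct n (gL n i * gH n i * gH n (i + 1)) (pX n j) = pX n j := by
  rw [cliffAct_mul, act_gH_X_ne h2, cliffAct_mul, act_gH_X_ne h1, act_gL_X_ne h1.symm h2.symm]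

theorem act_cox_Z_ne (h1 : i ≠ j) (h2 : i + 1 ≠ j) :
    cliffAct n (gL n i * gH n i * gH n (i + 1)) (pZ n j) = pZ n j := by
  rw [cliffAct_mul, act_gH_Z_ne h2, cliffAct_mul, act_gH_Z_ne h1, act_gL_Z]

/-- The word w = D² Λ_j has order three on generators. For instance Z_{j+1} → X_{j+2} → Z_{j+1}
X_{j+2} → Z_{j+1} and X_{j+1} → X_{j+1} Z_{j+2} Z_j → Z_{j+2} → X_{j+1}. -/
theorem cube_gates (h1 : 1 ≤ j) (h2 : j + 2 ≤ n) :
    (gL n (j + 1) * gH n (j + 2) * gH n (j + 1) * gL n (j + 1) * gH n (j + 2) * gH n (j + 1)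
      * gL n j) ^ 3 = 1 := by
  have d1 := act_cox_Z (n := n) (i := j + 1) (by omega) h2
  have d2 := act_cox_XZ (n := n) (i := j + 1) (by omega) h2
  have d3 := act_cox_X (n := n) (i := j + 1)
  have d4 := act_cox_Z_succ (n := n) (i := j + 1) (by omega) h2
  have d5 := act_cox_X_left (n := n) (i := j + 1)
  have d6 := act_cox_X_ne (n := n) (i := j + 1) (j := j) (by omega) (by omega)
  have d7 := act_cox_Z_ne (n := n) (i := j + 1) (j := j) (by omega) (by omega)
  have d8 := fun k => act_cox_X_ne (n := n) (i := j + 1) (j := k)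
  have d9 := fun k => act_cox_Z_ne (n := n) (i := j + 1) (j := k)
  have e : gL n (j + 1) * gH n (j + 2) * gH n (j + 1) * gL n (j + 1) * gH n (j + 2) * gH n (j + 1)
      * gL n j = gL n (j + 1) * gH n (j + 1) * gH n (j + 1 + 1)
        * (gL n (j + 1) * gH n (j + 1) * gH n (j + 1 + 1)) * gL n j := by
    rw [mul_assoc _ (gH n (j + 1)) (gH n (j + 1 + 1)), (commute_gH_gH (j + 1) (j + 1 + 1)).eq]
    simp only [mul_assoc]
  rw [e, pow_three]
  generalize gL n (j + 1) * gH n (j + 1) * gH n (j + 1 + 1) = D at *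
  change cliffAct n D _ = _ * pZ n (j + 2) at d1
  change cliffAct n D (_ * pZ n (j + 2)) = pX n (j + 2) at d2
  change cliffAct n D (pX n (j + 2)) = pZ n (j + 2) at d3
  change cliffAct n D (pZ n (j + 2)) = _ * pX n (j + 2) at d4
  have l1 := act_gL_X h1 (by omega : j + 1 ≤ n)
  have l2 := act_gL_X_succ h1 (by omega : j + 1 ≤ n)
  have l3 := act_gL_X_ne (n := n) (i := j) (j := j + 2) (by omega) (by omega)
  have zq : cliffAct n D (pZ n (j + 1) * pX n (j + 2)) = pX n (j + 1) := by
    rw [cliffAct_map_mul, d1, d3, mul_assoc, mul_self_pZ, mul_one]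
  have wX : cliffAct n (D * D * gL n j) (pX n j) = pX n j * pX n (j + 2) := by
    rw [cliffAct_mul, l1, cliffAct_map_mul, cliffAct_mul, d6, d6, cliffAct_mul, d1, d2]
  have wXq : cliffAct n (D * D * gL n j) (pX n (j + 2)) = pZ n (j + 1) * pX n (j + 2) := by
    rw [cliffAct_mul, l3, cliffAct_mul, d3, d4]
  have wZp : cliffAct n (D * D * gL n j) (pZ n (j + 1)) = pX n (j + 2) := by
    rw [cliffAct_mul, act_gL_Z, cliffAct_mul, d1, d2]
  have wXp : cliffAct n (D * D * gL n j) (pX n (j + 1)) = pX n (j + 1) * (pZ n (j + 2) * pZ n j) := by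
    rw [cliffAct_mul, l2, cliffAct_map_mul, cliffAct_mul, d5, d1, cliffAct_mul, d7, d7, mul_assoc]
  have wZq : cliffAct n (D * D * gL n j) (pZ n (j + 2)) = pX n (j + 1) := by
    rw [cliffAct_mul, act_gL_Z, cliffAct_mul, d4, zq]
  have wZ : cliffAct n (D * D * gL n j) (pZ n j) = pZ n j := by
    rw [cliffAct_mul, act_gL_Z, cliffAct_mul, d7, d7]
  have fX : ∀ k, j ≠ k → j + 1 ≠ k → j + 2 ≠ k →
      cliffAct n (D * D * gL n j) (pX n k) = pX n k := by
    intro k h3 h4 h5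
    rw [cliffAct_mul, act_gL_X_ne h3.symm h4.symm, cliffAct_mul, d8 k h4 h5, d8 k h4 h5]
  have fZ : ∀ k, j ≠ k → j + 1 ≠ k → j + 2 ≠ k →
      cliffAct n (D * D * gL n j) (pZ n k) = pZ n k := by
    intro k h3 h4 h5
    rw [cliffAct_mul, act_gL_Z, cliffAct_mul, d9 k h4 h5, d9 k h4 h5]
  generalize D * D * gL n j = w at *
  have wZX : cliffAct n w (pZ n (j + 1) * pX n (j + 2)) = pZ n (j + 1) := by
    rw [cliffAct_map_mul, wZp, wXq, ← mul_assoc, (pX_comm_pZ (by omega)).eq, mul_assoc,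
      mul_self_pX, mul_one]
  have wXZZ : cliffAct n w (pX n (j + 1) * (pZ n (j + 2) * pZ n j)) = pZ n (j + 2) := by
    rw [cliffAct_map_mul, cliffAct_map_mul, wXp, wZq, wZ, mul_assoc,
      mul_assoc, ← mul_assoc (pZ n j), ← (pX_comm_pZ (by omega : j + 1 ≠ j)).eq, mul_assoc,
      mul_self_pZ, mul_one, ← (pX_comm_pZ (by omega : j + 1 ≠ j + 2)).eq, ← mul_assoc, mul_self_pX,
      one_mul]
  refine cliffAct_ext_three j ?_ ?_ (fun k h3 h4 h5 => ?_) (fun k h3 h4 h5 => ?_)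
  · rintro k (rfl | rfl | rfl)
    · rw [cliffAct_one, cliffAct_mul, cliffAct_mul, wX, cliffAct_map_mul, wX, wXq, mul_assoc,
        ← mul_assoc (pX n (k + 2)), (pX_comm_pZ (by omega)).eq, mul_assoc, mul_self_pX, mul_one,
        cliffAct_map_mul, wX, wZp, mul_assoc, mul_self_pX, mul_one]
    · rw [cliffAct_one, cliffAct_mul, cliffAct_mul, wXp, wXZZ, wZq]
    · rw [cliffAct_one, cliffAct_mul, cliffAct_mul, wXq, wZX, wZp]
  · rintro k (rfl | rfl | rfl)
    · rw [cliffAct_one, cliffAct_mul, cliffAct_mul, wZ, wZ, wZ]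
    · rw [cliffAct_one, cliffAct_mul, cliffAct_mul, wZp, wXq, wZX]
    · rw [cliffAct_one, cliffAct_mul, cliffAct_mul, wZq, wXp, wXZZ]
  · rw [cliffAct_one, cliffAct_mul, cliffAct_mul, fX k h3 h4 h5, fX k h3 h4 h5, fX k h3 h4 h5]
  · rw [cliffAct_one, cliffAct_mul, cliffAct_mul, fZ k h3 h4 h5, fZ k h3 h4 h5, fZ k h3 h4 h5]

theorem cliffordFamily_gates (n : ℕ) : CliffordFamily 1 n (gH n) (gS n) (gL n) where
  one_le := le_rfl
  le_two := by omega
  one _ h1 h2 := oneQubit_gates h1 h2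
  left _ h1 h2 := halfLink_gates h1 h2
  right _ h1 h2 := halfLink_gates_succ h1 h2
  ss i j _ _ _ _ := commute_gS_gS i j
  hh i j _ _ _ _ := commute_gH_gH i j
  LL _ _ h1 h2 h3 h4 := commute_gL_gL h1 h2 h3 h4
  Ls _ _ h1 h2 h3 h4 := commute_gL_gS h1 h2 h3 h4
  Lh _ _ h1 h2 _ _ h5 h6 := commute_gL_gH h1 h2 h5 h6
  three _ h1 h2 := three_gates h1 h2
  cube _ h1 h2 := cube_gates h1 h2

end

/-! ### Generation of the stabilizer of Z_1 -/

noncomputable section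
variable {n d i j : ℕ}

theorem cliffAct_mem_pauliGroup (u : ProjClifford n) {P : UnitaryN n} (hP : P ∈ PauliGroup n) :
    cliffAct n u P ∈ PauliGroup n := by
  obtain ⟨U, hU, rfl⟩ := exists_projClass u
  rw [cliffAct_projClass]
  have := (Subgroup.mem_normalizer_iff.1 (inv_mem hU) P).1 hP
  rwa [inv_inv] at this

/-- Commuting with both X_d and Z_d leaves no component on qubit d. -/
theorem mem_pauliFrom_succ {P : UnitaryN n} (h1 : 1 ≤ d) (h2 : d ≤ n) (hP : P ∈ pauliFrom n d)
    (hX : Commute P (pX n d)) (hZ : Commute P (pZ n d)) : P ∈ pauliFrom n (d + 1) := by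
  rcases anticommute_cases h1 h2 hP with ⟨-, Q, hQ, rfl | rfl⟩ | ⟨h, -⟩
  · exact hQ
  · exfalso
    have := hX.mul_left (commute_pX hQ).inv_left
    rw [mul_inv_cancel_right] at this
    have h3 := pX_mul_pZ h1 h2
    rw [this.eq] at h3
    exact unitaryN_neg_ne _ h3.symm
  · rw [hZ.eq] at h
    exact absurd h.symm (unitaryN_neg_ne _)

theorem mem_pauliFrom_of_commute {P : UnitaryN n} (hP : P ∈ PauliGroup n) :
    ∀ d, d ≤ n → (∀ i, 1 ≤ i → i ≤ d → Commute P (pX n i)) →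
      (∀ i, 1 ≤ i → i ≤ d → Commute P (pZ n i)) → P ∈ pauliFrom n (d + 1) := by
  intro d
  induction d with
  | zero => intro _ _ _; rwa [zero_add, pauliFrom_one]
  | succ d ih =>
    intro hd hX hZ
    exact mem_pauliFrom_succ (by omega) hd
      (ih (by omega) (fun i h1 h2 => hX i h1 (by omega)) (fun i h1 h2 => hZ i h1 (by omega)))
      (hX _ (by omega) le_rfl) (hZ _ (by omega) le_rfl)

theorem commute_of_cliffAct_eq {u : ProjClifford n} {P Q : UnitaryN n} (h : Commute P Q)
    (hQ : cliffAct n u Q = Q) : Commute (cliffAct n u P) Q := by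
  have := h.map (cliffAct n u)
  rwa [hQ] at this

theorem act_Z_ne_one {u : ProjClifford n} (h1 : 1 ≤ i) (h2 : i ≤ n) :
    cliffAct n u (pZ n i) ≠ 1 ∧ cliffAct n u (pZ n i) ≠ -1 := by
  constructor <;> intro h
  · exact pZ_ne_one h1 h2 (cliffAct_injective u (h.trans (cliffAct_map_one u).symm))
  · exact pZ_ne_neg_one h1 h2
      (cliffAct_injective u (h.trans (by rw [cliffAct_neg, cliffAct_map_one])))

/-- An element of the projective Clifford group that fixes the Pauli operators on the first qubits
is a product of gates on the other qubits. -/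
theorem mem_cliffGates_of_fixes (hd : 1 ≤ d) (hn : d ≤ n + 1) : ∀ u : ProjClifford n,
    (∀ i, 1 ≤ i → i < d → cliffAct n u (pX n i) = pX n i) →
    (∀ i, 1 ≤ i → i < d → cliffAct n u (pZ n i) = pZ n i) → u ∈ cliffGates n d d := by
  induction hn using Nat.decreasingInduction with
  | self =>
    intro u hX hZ
    rw [eq_one_of_cliffAct (fun i h1 h2 => hX i h1 (by omega)) (fun i h1 h2 => hZ i h1 (by omega))]
    exact one_mem _
  | of_succ d hd' ih =>
    intro u hX hZ
    have hmem : ∀ u : ProjClifford n, (∀ i, 1 ≤ i → i < d → cliffAct n u (pX n i) = pX n i) →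
        (∀ i, 1 ≤ i → i < d → cliffAct n u (pZ n i) = pZ n i) → ∀ P ∈ PauliGroup n,
        (∀ i, 1 ≤ i → i < d → Commute P (pX n i)) → (∀ i, 1 ≤ i → i < d → Commute P (pZ n i)) →
        cliffAct n u P ∈ pauliFrom n d := by
      intro u hX hZ P hP cX cZ
      have := mem_pauliFrom_of_commute (cliffAct_mem_pauliGroup u hP) (d - 1) (by omega)
        (fun i h1 h2 => commute_of_cliffAct_eq (cX i h1 (by omega)) (hX i h1 (by omega)))
        (fun i h1 h2 => commute_of_cliffAct_eq (cZ i h1 (by omega)) (hZ i h1 (by omega)))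
      rwa [Nat.sub_add_cancel hd] at this
    have hdn : d ≤ n := by omega
    have mZ : pZ n d ∈ PauliGroup n := by rw [← pauliFrom_one]; exact pZ_mem hd hdn
    have mX : pX n d ∈ PauliGroup n := by rw [← pauliFrom_one]; exact pX_mem hd hdn
    -- Images of operators on qubit d commute with all operators on the fixed qubits, so they live
    -- on the qubits from d on and transitivity applies; v restores Z_d.
    obtain ⟨v, hv, hvZ⟩ := exists_act_pZ hd hdn (hmem u hX hZ _ mZ
      (fun i h1 h2 => (pX_comm_pZ (by omega)).symm) (fun i h1 h2 => pZ_comm_pZ))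
      (by rw [← cliffAct_map_mul, mul_self_pZ, cliffAct_map_one]) (act_Z_ne_one hd hdn).1
      (act_Z_ne_one hd hdn).2
    have hX' : ∀ i, 1 ≤ i → i < d → cliffAct n (v⁻¹ * u) (pX n i) = pX n i := by
      intro i h1 h2
      rw [cliffAct_mul, hX i h1 h2]
      exact cliffAct_inv_eq (act_pX_of_lt hv h2 h2)
    have hZ' : ∀ i, 1 ≤ i → i < d → cliffAct n (v⁻¹ * u) (pZ n i) = pZ n i := by
      intro i h1 h2
      rw [cliffAct_mul, hZ i h1 h2]
      exact cliffAct_inv_eq (act_pZ_of_lt hv h2)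
    have hdZ : cliffAct n (v⁻¹ * u) (pZ n d) = pZ n d := by
      rw [cliffAct_mul]; exact cliffAct_inv_eq hvZ
    -- The image of X_d still anticommutes with Z_d, so w can restore X_d while keeping Z_d.
    obtain ⟨w, hw, hwX⟩ := exists_act_pX hd hdn (hmem (v⁻¹ * u) hX' hZ' _ mX
      (fun i h1 h2 => pX_comm_pX) (fun i h1 h2 => pX_comm_pZ (by omega)))
      (by rw [← cliffAct_map_mul, mul_self_pX, cliffAct_map_one]) (by
        have := congrArg (cliffAct n (v⁻¹ * u)) (pX_mul_pZ hd hdn)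
        rwa [cliffAct_neg, cliffAct_map_mul, cliffAct_map_mul, hdZ] at this)
    have key : w⁻¹ * (v⁻¹ * u) ∈ cliffGates n (d + 1) (d + 1) := by
      refine ih (by omega) _ (fun i h1 h2 => ?_) (fun i h1 h2 => ?_)
      · rcases (Nat.lt_succ_iff.1 h2).eq_or_lt with rfl | h3
        · rw [cliffAct_mul]; exact cliffAct_inv_eq hwX
        · rw [cliffAct_mul, hX' i h1 h3]
          exact cliffAct_inv_eq (act_pX_of_lt hw h2 h3)
      · rw [cliffAct_mul]
        rcases (Nat.lt_succ_iff.1 h2).eq_or_lt with rfl | h3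
        · rw [hdZ]; exact cliffAct_inv_eq (act_pZ_of_lt hw h2)
        · rw [hZ' i h1 h3]; exact cliffAct_inv_eq (act_pZ_of_lt hw h2)
    have e : u = v * (w * (w⁻¹ * (v⁻¹ * u))) := by group
    rw [e]
    exact mul_mem hv (mul_mem (gateGroup_mono (by omega) le_rfl hw)
      (gateGroup_mono (by omega) (by omega) key))

/-- The stabilizer of `Z_1` is generated by the gates other than `h_1`. -/
theorem fixer_pZ (hn : 1 ≤ n) : fixer (pZ n 1) = cliffGates n 2 1 := by
  apply le_antisymm
  · intro u hu
    rw [mem_fixer] at hu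
    have mX : pX n 1 ∈ PauliGroup n := by rw [← pauliFrom_one]; exact pX_mem le_rfl hn
    obtain ⟨w, hw, hwX⟩ := exists_act_pX le_rfl hn (P := cliffAct n u (pX n 1))
      (by rw [pauliFrom_one]; exact cliffAct_mem_pauliGroup u mX)
      (by rw [← cliffAct_map_mul, mul_self_pX, cliffAct_map_one]) (by
        have := congrArg (cliffAct n u) (pX_mul_pZ le_rfl hn)
        rwa [cliffAct_neg, cliffAct_map_mul, cliffAct_map_mul, hu] at this)
    have key : w⁻¹ * u ∈ cliffGates n 2 2 := by
      refine mem_cliffGates_of_fixes (by omega) (by omega) _ (fun i h1 h2 => ?_)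
        (fun i h1 h2 => ?_) <;> obtain rfl : i = 1 := by omega
      · rw [cliffAct_mul]; exact cliffAct_inv_eq hwX
      · rw [cliffAct_mul, hu]; exact cliffAct_inv_eq (act_pZ_of_lt hw h2)
    rw [← mul_inv_cancel_left w u]
    exact mul_mem hw (gateGroup_mono le_rfl (by omega) key)
  · intro u hu
    exact act_pZ_of_lt hu (by omega)

end

/-! ### The centralizers of s_1 and s_1² -/

noncomputable section
variable {n d i j : ℕ}

theorem clH_eq (h : 1 ≤ i ∧ i ≤ n) : clH n i h = gH n i := (dif_pos h).symm

theorem clS_eq (h : 1 ≤ i ∧ i ≤ n) : clS n i h = gS n i := (dif_pos h).symm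

theorem clL_eq (h : 1 ≤ i ∧ i + 1 ≤ n) : clL n i h = gL n i := (dif_pos h).symm

theorem gateS_mul_self : gateS * gateS = gateZ := by
  apply Subtype.ext
  ext i j; fin_cases i <;> fin_cases j <;> simp [gateS, gateZ]

/-- S² = Z, so s_i² is the class of a Pauli operator and acts by conjugation with it. -/
theorem act_gS_sq (h1 : 1 ≤ i) (h2 : i ≤ n) (P : UnitaryN n) :
    cliffAct n (gS n i * gS n i) P = pZ n i * P * pZ n i := by
  have e : (pZ n i)⁻¹ = pZ n i := inv_eq_of_mul_eq_one_left mul_self_pZ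
  have e2 : onQubit (⟨i - 1, by omega⟩ : Fin n) gateS * onQubit (⟨i - 1, by omega⟩ : Fin n) gateS
      = pZ n i := by
    rw [← map_mul, gateS_mul_self, pZ, dif_pos ⟨h1, h2⟩]
  rw [cliffAct_mul, ← clS_eq ⟨h1, h2⟩, clS, cliffAct_projClass, cliffAct_projClass]
  nth_rewrite 1 [← e]
  rw [← e2]
  simp only [_root_.mul_inv_rev, mul_assoc]

/-- The elements that commute with `s_1²` are those that fix `Z_1` up to sign. -/
theorem mem_centralizer_sq (hn : 1 ≤ n) {u : ProjClifford n} :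
    u ∈ clCent (gS n 1 * gS n 1) ↔
      cliffAct n u (pZ n 1) = pZ n 1 ∨ cliffAct n u (pZ n 1) = -pZ n 1 := by
  have act : ∀ P, cliffAct n (u * (gS n 1 * gS n 1)) P
      = cliffAct n u (pZ n 1) * cliffAct n u P * cliffAct n u (pZ n 1) := by
    intro P
    rw [cliffAct_mul, act_gS_sq le_rfl hn, cliffAct_map_mul, cliffAct_map_mul]
  have act' : ∀ P, cliffAct n (gS n 1 * gS n 1 * u) P = pZ n 1 * cliffAct n u P * pZ n 1 := by
    intro P
    rw [cliffAct_mul, act_gS_sq le_rfl hn]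
  have hsq : cliffAct n u (pZ n 1) * cliffAct n u (pZ n 1) = 1 := by
    rw [← cliffAct_map_mul, mul_self_pZ, cliffAct_map_one]
  rw [Subgroup.mem_centralizer_singleton_iff]
  constructor
  · intro h
    have hP : cliffAct n u (pZ n 1) ∈ PauliGroup n :=
      cliffAct_mem_pauliGroup u (by rw [← pauliFrom_one]; exact pZ_mem le_rfl hn)
    generalize cliffAct n u (pZ n 1) = P at *
    -- Conjugation by P, the image of Z_1, equals conjugation by Z_1, so Z_1 P is central.
    have hc : ∀ Q, Commute (pZ n 1 * P) Q := by
      intro Q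
      obtain ⟨R, rfl⟩ := (cliffAct n u).surjective Q
      have h2 := act R
      rw [h, act'] at h2
      generalize cliffAct n u R = Q at *
      calc pZ n 1 * P * Q = pZ n 1 * (P * Q * P) * P := by simp only [mul_assoc, hsq, mul_one]
        _ = pZ n 1 * pZ n 1 * Q * (pZ n 1 * P) := by rw [← h2]; simp only [mul_assoc]
        _ = _ := by rw [mul_self_pZ, one_mul]
    have hm : pZ n 1 * P ∈ pauliFrom n (n + 1) :=
      mem_pauliFrom_of_commute (mul_mem (by rw [← pauliFrom_one]; exact pZ_mem le_rfl hn) hP) n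
        le_rfl (fun _ _ _ => hc _) (fun _ _ _ => hc _)
    have hPe : P = pZ n 1 * (pZ n 1 * P) := by rw [← mul_assoc, mul_self_pZ, one_mul]
    have hc' := hc (pZ n 1)
    generalize pZ n 1 * P = R at *
    -- The central factor between P and Z_1 is an involution in the Pauli group, hence a sign.
    have hRR : R * R = 1 := mul_self_of_mul_commute mul_self_pZ hc'.symm (by rwa [← hPe])
    rcases eq_one_or_of_mem_from_succ hm hRR with rfl | rfl
    · left; rw [hPe, mul_one]
    · right; rw [hPe, mul_neg, mul_one]
  · intro h
    have : ∀ P, cliffAct n (u * (gS n 1 * gS n 1)) P = cliffAct n (gS n 1 * gS n 1 * u) P := by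
      intro P
      rcases h with h | h <;> rw [act, act', h]
      rw [neg_mul, neg_mul, mul_neg, neg_neg]
    exact cliffAct_ext (fun _ _ _ => this _) (fun _ _ _ => this _)

/-- The element `g` as a word in the gates of qubit 1. -/
def gG (n : ℕ) : ProjClifford n := gH n 1 * gS n 1 * gH n 1 * gS n 1 ^ 3 * gH n 1

theorem clG_eq (hn : 1 ≤ n) : clG n hn = gG n := by
  rw [clG, clH_eq, clS_eq, gG]

theorem act_gG_Z (hn : 1 ≤ n) : cliffAct n (gG n) (pZ n 1) = -pZ n 1 := by
  simp only [gG, pow_succ, pow_zero, one_mul, cliffAct_mul, act_gH_Z, act_gS_X, act_gS_Y le_rfl hn,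
    cliffAct_neg, act_gH_Y le_rfl hn, neg_neg, act_gH_X]

theorem act_gG_X (hn : 1 ≤ n) : cliffAct n (gG n) (pX n 1) = -pY n 1 := by
  simp only [gG, pow_succ, pow_zero, one_mul, cliffAct_mul, act_gH_Z, act_gS_X, act_gS_Z,
    act_gH_Y le_rfl hn, act_gH_X]

theorem act_gG_Y (hn : 1 ≤ n) : cliffAct n (gG n) (pY n 1) = -pX n 1 := by
  simp only [gG, pow_succ, pow_zero, one_mul, cliffAct_mul, act_gH_Z, act_gS_X, act_gS_Z,
    act_gS_Y le_rfl hn, act_gH_Y le_rfl hn, act_gH_X, cliffAct_neg, neg_neg]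

theorem act_gG_X_ne (h : j ≠ 1) : cliffAct n (gG n) (pX n j) = pX n j := by
  simp only [gG, pow_succ, pow_zero, one_mul, cliffAct_mul, act_gH_X_ne h.symm, act_gS_X_ne h.symm]

theorem act_gG_Z_ne (h : j ≠ 1) : cliffAct n (gG n) (pZ n j) = pZ n j := by
  simp only [gG, pow_succ, pow_zero, one_mul, cliffAct_mul, act_gH_Z_ne h.symm, act_gS_Z]

theorem gG_mul_self (hn : 1 ≤ n) : gG n * gG n = 1 := by
  refine cliffAct_ext_one 1 ?_ ?_ (fun j hj => ?_) (fun j hj => ?_) <;>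
    rw [cliffAct_mul, cliffAct_one]
  · rw [act_gG_X hn, cliffAct_neg, act_gG_Y hn, neg_neg]
  · rw [act_gG_Z hn, cliffAct_neg, act_gG_Z hn, neg_neg]
  · rw [act_gG_X_ne hj.symm, act_gG_X_ne hj.symm]
  · rw [act_gG_Z_ne hj.symm, act_gG_Z_ne hj.symm]

/-- The element `g` commutes with the words in the gates of the other qubits. -/
theorem commute_gG {w : ProjClifford n} (hn : 1 ≤ n) (hw : w ∈ cliffGates n 2 2) :
    Commute (gG n) w := by
  have F := cliffordFamily_gates n
  have c1 := F.commute_h (d := 1) le_rfl hn hw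
  have c2 := F.commute_s (d := 1) le_rfl hn (gateGroup_mono le_rfl (by omega) hw)
  exact ((((c1.mul_right c2).mul_right c1).mul_right (c2.pow_right 3)).mul_right c1).symm

theorem gG_conj_s (hn : 1 ≤ n) : gG n * gS n 1 * gG n = gS n 1 ^ 3 := by
  refine cliffAct_ext_one 1 ?_ ?_ (fun j hj => ?_) (fun j hj => ?_) <;>
    simp only [pow_succ, pow_zero, one_mul, cliffAct_mul]
  · rw [act_gG_X hn, cliffAct_neg, act_gS_Y le_rfl hn, neg_neg, act_gG_X hn, act_gS_X,
      act_gS_Y le_rfl hn, cliffAct_neg, act_gS_X]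
  · rw [act_gG_Z hn, cliffAct_neg, act_gS_Z, cliffAct_neg, act_gG_Z hn, neg_neg, act_gS_Z,
      act_gS_Z]
  · rw [act_gG_X_ne hj.symm, act_gS_X_ne hj, act_gG_X_ne hj.symm, act_gS_X_ne hj, act_gS_X_ne hj]
  · rw [act_gG_Z_ne hj.symm, act_gS_Z, act_gG_Z_ne hj.symm, act_gS_Z, act_gS_Z]

theorem gG_conj_L (hn : 2 ≤ n) : gG n * gL n 1 * gG n = gL n 1 * gS n 2 ^ 2 := by
  have e : ∀ P, cliffAct n (gL n 1 * gS n 2 ^ 2) P = cliffAct n (gL n 1) (pZ n 2 * P * pZ n 2) := by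
    intro P
    rw [cliffAct_mul, pow_two, act_gS_sq (by omega) hn]
  have f1 := act_gL_X (n := n) (i := 1) le_rfl hn
  have f2 := act_gL_X_succ' (n := n) (i := 1) le_rfl hn
  refine cliffAct_ext_pair 1 ?_ ?_ ?_ ?_ (fun j hj hj' => ?_) (fun j hj hj' => ?_) <;>
    rw [e, cliffAct_mul, cliffAct_mul]
  · rw [act_gG_X (by omega), cliffAct_neg, act_gL_Y le_rfl hn, cliffAct_neg, cliffAct_map_mul,
      act_gG_Y (by omega), act_gG_Z_ne (by omega), ← (pX_comm_pZ (by omega)).eq, mul_assoc,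
      mul_self_pZ, mul_one, f1, neg_mul, neg_neg]
  · rw [act_gG_Z (by omega), cliffAct_neg, act_gL_Z, cliffAct_neg, act_gG_Z (by omega), neg_neg,
      pZ_comm_pZ.eq, mul_assoc, mul_self_pZ, mul_one, act_gL_Z]
  · have := pX_mul_pZ (n := n) (i := 2) (by omega) hn
    rw [act_gG_X_ne (by omega), f2, cliffAct_map_mul, act_gG_Z (by omega), act_gG_X_ne (by omega),
      mul_assoc, this, mul_neg, ← mul_assoc, mul_self_pZ, one_mul, cliffAct_neg, f2, neg_mul]
  · rw [act_gG_Z_ne (by omega), act_gL_Z, act_gG_Z_ne (by omega), mul_self_pZ, one_mul, act_gL_Z]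
  · rw [act_gG_X_ne (by omega), act_gL_X_ne (by omega) (by omega), act_gG_X_ne (by omega),
      ← (pX_comm_pZ (by omega)).eq, mul_assoc, mul_self_pZ, mul_one,
      act_gL_X_ne (by omega) (by omega)]
  · rw [act_gG_Z_ne (by omega), act_gL_Z, act_gG_Z_ne (by omega), pZ_comm_pZ.eq, mul_assoc,
      mul_self_pZ, mul_one, act_gL_Z]

/-- The elements that commute with `s_1` are those that fix `Z_1`. -/
theorem centralizer_gS (hn : 1 ≤ n) : clCent (gS n 1) = cliffGates n 2 1 := by
  have F := cliffordFamily_gates n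
  apply le_antisymm
  · intro u hu
    rw [Subgroup.mem_centralizer_singleton_iff] at hu
    have c : Commute u (gS n 1) := hu
    have h2 : u ∈ clCent (gS n 1 * gS n 1) :=
      Subgroup.mem_centralizer_singleton_iff.2 (c.mul_right c)
    rw [mem_centralizer_sq hn] at h2
    rw [← fixer_pZ hn, mem_fixer]
    rcases h2 with h2 | h2
    · exact h2
    · exfalso
      -- If u negated Z_1, then g u would fix Z_1 and commute with s_1, forcing g to commute with
      -- s_1. But g inverts s_1, and s_1 differs from s_1³ on X_1.
      have h3 : gG n * u ∈ cliffGates n 2 1 := by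
        rw [← fixer_pZ hn, mem_fixer, cliffAct_mul, h2, cliffAct_neg, act_gG_Z hn, neg_neg]
      have h4 : Commute (gG n) (gS n 1) := by
        have := (F.commute_s le_rfl hn h3).mul_left c.inv_left
        rwa [mul_inv_cancel_right] at this
      have h5 := gG_conj_s hn
      rw [h4.eq, mul_assoc, gG_mul_self hn, mul_one] at h5
      have h6 := congrArg (fun u => cliffAct n u (pX n 1)) h5
      simp only [pow_succ, pow_zero, one_mul, cliffAct_mul] at h6
      rw [act_gS_X, act_gS_Y le_rfl hn, cliffAct_neg, act_gS_X] at h6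
      exact unitaryN_neg_ne _ h6.symm
  · intro u hu
    exact Subgroup.mem_centralizer_singleton_iff.2 (F.commute_s le_rfl hn hu).eq

theorem toClifford_g (hn : 2 ≤ n) : (INSymbol.g : INSymbol n).toClifford hn = gG n :=
  clG_eq (by omega)

theorem toClifford_h (hn : 2 ≤ n) (hi : 2 ≤ i ∧ i ≤ n) :
    (INSymbol.h i hi).toClifford hn = gH n i := clH_eq ⟨by omega, hi.2⟩

theorem toClifford_s (hn : 2 ≤ n) (hj : 1 ≤ j ∧ j ≤ n) :
    (INSymbol.s j hj).toClifford hn = gS n j := clS_eq hj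

theorem toClifford_L (hn : 2 ≤ n) (hj : 1 ≤ j ∧ j + 1 ≤ n) :
    (INSymbol.L j hj).toClifford hn = gL n j := clL_eq hj

theorem closure_toClifford_ne (hn : 2 ≤ n) :
    Subgroup.closure (INSymbol.toClifford hn '' {x | x ≠ INSymbol.g}) = cliffGates n 2 1 := by
  apply le_antisymm
  · rw [Subgroup.closure_le]
    rintro _ ⟨x, hx, rfl⟩
    cases x with
    | g => exact absurd rfl hx
    | h i hi => rw [toClifford_h]; exact h_mem_gateGroup hi.1 hi.2
    | s j hj => rw [toClifford_s]; exact s_mem_gateGroup hj.1 hj.2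
    | L k hk => rw [toClifford_L]; exact L_mem_gateGroup hk.1 hk.2
  · refine gateGroup_le (fun i h1 h2 => ?_) (fun i h1 h2 => ?_) (fun i h1 h2 => ?_)
    · rw [← toClifford_h hn ⟨h1, h2⟩]; exact Subgroup.subset_closure ⟨_, by simp, rfl⟩
    · rw [← toClifford_s hn ⟨h1, h2⟩]; exact Subgroup.subset_closure ⟨_, by simp, rfl⟩
    · rw [← toClifford_L hn ⟨h1, h2⟩]; exact Subgroup.subset_closure ⟨_, by simp, rfl⟩

/-- The elements that commute with `s_1²` are those of `⟨h_i, s_j, Λ_k⟩` and their products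
with `g`. -/
theorem mem_centralizer_sq_iff (hn : 1 ≤ n) {u : ProjClifford n} :
    u ∈ clCent (gS n 1 * gS n 1) ↔ u ∈ cliffGates n 2 1 ∨ gG n * u ∈ cliffGates n 2 1 := by
  rw [mem_centralizer_sq hn, ← fixer_pZ hn, mem_fixer, mem_fixer, cliffAct_mul]
  have h : cliffAct n (gG n) (-pZ n 1) = pZ n 1 := by
    rw [cliffAct_neg, act_gG_Z hn, neg_neg]
  refine or_congr Iff.rfl ⟨fun h1 => by rw [h1, h], fun h1 => ?_⟩
  exact cliffAct_injective (gG n) (h1.trans h.symm)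

theorem centralizer_sq_eq (hn : 2 ≤ n) :
    clCent (gS n 1 * gS n 1) = Subgroup.closure (Set.range (INSymbol.toClifford hn)) := by
  have hg : gG n ∈ Subgroup.closure (Set.range (INSymbol.toClifford hn)) :=
    Subgroup.subset_closure ⟨INSymbol.g, toClifford_g hn⟩
  have hK : cliffGates n 2 1 ≤ Subgroup.closure (Set.range (INSymbol.toClifford hn)) := by
    rw [← closure_toClifford_ne hn]
    exact Subgroup.closure_mono (Set.image_subset_range _ _)
  apply le_antisymm
  · intro u hu
    rcases (mem_centralizer_sq_iff (by omega)).1 hu with h | h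
    · exact hK h
    · rw [← inv_mul_cancel_left (gG n) u]
      exact mul_mem (inv_mem hg) (hK h)
  · rw [Subgroup.closure_le]
    rintro _ ⟨x, rfl⟩
    by_cases hx : x = INSymbol.g
    · subst hx
      rw [toClifford_g, SetLike.mem_coe, mem_centralizer_sq (by omega)]
      exact Or.inr (act_gG_Z (by omega))
    · refine (mem_centralizer_sq_iff (by omega)).2 (Or.inl ?_)
      rw [← closure_toClifford_ne hn]
      exact Subgroup.subset_closure ⟨x, hx, rfl⟩

end

/-! ### The semidirect product and the presentation -/

noncomputable section
variable {n d i j : ℕ}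

theorem gG_notMem (hn : 1 ≤ n) : gG n ∉ cliffGates n 2 1 := by
  rw [← fixer_pZ hn, mem_fixer, act_gG_Z hn]
  exact unitaryN_neg_ne _

theorem zpowers_gG (hn : 1 ≤ n) {u : ProjClifford n} (hu : u ∈ Subgroup.zpowers (gG n)) :
    u = 1 ∨ u = gG n := by
  obtain ⟨k, rfl⟩ := hu
  have h2 : gG n ^ (2 : ℤ) = 1 := by rw [zpow_ofNat, pow_two, gG_mul_self hn]
  rcases Int.even_or_odd' k with ⟨m, rfl | rfl⟩
  · left; simp only [zpow_mul, h2, one_zpow]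
  · right; simp only [zpow_add, zpow_mul, h2, one_zpow, one_mul, zpow_one]

theorem gG_mem (hn : 1 ≤ n) : gG n ∈ clCent (gS n 1 * gS n 1) :=
  (mem_centralizer_sq hn).2 (Or.inr (act_gG_Z hn))

theorem zpowers_gG_le (hn : 1 ≤ n) : Subgroup.zpowers (gG n) ≤ clCent (gS n 1 * gS n 1) :=
  Subgroup.zpowers_le.2 (gG_mem hn)

theorem cliffGates_le (hn : 1 ≤ n) : cliffGates n 2 1 ≤ clCent (gS n 1 * gS n 1) :=
  fun _ hu => (mem_centralizer_sq_iff hn).2 (Or.inl hu)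

/-- The pointwise stabilizer of {Z_1, -Z_1} is normal in the stabilizer of that set. -/
theorem cliffGates_normal (hn : 1 ≤ n) :
    ((cliffGates n 2 1).subgroupOf (clCent (gS n 1 * gS n 1))).Normal where
  conj_mem := by
    rintro ⟨k, hk'⟩ hk ⟨u, hu⟩
    rw [Subgroup.mem_subgroupOf] at hk ⊢
    rw [← fixer_pZ hn, mem_fixer] at hk ⊢
    simp only at hk
    change cliffAct n (u * k * u⁻¹) (pZ n 1) = pZ n 1
    have hu' := inv_mem hu
    rw [mem_centralizer_sq hn] at hu'
    have e : cliffAct n k (cliffAct n u⁻¹ (pZ n 1)) = cliffAct n u⁻¹ (pZ n 1) := by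
      rcases hu' with h | h <;> rw [h]
      · exact hk
      · rw [cliffAct_neg, hk]
    rw [cliffAct_mul, cliffAct_mul, e, ← cliffAct_mul, mul_inv_cancel, cliffAct_one]

theorem isComplement_zpowers_gG (hn : 1 ≤ n) :
    Subgroup.IsComplement' ((Subgroup.zpowers (gG n)).subgroupOf (clCent (gS n 1 * gS n 1)))
      ((cliffGates n 2 1).subgroupOf (clCent (gS n 1 * gS n 1))) := by
  have := cliffGates_normal hn
  apply Subgroup.isComplement'_of_disjoint_and_mul_eq_univ
  · rw [Subgroup.disjoint_def]
    rintro ⟨u, hu⟩ h1 h2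
    rw [Subgroup.mem_subgroupOf] at h1 h2
    rcases zpowers_gG hn h1 with h | h
    · exact Subtype.ext h
    · rw [h] at h2
      exact absurd h2 (gG_notMem hn)
  · rw [Set.eq_univ_iff_forall]
    rintro ⟨u, hu⟩
    rcases (mem_centralizer_sq_iff hn).1 hu with h | h
    · exact ⟨1, one_mem _, ⟨u, hu⟩, Subgroup.mem_subgroupOf.2 h, one_mul _⟩
    · refine ⟨⟨gG n, gG_mem hn⟩, Subgroup.mem_subgroupOf.2 (Subgroup.mem_zpowers _),
        ⟨gG n * u, mul_mem (gG_mem hn) hu⟩, Subgroup.mem_subgroupOf.2 h, Subtype.ext ?_⟩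
      change gG n * (gG n * u) = u
      rw [← mul_assoc, gG_mul_self hn, one_mul]

/-- R3 is redundant: h s h = s³ h s³ makes the base equal to s² h s³, a conjugate of s h. -/
theorem OneQubit.cube_comm {Γ : Type*} [Group Γ] {s h : Γ} (H : OneQubit s h) :
    (s ^ 3 * h * s * h) ^ 3 = 1 := by
  obtain ⟨hh, ss, sh⟩ := H
  simp only [pow_succ, pow_zero, one_mul]
  grind (acSteps := 1000000)

/-- R4 is redundant: the bit flip inverts s and therefore commutes with s². -/
theorem OneQubit.sq_comm {Γ : Type*} [Group Γ] {s h : Γ} (H : OneQubit s h) :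
    (s ^ 2 * h * s ^ 2 * h) ^ 2 = 1 := by
  have := H.xsx
  obtain ⟨hh, ss, sh⟩ := H
  simp only [pow_succ, pow_zero, one_mul]
  grind (acSteps := 1000000)

theorem pow_four_eq {Γ : Type*} [Group Γ] (s : Γ) : s ^ 4 = s * s * s * s := by
  simp only [pow_succ, pow_zero, one_mul]

theorem pow_mul_three_eq {Γ : Type*} [Group Γ] (s h : Γ) :
    (s * h) ^ 3 = s * h * s * h * s * h := by
  simp only [pow_succ, pow_zero, one_mul, mul_assoc]

open INSymbol in
theorem lift_toClifford_eq (hn : 2 ≤ n) {u v : FreeGroup (INSymbol n)} (h : INRelation n u v) :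
    FreeGroup.lift (toClifford hn) u = FreeGroup.lift (toClifford hn) v := by
  have F := cliffordFamily_gates n
  have eg : FreeGroup.lift (toClifford hn) fg = gG n := by
    rw [fg, FreeGroup.lift_apply_of, toClifford_g]
  have eh : ∀ {i} (hi : 2 ≤ i ∧ i ≤ n), FreeGroup.lift (toClifford hn) (fh i hi) = gH n i := by
    intro i hi; rw [fh, FreeGroup.lift_apply_of, toClifford_h]
  have es : ∀ {i} (hi : 1 ≤ i ∧ i ≤ n), FreeGroup.lift (toClifford hn) (fs i hi) = gS n i := by
    intro i hi; rw [fs, FreeGroup.lift_apply_of, toClifford_s]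
  have eL : ∀ {i} (hi : 1 ≤ i ∧ i + 1 ≤ n), FreeGroup.lift (toClifford hn) (fL i hi) = gL n i := by
    intro i hi; rw [fL, FreeGroup.lift_apply_of, toClifford_L]
  have hn1 : 1 ≤ n := by omega
  have gc : ∀ w ∈ cliffGates n 2 2, gG n * w * gG n = w := fun w hw => by
    rw [(commute_gG hn1 hw).eq, mul_assoc, gG_mul_self hn1, mul_one]
  cases h with
  | Q1 => rw [map_pow, map_one, eg, pow_two, gG_mul_self hn1]
  | Q2 i hi => simp only [map_mul, eg, eh]; exact gc _ (h_mem_gateGroup hi.1 hi.2)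
  | Q3_first _ => simp only [map_mul, map_pow, eg, es]; exact gG_conj_s hn1
  | Q3 j hj hj1 => simp only [map_mul, eg, es]; exact gc _ (s_mem_gateGroup (by omega) hj.2)
  | Q4_first _ => simp only [map_mul, map_pow, eg, es, eL]; exact gG_conj_L hn
  | Q4 k hk hk1 => simp only [map_mul, eg, eL]; exact gc _ (L_mem_gateGroup (by omega) hk.2)
  | R1_h i hi =>
    rw [map_pow, map_one, eh, pow_two, (F.one i (by omega) hi.2).hh]
  | R1_s i hi =>
    rw [map_pow, map_one, es, pow_four_eq, (F.one i (by omega) hi.2).ss]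
  | R1_L i hi =>
    rw [map_pow, map_one, eL, pow_two, (F.left i hi.1 hi.2).LL]
  | R2 i hi =>
    rw [map_pow, map_mul, map_one, eh, es, pow_mul_three_eq, (F.one i (by omega) hi.2).sh]
  | R3 i hi =>
    simp only [map_mul, map_pow, map_one, eh, es]; exact (F.one i (by omega) hi.2).cube_comm
  | R4 i hi =>
    simp only [map_mul, map_pow, map_one, eh, es]; exact (F.one i (by omega) hi.2).sq_comm
  | R5_h i i' hi hi' => simp only [map_mul, eh]; exact commute_gH_gH _ _
  | R5_s i i' hi hi' => simp only [map_mul, es]; exact commute_gS_gS _ _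
  | R5_L i i' hi hi' =>
    simp only [map_mul, eL]; exact commute_gL_gL hi.1 hi.2 hi'.1 hi'.2
  | R6 j k hj hk => simp only [map_mul, es, eL]; exact commute_gL_gS hk.1 hk.2 hj.1 hj.2
  | R7 i k hi hk h1 h2 => simp only [map_mul, eh, eL]; exact commute_gL_gH hk.1 hk.2 h1 h2
  | R8 i hi =>
    have H := F.left i (by omega) hi.2
    have := H.hL
    have c : Commute (gS n (i + 1)) (gS n i) := H.ts
    simp only [map_mul, map_pow, eh, es, eL]
    -- R8 lists the two squares in the opposite order to `hL`.
    rw [mul_assoc (gL n i * gH n i), ((c.pow_left 2).pow_right 2).eq]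
    simpa only [pow_two, mul_assoc] using this
  | R9 i hi =>
    have := (F.right i hi.1 hi.2).hL
    simp only [map_mul, map_pow, eh, es, eL]
    simpa only [pow_two, mul_assoc] using this
  | R10 i hi =>
    have H := F.left i (by omega) hi.2
    have := H.LhL
    simp only [map_mul, eh, es, eL]
    rw [mul_assoc (gS n i * gH n i * gL n i), H.ts, ← mul_assoc]
    exact this
  | R11 i hi =>
    have H := F.right i hi.1 hi.2
    have := H.LhL
    simp only [map_mul, eh, es, eL]
    exact this
  | R12 j hj => simp only [map_mul, eh, eL]; exact F.three j (by omega) hj.2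
  | R13 j hj =>
    simp only [map_mul, map_pow, map_one, eh, eL]; exact F.cube' (by omega) hj.2
  | R14 j hj =>
    simp only [map_mul, map_pow, map_one, eh, eL]; exact F.cube j hj.1 hj.2

/-- The homomorphism from the presented group to the projective Clifford group. -/
def presentedHom (hn : 2 ≤ n) : INPresented n →* ProjClifford n :=
  PresentedGroup.toGroup (f := INSymbol.toClifford hn) (by
    rintro r ⟨u, v, h, rfl⟩
    rw [map_mul, map_inv, lift_toClifford_eq hn h, mul_inv_cancel])

theorem presentedHom_of (hn : 2 ≤ n) (x : INSymbol n) :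
    presentedHom hn (PresentedGroup.of x) = x.toClifford hn := PresentedGroup.toGroup.of _

/-- The generator `h_i` of the presented group. -/
def genH (n i : ℕ) : INPresented n :=
  if hi : 2 ≤ i ∧ i ≤ n then PresentedGroup.of (INSymbol.h i hi) else 1

/-- The generator `s_j` of the presented group. -/
def genS (n j : ℕ) : INPresented n :=
  if hj : 1 ≤ j ∧ j ≤ n then PresentedGroup.of (INSymbol.s j hj) else 1

/-- The generator `Λ_k` of the presented group. -/
def genL (n k : ℕ) : INPresented n :=
  if hk : 1 ≤ k ∧ k + 1 ≤ n then PresentedGroup.of (INSymbol.L k hk) else 1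

/-- The generator `g` of the presented group. -/
def genG (n : ℕ) : INPresented n := PresentedGroup.of INSymbol.g

theorem mk_fg : PresentedGroup.mk (inRelators n) INSymbol.fg = genG n := rfl

theorem mk_fh (hi : 2 ≤ i ∧ i ≤ n) :
    PresentedGroup.mk (inRelators n) (INSymbol.fh i hi) = genH n i := by rw [genH, dif_pos hi]; rfl

theorem mk_fs (hi : 1 ≤ i ∧ i ≤ n) :
    PresentedGroup.mk (inRelators n) (INSymbol.fs i hi) = genS n i := by rw [genS, dif_pos hi]; rfl

theorem mk_fL (hi : 1 ≤ i ∧ i + 1 ≤ n) :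
    PresentedGroup.mk (inRelators n) (INSymbol.fL i hi) = genL n i := by rw [genL, dif_pos hi]; rfl

theorem mk_eq_of_relation {u v : FreeGroup (INSymbol n)} (h : INRelation n u v) :
    PresentedGroup.mk (inRelators n) u = PresentedGroup.mk (inRelators n) v := by
  have : PresentedGroup.mk (inRelators n) (u * v⁻¹) = 1 :=
    PresentedGroup.one_of_mem ⟨u, v, h, rfl⟩
  rwa [map_mul, map_inv, mul_inv_eq_one] at this

theorem oneQubit_gen (h1 : 2 ≤ i) (h2 : i ≤ n) : OneQubit (genS n i) (genH n i) := by
  have r1 := mk_eq_of_relation (INRelation.R1_h (n := n) i ⟨h1, h2⟩)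
  have r2 := mk_eq_of_relation (INRelation.R1_s (n := n) i ⟨by omega, h2⟩)
  have r3 := mk_eq_of_relation (INRelation.R2 (n := n) i ⟨h1, h2⟩)
  simp only [map_mul, map_pow, map_one, mk_fh, mk_fs] at r1 r2 r3
  rw [pow_two] at r1
  rw [pow_four_eq] at r2
  rw [pow_mul_three_eq] at r3
  exact ⟨r1, r2, r3⟩

/-- Only R1, R2, R5–R12 and R14 are used. Since `lo = 2`, nothing about a Hadamard on qubit 1 is
required. -/
theorem cliffordFamily_gen (n : ℕ) : CliffordFamily 2 n (genH n) (genS n) (genL n) := by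
  have ss : ∀ i j, 1 ≤ i → i ≤ n → 1 ≤ j → j ≤ n → Commute (genS n i) (genS n j) := by
    intro i j h1 h2 h3 h4
    rw [Commute, SemiconjBy]
    simpa only [map_mul, mk_fs] using
      mk_eq_of_relation (INRelation.R5_s (n := n) i j ⟨h1, h2⟩ ⟨h3, h4⟩)
  have s4 : ∀ i, 1 ≤ i → i ≤ n → genS n i * genS n i * genS n i * genS n i = 1 := by
    intro i h1 h2
    have := mk_eq_of_relation (INRelation.R1_s (n := n) i ⟨h1, h2⟩)
    simp only [map_pow, map_one, mk_fs] at this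
    rwa [pow_four_eq] at this
  have LL : ∀ i, 1 ≤ i → i + 1 ≤ n → genL n i * genL n i = 1 := by
    intro i h1 h2
    have := mk_eq_of_relation (INRelation.R1_L (n := n) i ⟨h1, h2⟩)
    simp only [map_pow, map_one, mk_fL] at this
    rwa [pow_two] at this
  have Ls : ∀ i j, 1 ≤ i → i + 1 ≤ n → 1 ≤ j → j ≤ n → Commute (genL n i) (genS n j) := by
    intro i j h1 h2 h3 h4
    rw [Commute, SemiconjBy]
    simpa only [map_mul, mk_fs, mk_fL] using
      mk_eq_of_relation (INRelation.R6 (n := n) j i ⟨h3, h4⟩ ⟨h1, h2⟩)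
  refine ⟨by omega, le_rfl, fun i h1 h2 => oneQubit_gen h1 h2, fun i h1 h2 => ?_,
    fun i h1 h2 => ?_, ss, fun i j h1 h2 h3 h4 => ?_, fun i j h1 h2 h3 h4 => ?_, Ls,
    fun i j h1 h2 h3 h4 h5 h6 => ?_, fun j h1 h2 => ?_, fun j h1 h2 => ?_⟩
  · have r1 := mk_eq_of_relation (INRelation.R8 (n := n) i ⟨h1, h2⟩)
    have r2 := mk_eq_of_relation (INRelation.R10 (n := n) i ⟨h1, h2⟩)
    simp only [map_mul, map_pow, mk_fh, mk_fs, mk_fL] at r1 r2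
    have c := ss (i + 1) i (by omega) h2 (by omega) (by omega)
    refine ⟨oneQubit_gen h1 (by omega), s4 _ (by omega) h2, LL i (by omega) h2, c.eq,
      (Ls i (i + 1) (by omega) h2 (by omega) h2).eq,
      (Ls i i (by omega) h2 (by omega) (by omega)).eq, ?_, ?_⟩
    · rw [mul_assoc (genL n i * genH n i), ((c.pow_left 2).pow_right 2).eq] at r1
      simpa only [pow_two, mul_assoc] using r1
    · rw [mul_assoc (genS n i * genH n i * genL n i), c.eq, ← mul_assoc] at r2
      exact r2
  · have r1 := mk_eq_of_relation (INRelation.R9 (n := n) i ⟨h1, h2⟩)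
    have r2 := mk_eq_of_relation (INRelation.R11 (n := n) i ⟨h1, h2⟩)
    simp only [map_mul, map_pow, mk_fh, mk_fs, mk_fL] at r1 r2
    refine ⟨oneQubit_gen (by omega) h2, s4 _ (by omega) (by omega), LL i (by omega) h2,
      (ss i (i + 1) (by omega) (by omega) (by omega) h2).eq,
      (Ls i i (by omega) h2 (by omega) (by omega)).eq,
      (Ls i (i + 1) (by omega) h2 (by omega) h2).eq, ?_, r2⟩
    simpa only [pow_two, mul_assoc] using r1
  · rw [Commute, SemiconjBy]
    simpa only [map_mul, mk_fh] using
      mk_eq_of_relation (INRelation.R5_h (n := n) i j ⟨h1, h2⟩ ⟨h3, h4⟩)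
  · rw [Commute, SemiconjBy]
    simpa only [map_mul, mk_fL] using
      mk_eq_of_relation (INRelation.R5_L (n := n) i j ⟨h1, h2⟩ ⟨h3, h4⟩)
  · rw [Commute, SemiconjBy]
    simpa only [map_mul, mk_fL, mk_fh] using
      mk_eq_of_relation (INRelation.R7 (n := n) j i ⟨h3, h4⟩ ⟨h1, h2⟩ h5 h6)
  · simpa only [map_mul, mk_fL, mk_fh] using
      mk_eq_of_relation (INRelation.R12 (n := n) j ⟨h1, h2⟩)
  · simpa only [map_mul, map_pow, map_one, mk_fL, mk_fh] using
      mk_eq_of_relation (INRelation.R14 (n := n) j ⟨h1, h2⟩)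

theorem isCliffordHom_presentedHom (hn : 2 ≤ n) :
    IsCliffordHom 2 n (genH n) (genS n) (genL n) (presentedHom hn) where
  toCliffordFamily := cliffordFamily_gen n
  map_h i h1 h2 := by rw [genH, dif_pos ⟨h1, h2⟩, presentedHom_of, toClifford_h]
  map_s i h1 h2 := by rw [genS, dif_pos ⟨h1, h2⟩, presentedHom_of, toClifford_s]
  map_L i h1 h2 := by rw [genL, dif_pos ⟨h1, h2⟩, presentedHom_of, toClifford_L]

end

noncomputable section
variable {n : ℕ}

theorem genG_mul_self (n : ℕ) : genG n * genG n = 1 := by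
  have := mk_eq_of_relation (INRelation.Q1 (n := n))
  rw [map_pow, map_one, pow_two] at this
  exact this

/-- The relations Q express each conjugate of a generator by g as a word without g. -/
theorem genG_conj_mem {w : INPresented n} (hw : w ∈ gateGroup n (genH n) (genS n) (genL n) 2 1) :
    genG n * w * genG n ∈ gateGroup n (genH n) (genS n) (genL n) 2 1 := by
  have hg : (genG n)⁻¹ = genG n := inv_eq_of_mul_eq_one_left (genG_mul_self n)
  have hle : gateGroup n (genH n) (genS n) (genL n) 2 1 ≤
      (gateGroup n (genH n) (genS n) (genL n) 2 1).comap (MulAut.conj (genG n)).toMonoidHom := by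
    have hS : ∀ i, 1 ≤ i → i ≤ n → genS n i ∈ gateGroup n (genH n) (genS n) (genL n) 2 1 :=
      fun i h1 h2 => s_mem_gateGroup h1 h2
    have hL : ∀ i, 1 ≤ i → i + 1 ≤ n → genL n i ∈ gateGroup n (genH n) (genS n) (genL n) 2 1 :=
      fun i h1 h2 => L_mem_gateGroup h1 h2
    refine gateGroup_le (fun i h1 h2 => ?_) (fun i h1 h2 => ?_) (fun i h1 h2 => ?_)
    · change genG n * genH n i * (genG n)⁻¹ ∈ gateGroup n (genH n) (genS n) (genL n) 2 1
      have := mk_eq_of_relation (INRelation.Q2 (n := n) i ⟨h1, h2⟩)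
      simp only [map_mul, mk_fh, mk_fg] at this
      rw [hg, this]
      exact h_mem_gateGroup h1 h2
    · change genG n * genS n i * (genG n)⁻¹ ∈ gateGroup n (genH n) (genS n) (genL n) 2 1
      rw [hg]
      by_cases hi : i = 1
      · subst hi
        have := mk_eq_of_relation (INRelation.Q3_first (n := n) h2)
        simp only [map_mul, map_pow, mk_fs, mk_fg] at this
        rw [this]
        exact pow_mem (hS 1 h1 h2) 3
      · have := mk_eq_of_relation (INRelation.Q3 (n := n) i ⟨h1, h2⟩ hi)
        simp only [map_mul, mk_fs, mk_fg] at this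
        rw [this]
        exact hS i h1 h2
    · change genG n * genL n i * (genG n)⁻¹ ∈ gateGroup n (genH n) (genS n) (genL n) 2 1
      rw [hg]
      by_cases hi : i = 1
      · subst hi
        have := mk_eq_of_relation (INRelation.Q4_first (n := n) h2)
        simp only [map_mul, map_pow, mk_fs, mk_fL, mk_fg] at this
        rw [this]
        exact mul_mem (hL 1 h1 h2) (pow_mem (hS 2 (by omega) h2) 2)
      · have := mk_eq_of_relation (INRelation.Q4 (n := n) i ⟨h1, h2⟩ hi)
        simp only [map_mul, mk_fL, mk_fg] at this
        rw [this]
        exact hL i h1 h2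
  have := hle hw
  change genG n * w * (genG n)⁻¹ ∈
        gateGroup n (genH n) (genS n) (genL n) 2 1 at this
  rwa [hg] at this

/-- Every element of the presented group is a word in `h_i`, `s_j`, `Λ_k`, or `g` times one. -/
theorem mem_or_genG_mul_mem (w : INPresented n) :
    w ∈ gateGroup n (genH n) (genS n) (genL n) 2 1 ∨
      genG n * w ∈ gateGroup n (genH n) (genS n) (genL n) 2 1 := by
  have gg := genG_mul_self n
  have cj : ∀ w, w ∈ gateGroup n (genH n) (genS n) (genL n) 2 1 →
      genG n * w * genG n ∈ gateGroup n (genH n) (genS n) (genL n) 2 1 :=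
    fun w hw => genG_conj_mem hw
  have hw : w ∈ Subgroup.closure (Set.range (PresentedGroup.of (rels := inRelators n))) := by
    rw [PresentedGroup.closure_range_of]; trivial
  induction hw using Subgroup.closure_induction with
  | mem x hx =>
    obtain ⟨x, rfl⟩ := hx
    cases x with
    | g => right; change genG n * genG n ∈ _; rw [gg]; exact one_mem _
    | h i hi =>
      left
      have := h_mem_gateGroup (h := genH n) (s := genS n) (L := genL n) (d := 1) hi.1 hi.2
      rwa [genH, dif_pos hi] at this
    | s i hi =>
      left
      have := s_mem_gateGroup (h := genH n) (s := genS n) (L := genL n) (a := 2) hi.1 hi.2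
      rwa [genS, dif_pos hi] at this
    | L i hi =>
      left
      have := L_mem_gateGroup (h := genH n) (s := genS n) (L := genL n) (a := 2) hi.1 hi.2
      rwa [genL, dif_pos hi] at this
  | one => exact Or.inl (one_mem _)
  | mul a b _ _ ha hb =>
    rcases ha with ha | ha <;> rcases hb with hb | hb
    · exact Or.inl (mul_mem ha hb)
    · right
      have := mul_mem (cj a ha) hb
      rwa [mul_assoc, ← mul_assoc (genG n) (genG n), gg, one_mul, mul_assoc] at this
    · right
      have := mul_mem ha hb
      rwa [mul_assoc] at this
    · left
      have := mul_mem (cj _ ha) hb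
      rwa [← mul_assoc (genG n) (genG n) a, gg, one_mul, mul_assoc, ← mul_assoc (genG n) (genG n) b,
        gg, one_mul] at this
  | inv a _ ha =>
    rcases ha with ha | ha
    · exact Or.inl (inv_mem ha)
    · right
      have := cj _ (inv_mem ha)
      rwa [_root_.mul_inv_rev, inv_eq_of_mul_eq_one_left gg, ← mul_assoc, mul_assoc, gg,
        mul_one] at this

theorem presentedHom_genG (hn : 2 ≤ n) : presentedHom hn (genG n) = gG n := by
  rw [genG, presentedHom_of, toClifford_g]

/-- A kernel element w is a word without g, or g w is one. In the second case the image of g w is g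
itself, which is impossible because g negates Z_1. -/
theorem presentedHom_injective (hn : 2 ≤ n) : Function.Injective (presentedHom hn) := by
  have F := isCliffordHom_presentedHom hn
  rw [injective_iff_map_eq_one]
  intro w h1
  rcases mem_or_genG_mul_mem w with hw | hw
  · exact F.injective_of_two_le hn hw h1
  · exfalso
    have := F.map_mem le_rfl le_rfl hw
    rw [map_mul, h1, mul_one, presentedHom_genG] at this
    exact gG_notMem (by omega) this

theorem range_presentedHom (hn : 2 ≤ n) :
    (presentedHom hn).range = clCent (gS n 1 * gS n 1) := by
  rw [centralizer_sq_eq hn, MonoidHom.range_eq_map, ← PresentedGroup.closure_range_of,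
    MonoidHom.map_closure, ← Set.range_comp]
  congr 2
  funext x
  exact presentedHom_of hn x

/-- The presented group is isomorphic to the centralizer of `s_1²`. -/
def presentedEquiv (hn : 2 ≤ n) : INPresented n ≃* clCent (gS n 1 * gS n 1) :=
  ((presentedHom hn).ofInjective (presentedHom_injective hn)).trans
    (MulEquiv.subgroupCongr (range_presentedHom hn))

theorem presentedEquiv_of (hn : 2 ≤ n) (x : INSymbol n) :
    (presentedEquiv hn (PresentedGroup.of x) : ProjClifford n) = x.toClifford hn :=
  presentedHom_of hn x

end

/-! ### The explicit subgroup as a conjugate of the centralizer -/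

noncomputable section
variable {n : ℕ}

/-- The element `h_1 s_1 h_1`, which sends `Z_1` to `-Y_1`. -/
def gU (n : ℕ) : ProjClifford n := gH n 1 * gS n 1 * gH n 1

theorem clM_eq (hn : 2 ≤ n) : clM n hn = gH n 2 * gL n 1 * gS n 2 ^ 2 * gH n 2 * gH n 1 *
    gS n 1 ^ 2 * gH n 2 * gL n 1 * gH n 2 := by
  rw [clM, clH_eq, clH_eq, clS_eq, clS_eq, clL_eq]

/-- Exhibits M as the conjugate by h_1 s_1 h_1 of a word fixing Z_1. The word reduces to Λ_1 s_1³
modulo gates on qubit 2. -/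
theorem clM_mul_gU (hn : 2 ≤ n) : clM n hn * gU n = gU n *
    (gH n 2 * gS n 2 ^ 2 * gL n 1 * gS n 1 ^ 3 * gS n 2 ^ 3 * gH n 2) := by
  have h1 : 1 ≤ 1 := le_rfl
  have h2 : 1 + 1 ≤ n := hn
  have hi : 1 + 1 ≠ 1 := by omega
  have hi' : 1 ≠ 1 + 1 := by omega
  rw [clM_eq, gU]
  change gH n (1 + 1) * gL n 1 * gS n (1 + 1) ^ 2 * gH n (1 + 1) * gH n 1 * gS n 1 ^ 2 *
      gH n (1 + 1) * gL n 1 * gH n (1 + 1) * (gH n 1 * gS n 1 * gH n 1) =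
    gH n 1 * gS n 1 * gH n 1 * (gH n (1 + 1) * gS n (1 + 1) ^ 2 * gL n 1 * gS n 1 ^ 3 *
      gS n (1 + 1) ^ 3 * gH n (1 + 1))
  refine cliffAct_ext_pair 1 ?_ ?_ ?_ ?_ (fun j h5 h6 => ?_) (fun j h5 h6 => ?_)
  iterate 4 simp only [pow_succ, pow_zero, one_mul, cliffAct_mul, act_gH_X, act_gH_Z,
      act_gH_Y h1 (by omega : 1 ≤ n), act_gH_Y (by omega : 1 ≤ 1 + 1) h2,
      act_gS_X, act_gS_Z, act_gS_Y h1 (by omega : 1 ≤ n), act_gS_Y (by omega : 1 ≤ 1 + 1) h2,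
      cliffAct_neg, neg_neg, act_gH_mul, act_gS_mul, mul_neg_unitary, neg_mul_unitary,
      act_gH_X_ne hi, act_gH_Z_ne hi, act_gS_X_ne hi, act_gH_X_ne hi', act_gH_Z_ne hi',
      act_gS_X_ne hi', act_gS_Y_ne h1 (by omega : 1 ≤ n) hi,
      act_gS_Y_ne (by omega : 1 ≤ 1 + 1) h2 hi', act_gH_Y_ne h1 (by omega : 1 ≤ n) hi,
      act_gH_Y_ne (by omega : 1 ≤ 1 + 1) h2 hi',
      act_gL_X h1 h2, act_gL_X_succ' h1 h2, act_gL_Y h1 h2, act_gL_Y_succ h1 h2,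
      act_gL_YZ h1 h2, act_gL_XX h1 h2, act_gL_ZZ, act_gL_Z]
  iterate 2 simp only [pow_succ, pow_zero, one_mul, cliffAct_mul, act_gL_Z, act_gS_Z,
      act_gH_X_ne h6, act_gH_Z_ne h6, act_gH_X_ne h5, act_gH_Z_ne h5,
      act_gS_X_ne h5, act_gS_X_ne h6, act_gL_X_ne h5.symm h6.symm]

/-- Conjugation by h s h sends s times the bit flip to h, which accounts for the generator h_1. -/
theorem OneQubit.conj_mul {Γ : Type*} [Group Γ] {s h : Γ} (H : OneQubit s h) :
    h * s * h * (s * (h * s * s * h)) = h * (h * s * h) := by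
  obtain ⟨hh, ss, sh⟩ := H
  grind (acSteps := 1000000)

/-- The bit flip is the square of h s h, so the two commute. -/
theorem OneQubit.conj_comm {Γ : Type*} [Group Γ] {s h : Γ} (H : OneQubit s h) :
    h * s * h * (h * s * s * h) = h * s * s * h * (h * s * h) := by
  obtain ⟨hh, ss, sh⟩ := H
  grind (acSteps := 1000000)

/-- Conjugation by `h_1 s_1 h_1`. -/
def conjU (n : ℕ) : ProjClifford n →* ProjClifford n := (MulAut.conj (gU n)).toMonoidHom

theorem conjU_eq_of {x y : ProjClifford n} (h : gU n * x = y * gU n) : conjU n x = y :=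
  mul_inv_eq_of_eq_mul h

theorem conjU_of_mem (hn : 1 ≤ n) {w : ProjClifford n} (hw : w ∈ cliffGates n 2 2) :
    conjU n w = w := by
  have F := cliffordFamily_gates n
  have c1 := F.commute_h (d := 1) le_rfl hn hw
  have c2 := F.commute_s (d := 1) le_rfl hn (gateGroup_mono le_rfl (by omega) hw)
  exact conjU_eq_of ((c1.mul_right c2).mul_right c1).symm

/-- The bit flip of qubit 1. -/
def gFlip (n : ℕ) : ProjClifford n := gH n 1 * gS n 1 * gS n 1 * gH n 1

theorem conjU_gFlip (hn : 1 ≤ n) : conjU n (gFlip n) = gFlip n :=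
  conjU_eq_of (oneQubit_gates le_rfl hn).conj_comm

theorem conjU_s_mul_gFlip (hn : 1 ≤ n) : conjU n (gS n 1 * gFlip n) = gH n 1 :=
  conjU_eq_of (oneQubit_gates le_rfl hn).conj_mul

theorem conjU_M (hn : 2 ≤ n) :
    conjU n (gH n 2 * gS n 2 ^ 2 * gL n 1 * gS n 1 ^ 3 * gS n 2 ^ 3 * gH n 2) = clM n hn :=
  conjU_eq_of (clM_mul_gU hn).symm

theorem gFlip_mem (hn : 1 ≤ n) : gFlip n ∈ clCent (gS n 1 * gS n 1) :=
  (mem_centralizer_sq hn).2 (Or.inr (act_xWord le_rfl hn))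

theorem explicitIN_le (hn : 2 ≤ n) :
    explicitIN n hn ≤ (clCent (gS n 1 * gS n 1)).map (conjU n) := by
  have hK := cliffGates_le (n := n) (by omega)
  have hS : ∀ i, 1 ≤ i → i ≤ n → gS n i ∈ cliffGates n 2 1 := fun i h1 h2 => s_mem_gateGroup h1 h2
  have hH : ∀ i, 2 ≤ i → i ≤ n → gH n i ∈ cliffGates n 2 1 := fun i h1 h2 => h_mem_gateGroup h1 h2
  rw [explicitIN, Subgroup.closure_le]
  rintro x ((((⟨i, hi, rfl⟩ | ⟨i, hi, rfl⟩) | rfl) | ⟨i, hi, rfl⟩) | ⟨-, rfl⟩)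
  · rw [clH_eq]
    by_cases h1 : i = 1
    · subst h1
      exact ⟨_, mul_mem (hK (hS 1 le_rfl hi.2)) (gFlip_mem hi.2), conjU_s_mul_gFlip hi.2⟩
    · exact ⟨_, hK (hH i (by omega) hi.2),
        conjU_of_mem (by omega) (h_mem_gateGroup (by omega) hi.2)⟩
  · rw [clS_eq]
    exact ⟨_, hK (hS i (by omega) hi.2), conjU_of_mem (by omega) (s_mem_gateGroup (by omega) hi.2)⟩
  · refine ⟨_, hK ?_, conjU_M hn⟩
    exact mul_mem (mul_mem (mul_mem (mul_mem (mul_mem (hH 2 le_rfl hn)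
      (pow_mem (hS 2 (by omega) hn) 2)) (L_mem_gateGroup le_rfl hn))
      (pow_mem (hS 1 le_rfl (by omega)) 3)) (pow_mem (hS 2 (by omega) hn) 3)) (hH 2 le_rfl hn)
  · rw [clL_eq]
    exact ⟨_, hK (L_mem_gateGroup (by omega) hi.2),
      conjU_of_mem (by omega) (L_mem_gateGroup (by omega) hi.2)⟩
  · rw [clH_eq, clS_eq, pow_two, ← mul_assoc]
    exact ⟨_, gFlip_mem (by omega), conjU_gFlip (by omega)⟩

/-- If `(c L)³ = 1`, `s⁴ = 1` and `s` commutes with `c` and `L`, then `(c L s³)³ = s`. -/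
theorem cube_mul_eq {Γ : Type*} [Group Γ] {c L s : Γ} (h : (c * L) ^ 3 = 1)
    (hs : s * s * s * s = 1) (h1 : Commute s c) (h2 : Commute s L) : (c * L * s ^ 3) ^ 3 = s := by
  have h4 : s ^ 4 = 1 := by rw [pow_four_eq, hs]
  have hc : Commute (c * L) (s ^ 3) := ((h1.mul_right h2).pow_left 3).symm
  rw [hc.mul_pow, h, one_mul, ← pow_mul, show 3 * 3 = 4 + 4 + 1 by rfl, pow_add, pow_add, h4]
  simp only [pow_one, one_mul]

theorem le_explicitIN (hn : 2 ≤ n) :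
    clCent (gS n 1 * gS n 1) ≤ (explicitIN n hn).comap (conjU n) := by
  have F := cliffordFamily_gates n
  set E := (explicitIN n hn).comap (conjU n) with hE
  have hH1 : gS n 1 * gFlip n ∈ E := by
    rw [hE, Subgroup.mem_comap, conjU_s_mul_gFlip (by omega), ← clH_eq ⟨le_rfl, by omega⟩]
    exact Subgroup.subset_closure (Or.inl (Or.inl (Or.inl (Or.inl ⟨1, ⟨le_rfl, by omega⟩, rfl⟩))))
  have hH : ∀ i, 2 ≤ i → i ≤ n → gH n i ∈ E := by
    intro i h1 h2
    rw [hE, Subgroup.mem_comap, conjU_of_mem (by omega) (h_mem_gateGroup h1 h2),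
      ← clH_eq ⟨by omega, h2⟩]
    exact Subgroup.subset_closure (Or.inl (Or.inl (Or.inl (Or.inl ⟨i, ⟨by omega, h2⟩, rfl⟩))))
  have hS : ∀ i, 2 ≤ i → i ≤ n → gS n i ∈ E := by
    intro i h1 h2
    rw [hE, Subgroup.mem_comap, conjU_of_mem (by omega) (s_mem_gateGroup h1 h2),
      ← clS_eq ⟨by omega, h2⟩]
    exact Subgroup.subset_closure (Or.inl (Or.inl (Or.inl (Or.inr ⟨i, ⟨h1, h2⟩, rfl⟩))))
  have hL : ∀ i, 2 ≤ i → i + 1 ≤ n → gL n i ∈ E := by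
    intro i h1 h2
    rw [hE, Subgroup.mem_comap, conjU_of_mem (by omega) (L_mem_gateGroup h1 h2),
      ← clL_eq ⟨by omega, h2⟩]
    exact Subgroup.subset_closure (Or.inl (Or.inr ⟨i, ⟨h1, h2⟩, rfl⟩))
  -- Cancelling the gates of qubit 2 from the preimage of M leaves Λ_1 s_1³.
  have hN : gL n 1 * gS n 1 ^ 3 ∈ E := by
    have hM : gH n 2 * gS n 2 ^ 2 * gL n 1 * gS n 1 ^ 3 * gS n 2 ^ 3 * gH n 2 ∈ E := by
      rw [hE, Subgroup.mem_comap, conjU_M hn]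
      exact Subgroup.subset_closure (Or.inl (Or.inl (Or.inr rfl)))
    have h2 := hH 2 le_rfl hn
    have s2 := hS 2 le_rfl hn
    rwa [Subgroup.mul_mem_cancel_right _ h2, Subgroup.mul_mem_cancel_right _ (pow_mem s2 3),
      mul_assoc, Subgroup.mul_mem_cancel_left _ (mul_mem h2 (pow_mem s2 2))] at hM
  have hs1 : gS n 1 ∈ E := by
    -- To separate s_1 from the bit flip: for n = 2 the flip is an extra generator; for n ≥ 3 the
    -- cube of c Λ_1 s_1³ is s_1, because (c Λ_1)³ = 1 is R14.
    rcases (show n = 2 ∨ 3 ≤ n by omega) with h | h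
    · have hX : gFlip n ∈ E := by
        rw [hE, Subgroup.mem_comap, conjU_gFlip (by omega)]
        refine Subgroup.subset_closure (Or.inr ⟨h, ?_⟩)
        rw [clH_eq, clS_eq, pow_two, ← mul_assoc, gFlip]
      rwa [Subgroup.mul_mem_cancel_right _ hX] at hH1
    · have hc : gL n 2 * gH n 3 * gH n 2 * gL n 2 * gH n 3 * gH n 2 ∈ E :=
        mul_mem (mul_mem (mul_mem (mul_mem (mul_mem (hL 2 le_rfl h) (hH 3 (by omega) h))
          (hH 2 le_rfl hn)) (hL 2 le_rfl h)) (hH 3 (by omega) h)) (hH 2 le_rfl hn)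
      have hm : gL n 2 * gH n 3 * gH n 2 * gL n 2 * gH n 3 * gH n 2 ∈ cliffGates n 2 1 := by
        have h2 : gH n 2 ∈ cliffGates n 2 1 := h_mem_gateGroup le_rfl hn
        have h3 : gH n 3 ∈ cliffGates n 2 1 := h_mem_gateGroup (by omega) h
        have L2 : gL n 2 ∈ cliffGates n 2 1 := L_mem_gateGroup (by omega) h
        exact mul_mem (mul_mem (mul_mem (mul_mem (mul_mem L2 h3) h2) L2) h3) h2
      have := cube_mul_eq (F.cube 1 le_rfl h) (F.one 1 le_rfl (by omega)).ss
        (F.commute_s le_rfl (by omega) hm).symm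
        (F.commute_s le_rfl (by omega) (L_mem_gateGroup le_rfl hn)).symm
      rw [← this, mul_assoc]
      exact pow_mem (mul_mem hc hN) 3
  have hX : gFlip n ∈ E := by rwa [Subgroup.mul_mem_cancel_left _ hs1] at hH1
  have hL1 : gL n 1 ∈ E := by rwa [Subgroup.mul_mem_cancel_right _ (pow_mem hs1 3)] at hN
  have hK : cliffGates n 2 1 ≤ E := by
    refine gateGroup_le hH (fun i h1 h2 => ?_) (fun i h1 h2 => ?_) <;> by_cases hi : i = 1
    · rwa [hi]
    · exact hS i (by omega) h2
    · rwa [hi]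
    · exact hL i (by omega) h2
  intro w hw
  rcases (mem_centralizer_sq (by omega)).1 hw with h | h
  · rw [← mem_fixer, fixer_pZ (by omega)] at h
    exact hK h
  -- The flip, like g, negates Z_1, so it represents the other coset.
  · have : gFlip n * w ∈ cliffGates n 2 1 := by
      rw [← fixer_pZ (by omega), mem_fixer, cliffAct_mul, h, cliffAct_neg, gFlip,
        act_xWord le_rfl (by omega), neg_neg]
    have := hK this
    rwa [Subgroup.mul_mem_cancel_left _ hX] at this

theorem map_conjU (hn : 2 ≤ n) : (clCent (gS n 1 * gS n 1)).map (conjU n) = explicitIN n hn :=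
  le_antisymm (Subgroup.map_le_iff_le_comap.2 (le_explicitIN hn)) (explicitIN_le hn)

/-- The explicit subgroup is isomorphic to the centralizer of `s_1²` by conjugation. -/
def explicitEquiv (hn : 2 ≤ n) : explicitIN n hn ≃* clCent (gS n 1 * gS n 1) :=
  (((clCent (gS n 1 * gS n 1)).equivMapOfInjective (conjU n) (MulAut.conj (gU n)).injective).trans
    (MulEquiv.subgroupCongr (map_conjU hn))).symm

end

/-! ### Commutation signs of Pauli operators -/

noncomputable section
variable {n d i j : ℕ}

/-- The operators `P` and `Q` commute if `a` holds and anticommute otherwise. -/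
def SignComm (a : Prop) (P Q : UnitaryN n) : Prop :=
  (a → P * Q = Q * P) ∧ (¬a → P * Q = -(Q * P))

namespace SignComm
variable {a b : Prop} {P Q R : UnitaryN n}

theorem right_neg (h : SignComm a P Q) : SignComm a P (-Q) := by
  simpa only [SignComm, neg_mul, mul_neg, neg_inj] using h

theorem mul_right (hQ : SignComm a P Q) (hR : Commute P R) : SignComm a P (Q * R) := by
  refine ⟨fun h => ?_, fun h => ?_⟩
  · rw [← mul_assoc, hQ.1 h, mul_assoc, hR.eq, mul_assoc]
  · rw [← mul_assoc, hQ.2 h, neg_mul, mul_assoc, hR.eq, mul_assoc]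

theorem mul_right' (hQ : Commute P Q) (hR : SignComm a P R) : SignComm a P (Q * R) := by
  refine ⟨fun h => ?_, fun h => ?_⟩
  · rw [← mul_assoc, hQ.eq, mul_assoc, hR.1 h, mul_assoc]
  · rw [← mul_assoc, hQ.eq, mul_assoc, hR.2 h, mul_neg, mul_assoc]

/-- Signs multiply, which for the propositions "commutes" is equivalence. -/
theorem mul_left (hP : SignComm a P R) (hQ : SignComm b Q R) : SignComm (a ↔ b) (P * Q) R := by
  by_cases h1 : a <;> by_cases h2 : b <;>
    simp only [SignComm, h1, h2, true_imp_iff, not_true, not_false_eq_true, iff_self, iff_false,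
      iff_true, false_imp_iff, and_true, true_and] at *
  · rw [mul_assoc, hQ, ← mul_assoc, hP, mul_assoc]
  · rw [mul_assoc, hQ, mul_neg, ← mul_assoc, hP, mul_assoc]
  · rw [mul_assoc, hQ, ← mul_assoc, hP, neg_mul, mul_assoc]
  · rw [mul_assoc, hQ, mul_neg, ← mul_assoc, hP, neg_mul, neg_neg, mul_assoc]

theorem inv_left (hP : SignComm a P Q) : SignComm a P⁻¹ Q := by
  refine ⟨fun h => ?_, fun h => ?_⟩
  · rw [inv_mul_eq_iff_eq_mul, ← mul_assoc, hP.1 h, mul_inv_cancel_right]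
  · rw [inv_mul_eq_iff_eq_mul, mul_neg, ← mul_assoc, hP.2 h, neg_mul, neg_neg,
      mul_inv_cancel_right]

theorem commute_mul (hQ : SignComm a P Q) (hR : SignComm a P R) : Commute (Q * R) P := by
  by_cases h : a
  · have h1 : Commute P Q := hQ.1 h
    exact (h1.mul_right (hR.1 h)).symm
  · rw [Commute, SemiconjBy, mul_assoc, ← neg_inj, ← mul_neg, ← hR.2 h, ← mul_assoc,
      ← neg_eq_iff_eq_neg.2 (hQ.2 h), neg_mul, mul_assoc]

theorem map (h : SignComm a P Q) (u : ProjClifford n) :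
    SignComm a (cliffAct n u P) (cliffAct n u Q) := by
  refine ⟨fun ha => ?_, fun ha => ?_⟩
  · rw [← cliffAct_map_mul, h.1 ha, cliffAct_map_mul]
  · rw [← cliffAct_map_mul, h.2 ha, cliffAct_neg, cliffAct_map_mul]

theorem iff_of (hP : SignComm a P Q) (hQ : SignComm b P Q) : a ↔ b := by
  by_cases h1 : a <;> by_cases h2 : b <;> simp only [h1, h2, iff_false, iff_true, not_true]
  · have := hP.1 h1
    rw [hQ.2 h2] at this
    exact unitaryN_neg_ne _ this
  · have := hQ.1 h2
    rw [hP.2 h1] at this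
    exact unitaryN_neg_ne _ this

theorem of_commute (h : Commute P Q) : SignComm True P Q := ⟨fun _ => h, fun h => absurd trivial h⟩

theorem congr (h : SignComm a P Q) (hab : a ↔ b) : SignComm b P Q := by rwa [← hab]

end SignComm

theorem signComm_pauli {P Q : UnitaryN n} (hP : P ∈ PauliGroup n) (hQ : Q ∈ PauliGroup n) :
    ∃ a, SignComm a P Q := by
  -- Fixing the second argument, it suffices to know generators in the first; this is applied twice,
  -- exchanging the roles.
  have key : ∀ Q : UnitaryN n, (∀ i, 1 ≤ i → i ≤ n → ∃ a, SignComm a (pX n i) Q) →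
      (∀ i, 1 ≤ i → i ≤ n → ∃ a, SignComm a (pZ n i) Q) →
      ∀ P ∈ PauliGroup n, ∃ a, SignComm a P Q := by
    intro Q hX hZ P hP
    let S : Subgroup (UnitaryN n) :=
      { carrier := {P | ∃ a, SignComm a P Q}
        one_mem' := ⟨True, .of_commute (Commute.one_left Q)⟩
        mul_mem' := fun ⟨_, ha⟩ ⟨_, hb⟩ => ⟨_, ha.mul_left hb⟩
        inv_mem' := fun ⟨_, ha⟩ => ⟨_, ha.inv_left⟩ }
    rw [← pauliFrom_one] at hP
    exact (pauliFrom_le (S := S) hX hZ ⟨True, .of_commute (commute_phaseI Q).symm⟩) hP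
  have symm : ∀ {P Q : UnitaryN n} {a}, SignComm a P Q → SignComm a Q P := fun h =>
    ⟨fun ha => (h.1 ha).symm, fun ha => by rw [h.2 ha, neg_neg]⟩
  have hXZ : ∀ i j, 1 ≤ i → i ≤ n → ∃ a, SignComm a (pX n i) (pZ n j) := by
    intro i j h1 h2
    by_cases hij : i = j
    · exact ⟨False, fun h => h.elim, fun _ => by rw [← hij, pX_mul_pZ h1 h2]⟩
    · exact ⟨True, .of_commute (pX_comm_pZ hij)⟩
  refine key Q (fun i h1 h2 => ?_) (fun i h1 h2 => ?_) P hP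
  · obtain ⟨a, ha⟩ := key (pX n i) (fun j _ _ => ⟨True, .of_commute pX_comm_pX⟩)
      (fun j _ _ => let ⟨a, ha⟩ := hXZ i j h1 h2; ⟨a, symm ha⟩) Q hQ
    exact ⟨a, symm ha⟩
  · obtain ⟨a, ha⟩ := key (pZ n i) (fun j h3 h4 => hXZ j i h3 h4)
      (fun j _ _ => ⟨True, .of_commute pZ_comm_pZ⟩) Q hQ
    exact ⟨a, symm ha⟩

/-- A Pauli operator can be chosen to commute or anticommute with the `X_i` and the `Z_i` in any
prescribed way. -/
theorem exists_signComm (a b : ℕ → Prop) (m : ℕ) : ∀ d, 1 ≤ d → d + m = n + 1 →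
    ∃ Q ∈ pauliFrom n d, Q * Q = 1 ∧ (∀ i, d ≤ i → i ≤ n → SignComm (a i) (pX n i) Q) ∧
      ∀ i, d ≤ i → i ≤ n → SignComm (b i) (pZ n i) Q := by
  induction m with
  | zero =>
    intro d h1 h2
    exact ⟨1, one_mem _, one_mul _, fun i h3 h4 => by omega, fun i h3 h4 => by omega⟩
  | succ m ih =>
    intro d h1 h2
    have hd : d ≤ n := by omega
    obtain ⟨Q, hQ, hQQ, hX, hZ⟩ := ih (d + 1) (by omega) (by omega)
    have hXY : pX n d * pY n d = -(pY n d * pX n d) := by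
      rw [pY_eq h1 hd, mul_assoc, mul_assoc, ← mul_assoc (pX n d),
        ((commute_phaseI _).inv_right).eq, mul_assoc, ← mul_assoc (pX n d),
        mul_assoc (pX n d) (pZ n d), ← neg_eq_iff_eq_neg.2 (pX_mul_pZ h1 hd), mul_neg, mul_neg,
        neg_neg, ← mul_assoc (pX n d)]
    -- The four sign patterns on qubit d are realized by 1, X, Z and Y.
    have hA : ∃ A ∈ pauliFrom n d, A * A = 1 ∧ Commute A Q ∧
        (∀ i, d + 1 ≤ i → i ≤ n → Commute (pX n i) A ∧ Commute (pZ n i) A) ∧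
        SignComm (a d) (pX n d) A ∧ SignComm (b d) (pZ n d) A := by
      have cX : ∀ i, d + 1 ≤ i → i ≤ n → Commute (pX n i) (pX n d) ∧ Commute (pZ n i) (pX n d) :=
        fun i h3 h4 => ⟨pX_comm_pX, (pX_comm_pZ (by omega)).symm⟩
      have cZ : ∀ i, d + 1 ≤ i → i ≤ n → Commute (pX n i) (pZ n d) ∧ Commute (pZ n i) (pZ n d) :=
        fun i h3 h4 => ⟨pX_comm_pZ (by omega), pZ_comm_pZ⟩
      by_cases ha : a d <;> by_cases hb : b d
      · exact ⟨1, one_mem _, one_mul _, Commute.one_left _,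
          fun i _ _ => ⟨Commute.one_right _, Commute.one_right _⟩,
          (SignComm.of_commute (Commute.one_right _)).congr (by simp only [ha]),
          (SignComm.of_commute (Commute.one_right _)).congr (by simp only [hb])⟩
      · exact ⟨pX n d, pX_mem le_rfl hd, mul_self_pX, (commute_pX hQ).symm, cX,
          (SignComm.of_commute (Commute.refl _)).congr (by simp only [ha]),
          fun h => absurd h hb, fun _ => by rw [pX_mul_pZ h1 hd, neg_neg]⟩
      · exact ⟨pZ n d, pZ_mem le_rfl hd, mul_self_pZ, (commute_pZ hQ).symm, cZ,
          ⟨fun h => absurd h ha, fun _ => pX_mul_pZ h1 hd⟩,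
          (SignComm.of_commute (Commute.refl _)).congr (by simp only [hb])⟩
      · refine ⟨pY n d, pY_mem h1 le_rfl hd, mul_self_pY, (commute_pY h1 hd hQ).symm,
          fun i h3 h4 => ?_, ⟨fun h => absurd h ha, fun _ => hXY⟩,
          ⟨fun h => absurd h hb, fun _ => by rw [pY_mul_pZ h1 hd, neg_neg]⟩⟩
        exact ⟨commute_pY h1 hd (pX_mem h3 h4), commute_pY h1 hd (pZ_mem h3 h4)⟩
    obtain ⟨A, hA, hAA, hAQ, hc, hAX, hAZ⟩ := hA
    refine ⟨A * Q, mul_mem hA (pauliFrom_mono (by omega) hQ), ?_, fun i h3 h4 => ?_,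
      fun i h3 h4 => ?_⟩
    · rw [hAQ.symm.mul_mul_mul_comm, hAA, hQQ, one_mul]
    · rcases h3.eq_or_lt with rfl | h3
      · exact hAX.mul_right (commute_pX hQ).symm
      · exact (hX i h3 h4).mul_right' (hc i h3 h4).1
    · rcases h3.eq_or_lt with rfl | h3
      · exact hAZ.mul_right (commute_pZ hQ).symm
      · exact (hZ i h3 h4).mul_right' (hc i h3 h4).2

/-- Two Pauli involutions whose product is central agree up to sign. -/
theorem eq_or_eq_neg_of_commute {P Q : UnitaryN n} (hP : P ∈ PauliGroup n) (hQ : Q ∈ PauliGroup n)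
    (hPP : P * P = 1) (hQQ : Q * Q = 1) (hc : ∀ R ∈ PauliGroup n, Commute (Q * P) R) :
    P = Q ∨ P = -Q := by
  have hm : Q * P ∈ pauliFrom n (n + 1) :=
    mem_pauliFrom_of_commute (mul_mem hQ hP) n le_rfl
      (fun i h1 h2 => hc _ (by rw [← pauliFrom_one]; exact pX_mem h1 h2))
      (fun i h1 h2 => hc _ (by rw [← pauliFrom_one]; exact pZ_mem h1 h2))
  have hPe : P = Q * (Q * P) := by rw [← mul_assoc, hQQ, one_mul]
  have hc' := hc Q hQ
  generalize Q * P = R at *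
  have hRR : R * R = 1 := mul_self_of_mul_commute hQQ hc'.symm (by rwa [← hPe])
  rcases eq_one_or_of_mem_from_succ hm hRR with rfl | rfl
  · left; rw [hPe, mul_one]
  · right; rw [hPe, mul_neg, mul_one]

end

/-! ### Representations of the projective Pauli group and inertia -/

noncomputable section
variable {n : ℕ}

theorem pauliGroup_le : PauliGroup n ≤ CliffordGroup n := Subgroup.le_normalizer

/-- The class in the projective Pauli group of a Pauli operator. -/
def pauliClass (P : UnitaryN n) (hP : P ∈ PauliGroup n) : ProjPauli n :=
  ⟨projClass P (pauliGroup_le hP), ⟨⟨P, pauliGroup_le hP⟩, hP, rfl⟩⟩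

theorem exists_pauliClass (q : ProjPauli n) : ∃ P hP, q = pauliClass P hP := by
  obtain ⟨q, ⟨P, hP⟩, hq, e⟩ := q
  exact ⟨P, hq, Subtype.ext (MulOpposite.unop_injective e.symm)⟩

theorem pauliClass_mul {P Q : UnitaryN n} (hP : P ∈ PauliGroup n) (hQ : Q ∈ PauliGroup n) :
    pauliClass (P * Q) (mul_mem hP hQ) = pauliClass Q hQ * pauliClass P hP := rfl

/-- Conjugating by P changes a Pauli operator by a sign, so doing it twice acts trivially. -/
theorem pauliClass_mul_self {P : UnitaryN n} (hP : P ∈ PauliGroup n) :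
    pauliClass P hP * pauliClass P hP = 1 := by
  have act : ∀ {Q}, Q ∈ PauliGroup n →
      cliffAct n (projClass P (pauliGroup_le hP) * projClass P (pauliGroup_le hP)) Q = Q := by
    intro Q hQ
    obtain ⟨a, ha⟩ := signComm_pauli hQ hP
    rw [cliffAct_mul, cliffAct_projClass, cliffAct_projClass]
    by_cases h : a
    · rw [mul_assoc _ Q, ha.1 h, inv_mul_cancel_left, mul_assoc, ha.1 h, inv_mul_cancel_left]
    · rw [mul_assoc _ Q, ha.2 h, mul_neg, inv_mul_cancel_left, mul_neg, neg_mul, mul_assoc,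
        ha.2 h, mul_neg, neg_neg, inv_mul_cancel_left]
  refine Subtype.ext (cliffAct_ext (fun i h1 h2 => ?_) (fun i h1 h2 => ?_)) <;>
    refine (act ?_).trans (cliffAct_one _).symm <;> rw [← pauliFrom_one]
  · exact pX_mem h1 h2
  · exact pZ_mem h1 h2

theorem pauliClass_phaseI : pauliClass (phaseI n) (phaseI_mem n) = 1 := by
  refine Subtype.ext (cliffAct_ext (fun i _ _ => ?_) (fun i _ _ => ?_)) <;>
    refine (cliffAct_projClass _ _ _).trans ?_ <;>
    rw [mul_assoc, phaseI_comm, inv_mul_cancel_left] <;> exact (cliffAct_one _).symm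

theorem projPauli_mul_self (q : ProjPauli n) : q * q = 1 := by
  obtain ⟨P, hP, rfl⟩ := exists_pauliClass q
  exact pauliClass_mul_self hP

theorem projPauli_comm (p q : ProjPauli n) : p * q = q * p := by
  have h : ∀ r : ProjPauli n, r⁻¹ = r := fun r => inv_eq_of_mul_eq_one_left (projPauli_mul_self r)
  rw [← h (p * q), _root_.mul_inv_rev, h, h]

/-- Conjugation in the projective Clifford group and the action on Pauli operators. -/
theorem conjNormal_pauliClass (c : ProjClifford n) {P : UnitaryN n} (hP : P ∈ PauliGroup n) :
    MulAut.conjNormal c (pauliClass P hP) =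
      pauliClass (cliffAct n c P) (cliffAct_mem_pauliGroup c hP) := by
  obtain ⟨U, hU, rfl⟩ := exists_projClass c
  refine Subtype.ext ?_
  rw [MulAut.conjNormal_apply]
  have h : cliffAct n (projClass U hU) P = U⁻¹ * (P * U) := by
    rw [cliffAct_projClass, mul_assoc]
  simp only [pauliClass, h]
  rfl

section Representation
variable {V : Type*} [AddCommGroup V] [Module ℂ V] {ρ : Representation ℂ (ProjPauli n) V}

/-- In an irreducible representation the elements of the projective Pauli group act as signs. -/
theorem representation_eq_one_or (hρ : ρ.IsIrreducible) (q : ProjPauli n) : ρ q = 1 ∨ ρ q = -1 := by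
  -- The group is commutative, so the fixed space of ρ q is invariant.
  let W : Subrepresentation ρ :=
    { toSubmodule := LinearMap.ker (ρ q - 1)
      apply_mem_toSubmodule := fun p v hv => by
        rw [LinearMap.mem_ker, LinearMap.sub_apply, sub_eq_zero] at hv ⊢
        change ρ q (ρ p v) = ρ p v
        change ρ q v = v at hv
        rw [← Module.End.mul_apply, ← map_mul, projPauli_comm, map_mul, Module.End.mul_apply, hv] }
  rcases hρ.eq_bot_or_eq_top W with h | h
  · right
    refine LinearMap.ext fun v => ?_
    -- As q² = 1, this vector is fixed; if no nonzero vector is fixed, ρ q = -1.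
    have hv : v + ρ q v ∈ W.toSubmodule := by
      change _ ∈ LinearMap.ker (ρ q - 1)
      rw [LinearMap.mem_ker, LinearMap.sub_apply, map_add, ← Module.End.mul_apply, ← map_mul,
        projPauli_mul_self, map_one, Module.End.one_apply, Module.End.one_apply, add_comm, sub_self]
    rw [h] at hv
    have hv0 : v + ρ q v = 0 := hv
    rw [LinearMap.neg_apply, Module.End.one_apply]
    exact (neg_eq_of_add_eq_zero_right hv0).symm
  · left
    refine LinearMap.ext fun v => ?_
    have hv : v ∈ W.toSubmodule := by rw [h]; exact Submodule.mem_top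
    have : (ρ q - 1) v = 0 := hv
    rwa [LinearMap.sub_apply, sub_eq_zero] at this

/-- Over ℂ, 1 = -1 forces V = 0, where ρ would be trivial. -/
theorem one_ne_neg_one_of_ne {p : ProjPauli n} (hp : ρ p ≠ 1) :
    (1 : Module.End ℂ V) ≠ -1 := by
  intro h
  refine hp (LinearMap.ext fun v => ?_)
  have h2 : ∀ w : V, w = 0 := fun w => by
    have : w = -w := LinearMap.congr_fun h w
    have h3 : (2 : ℂ) • w = 0 := by rw [two_smul]; nth_rewrite 1 [this]; exact neg_add_cancel w
    exact (smul_eq_zero.1 h3).resolve_left two_ne_zero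
  rw [h2 (ρ p v), h2 ((1 : Module.End ℂ V) v)]

/-- Every intertwiner commutes with ±1, so isomorphism with the conjugate means equality. -/
theorem mem_inertiaSubgroup_iff (hρ : ρ.IsIrreducible) {c : ProjClifford n} :
    c ∈ inertiaSubgroup ρ ↔ ∀ q, ρ (MulAut.conjNormal c q) = ρ q := by
  constructor
  · rintro ⟨e, he⟩ q
    refine LinearMap.ext fun v => ?_
    obtain ⟨v, rfl⟩ := e.surjective v
    rw [← he]
    rcases representation_eq_one_or hρ q with h | h <;> rw [h]
    · rfl
    · exact map_neg e v
  · intro h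
    exact ⟨LinearEquiv.refl ℂ V, fun q v => by rw [h]; rfl⟩

/-- The characters of the projective Pauli group are given by commutation with Pauli operators. -/
theorem exists_signComm_representation (hρ : ρ.IsIrreducible) (hne : ∃ p, ρ p ≠ 1) :
    ∃ Q ∈ PauliGroup n, Q * Q = 1 ∧ ∀ P hP, SignComm (ρ (pauliClass P hP) = 1) P Q := by
  obtain ⟨p, hp⟩ := hne
  have h1 := one_ne_neg_one_of_ne hp
  obtain ⟨Q, hQ, hQQ, hX, hZ⟩ := exists_signComm (n := n)
    (fun i => ∃ h : pX n i ∈ PauliGroup n, ρ (pauliClass _ h) = 1)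
    (fun i => ∃ h : pZ n i ∈ PauliGroup n, ρ (pauliClass _ h) = 1) n 1 le_rfl (by omega)
  rw [pauliFrom_one] at hQ
  refine ⟨Q, hQ, hQQ, fun P hP => ?_⟩
  -- Both the sign of ρ and the commutation sign with Q are multiplicative, so agreement on the X_i,
  -- Z_i and the phase extends to all Pauli operators.
  let S : Subgroup (UnitaryN n) :=
    { carrier := {P | ∃ hP : P ∈ PauliGroup n, SignComm (ρ (pauliClass P hP) = 1) P Q}
      one_mem' := ⟨one_mem _, (SignComm.of_commute (Commute.one_left Q)).congr
        (iff_of_true trivial (map_one ρ))⟩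
      mul_mem' := by
        rintro A B ⟨hA, hA'⟩ ⟨hB, hB'⟩
        refine ⟨mul_mem hA hB, (hA'.mul_left hB').congr ?_⟩
        rw [pauliClass_mul hA hB, map_mul]
        rcases representation_eq_one_or hρ (pauliClass A hA) with h | h <;>
          rcases representation_eq_one_or hρ (pauliClass B hB) with h' | h' <;> rw [h, h'] <;>
          simp only [mul_one, mul_neg, neg_neg, h1.symm, iff_self, iff_false, iff_true, not_true]
      inv_mem' := by
        rintro A ⟨hA, hA'⟩
        refine ⟨inv_mem hA, hA'.inv_left.congr ?_⟩
        have : pauliClass A⁻¹ (inv_mem hA) = pauliClass A hA := by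
          refine Eq.trans ?_ (inv_eq_of_mul_eq_one_left (pauliClass_mul_self hA))
          rfl
        rw [this] }
  have hle : PauliGroup n ≤ S := by
    rw [← pauliFrom_one]
    refine pauliFrom_le (fun i h3 h4 => ?_) (fun i h3 h4 => ?_) ?_
    · have hm : pX n i ∈ PauliGroup n := by rw [← pauliFrom_one]; exact pX_mem h3 h4
      exact ⟨hm, (hX i h3 h4).congr ⟨fun ⟨_, h⟩ => h, fun h => ⟨hm, h⟩⟩⟩
    · have hm : pZ n i ∈ PauliGroup n := by rw [← pauliFrom_one]; exact pZ_mem h3 h4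
      exact ⟨hm, (hZ i h3 h4).congr ⟨fun ⟨_, h⟩ => h, fun h => ⟨hm, h⟩⟩⟩
    · exact ⟨phaseI_mem n, (SignComm.of_commute (commute_phaseI Q).symm).congr
        (iff_of_true trivial (by rw [pauliClass_phaseI, map_one]))⟩
  exact (hle hP).2

/-- The inertia subgroup of a non-trivial irreducible representation is the stabilizer, up to
sign, of a Pauli operator. -/
theorem mem_inertiaSubgroup_iff_act (hρ : ρ.IsIrreducible) {Q : UnitaryN n}
    (hQ : Q ∈ PauliGroup n) (hQQ : Q * Q = 1)
    (hs : ∀ P hP, SignComm (ρ (pauliClass P hP) = 1) P Q) {c : ProjClifford n} :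
    c ∈ inertiaSubgroup ρ ↔ cliffAct n c Q = Q ∨ cliffAct n c Q = -Q := by
  rw [mem_inertiaSubgroup_iff hρ]
  constructor
  · intro h
    refine eq_or_eq_neg_of_commute (cliffAct_mem_pauliGroup c hQ) hQ
      (by rw [← cliffAct_map_mul, hQQ, cliffAct_map_one]) hQQ fun R hR => ?_
    -- Pulling R back by c shows that Q and its image have the same commutation sign with R, so
    -- their product is central.
    have hR' := cliffAct_mem_pauliGroup c⁻¹ hR
    have e : cliffAct n c (cliffAct n c⁻¹ R) = R := by
      rw [← cliffAct_mul, mul_inv_cancel, cliffAct_one]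
    have h2 := h (pauliClass _ hR')
    rw [conjNormal_pauliClass] at h2
    simp only [e] at h2
    have h3 := (hs _ hR').map c
    rw [e, ← h2] at h3
    exact (hs R hR).commute_mul h3
  · intro h q
    obtain ⟨P, hP, rfl⟩ := exists_pauliClass q
    rw [conjNormal_pauliClass]
    have h2 := hs _ (cliffAct_mem_pauliGroup c hP)
    have h3 : SignComm (ρ (pauliClass P hP) = 1) (cliffAct n c P) Q := by
      have h4 := (hs P hP).map c
      rcases h with h | h
      · rwa [h] at h4
      · rw [h] at h4
        have := h4.right_neg
        rwa [neg_neg] at this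
    have h4 := h2.iff_of h3
    rcases representation_eq_one_or hρ (pauliClass P hP) with h5 | h5
    · rw [h5, h4.2 h5]
    · by_cases h6 : ρ (pauliClass P hP) = 1
      · rw [h6, h4.2 h6]
      · rw [h5]
        exact (representation_eq_one_or hρ _).resolve_left fun h7 => h6 (h4.1 h7)

/-- Non-triviality makes Q noncentral, so some v carries Z_1 to Q. Conjugation by v then identifies
the stabilizers of ±Z_1 and ±Q. -/
theorem nonempty_inertiaSubgroup_equiv (hn : 1 ≤ n) (hρ : ρ.IsIrreducible) (hne : ∃ p, ρ p ≠ 1) :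
    Nonempty (inertiaSubgroup ρ ≃* clCent (gS n 1 * gS n 1)) := by
  obtain ⟨Q, hQ, hQQ, hs⟩ := exists_signComm_representation hρ hne
  have hnc : ¬ ∀ P ∈ PauliGroup n, Commute P Q := by
    intro h
    obtain ⟨p, hp⟩ := hne
    obtain ⟨P, hP, rfl⟩ := exists_pauliClass p
    exact hp (((hs P hP).iff_of (SignComm.of_commute (h P hP))).2 trivial)
  obtain ⟨v, -, hv⟩ := exists_act_pZ le_rfl hn (by rwa [pauliFrom_one]) hQQ
    (by rintro rfl; exact hnc fun P _ => Commute.one_right P)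
    (by rintro rfl; exact hnc fun P _ => (Commute.one_right P).neg_right)
  have hmap : (clCent (gS n 1 * gS n 1)).map (MulAut.conj v).toMonoidHom = inertiaSubgroup ρ := by
    ext c
    rw [mem_inertiaSubgroup_iff_act hρ hQ hQQ hs, ← hv]
    constructor
    · rintro ⟨w, hw, rfl⟩
      rw [SetLike.mem_coe, mem_centralizer_sq hn] at hw
      have e : cliffAct n (v * w * v⁻¹) (cliffAct n v (pZ n 1))
          = cliffAct n v (cliffAct n w (pZ n 1)) := by
        rw [← cliffAct_mul, inv_mul_cancel_right, cliffAct_mul]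
      change cliffAct n (v * w * v⁻¹) _ = _ ∨ cliffAct n (v * w * v⁻¹) _ = _
      rw [e]
      rcases hw with h | h <;> rw [h]
      · exact Or.inl rfl
      · exact Or.inr (cliffAct_neg _ _)
    · intro h
      refine ⟨v⁻¹ * c * v, ?_, ?_⟩
      · rw [SetLike.mem_coe, mem_centralizer_sq hn, mul_assoc, cliffAct_mul, cliffAct_mul]
        have e : cliffAct n v⁻¹ (cliffAct n v (pZ n 1)) = pZ n 1 := by
          rw [← cliffAct_mul, inv_mul_cancel, cliffAct_one]
        rcases h with h | h <;> rw [h]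
        · exact Or.inl e
        · rw [cliffAct_neg, e]; exact Or.inr rfl
      · change v * (v⁻¹ * c * v) * v⁻¹ = c
        simp only [mul_assoc, mul_inv_cancel_left, mul_inv_cancel, mul_one]
  exact ⟨(((clCent (gS n 1 * gS n 1)).equivMapOfInjective _ (MulAut.conj v).injective).trans
    (MulEquiv.subgroupCongr hmap)).symm⟩

end Representation

end

/-! ### The main theorem -/

theorem mainTheorem4 (n : ℕ) (hn : 2 ≤ n) :
    -- generators of the two centralizers
    clCent (clS n 1 ^ 2) = Subgroup.closure (Set.range (INSymbol.toClifford hn)) ∧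
    clCent (clS n 1) = Subgroup.closure (INSymbol.toClifford hn '' {x | x ≠ INSymbol.g}) ∧
    -- the centralizer of `s_1 ^ 2` is the internal semidirect product `⟨g⟩ ⋉ Cent(s_1)`
    Subgroup.zpowers (clG n) ≤ clCent (clS n 1 ^ 2) ∧
    clCent (clS n 1) ≤ clCent (clS n 1 ^ 2) ∧
    ((clCent (clS n 1)).subgroupOf (clCent (clS n 1 ^ 2))).Normal ∧
    Subgroup.IsComplement' ((Subgroup.zpowers (clG n)).subgroupOf (clCent (clS n 1 ^ 2)))
      ((clCent (clS n 1)).subgroupOf (clCent (clS n 1 ^ 2))) ∧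
    -- the presentation: the symbols are sent to the elements that they name
    (∃ e : INPresented n ≃* clCent (clS n 1 ^ 2),
        ∀ x : INSymbol n, (e (PresentedGroup.of x) : ProjClifford n) = x.toClifford hn) ∧
    -- the explicit subgroup `IN_n` is isomorphic to both groups
    (Nonempty (explicitIN n hn ≃* clCent (clS n 1 ^ 2)) ∧
      Nonempty (explicitIN n hn ≃* INPresented n)) ∧
    -- and so is the inertia subgroup of every non-trivial irreducible representation
    -- of the projective Pauli group
    (∀ (V : Type*) [AddCommGroup V] [Module ℂ V] (ρ : Representation ℂ (ProjPauli n) V),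
        ρ.IsIrreducible → (∃ p, ρ p ≠ 1) →
        Nonempty (inertiaSubgroup ρ ≃* clCent (clS n 1 ^ 2)) ∧
        Nonempty (inertiaSubgroup ρ ≃* INPresented n)) := by
  rw [clS_eq ⟨le_rfl, by omega⟩, clG_eq (by omega), pow_two, closure_toClifford_ne,
    centralizer_gS (by omega)]
  have hn1 : 1 ≤ n := by omega
  refine ⟨centralizer_sq_eq hn, rfl, zpowers_gG_le hn1, cliffGates_le hn1, cliffGates_normal hn1,
    isComplement_zpowers_gG hn1, ⟨presentedEquiv hn, presentedEquiv_of hn⟩,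
    ⟨⟨explicitEquiv hn⟩, ⟨(explicitEquiv hn).trans (presentedEquiv hn).symm⟩⟩, ?_⟩
  intro V _ _ ρ hρ hne
  obtain ⟨e⟩ := nonempty_inertiaSubgroup_equiv hn1 hρ hne
  exact ⟨⟨e⟩, ⟨e.trans (presentedEquiv hn).symm⟩⟩
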